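/- Let $1<p<\infty$. For an open set $\Omega\subset\mathbb R^2$ let $X_p(\Omega)=W^{2,p}(\Omega)\cap W^{1,p}_0(\Omega)$ (real-valued functions, $W^{2,p}$ norm). Let $\Omega,\tilde\Omega\subset\mathbb R^2$ be open. A homeomorphism $\phi\colon\Omega\to\tilde\Omega$ is called $p$-admissible if its weak derivatives of first and second order exist and are bounded, $\inf_\Omega|\det D\phi|>0$ (essential infimum), and the Laplacian $\Delta\colon X_p\to L^p$ is bijective on both $\Omega$ and $\tilde\Omega$. For such $\phi$ let $$T=\Delta_\Omega^{-1}\colon L^p(\Omega)\to X_p(\Omega)\hookrightarrow L^p(\Omega),\qquad T_\phi u=\bigl(\Delta_{\tilde\Omega}^{-1}(u\circ\phi^{-1})\bigr)\circ\phi ,$$ $$M_\phi=D\phi^{-1}D\phi^{-t}\,|\det D\phi|-I=\begin{pmatrix}a&b\\c&d\end{pmatrix},$$ $$K_\phi=\|a\|_{L^\infty(\Omega)}+\|b\|_{L^\infty(\Omega)}+\|c\|_{L^\infty(\Omega)}+\|d\|_{L^\infty(\Omega)}+\|a_x+b_y\|_{L^\infty(\Omega)}+\|c_x+d_y\|_{L^\infty(\Omega)}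 .$$ (i) For every $p$-admissible $\phi\colon\Omega\to\tilde\Omega$: composition with $\phi$ and with $\phi^{-1}$ are well-defined maps $L^p(\tilde\Omega)\to L^p(\Omega)$ and $L^p(\Omega)\to L^p(\tilde\Omega)$; the entries of $M_\phi$ lie in $W^{1,\infty}(\Omega)$, so $K_\phi<\infty$; the norms $\|\Delta_\Omega^{-1}\|_{L^p(\Omega)\to W^{2,p}(\Omega)}$ and $\|\Delta_{\tilde\Omega}^{-1}\|_{L^p(\tilde\Omega)\to L^p(\tilde\Omega)}$ are finite; $T$ and $T_\phi$ are bounded linear operators on $L^p(\Omega)$; and $$\|T-T_\phi\|_{L^p(\Omega)\to L^p(\Omega)}\le \frac{C}{\inf_\Omega|\det D\phi|}\Bigl(\bigl\|1-|\det D\phi|\bigr\|_{L^\infty(\Omega)}+K_\phi\Bigr),$$ where $$C=C_p\,\|\Delta_{\tilde\Omega}^{-1}\|_{L^p(\tilde\Omega)\to L^p(\tilde\Omega)}\bigl(1+\|\Delta_\Omega^{-1}\|_{L^p(\Omega)\to W^{2,p}(\Omega)}\bigr)$$ and $C_p>0$ depends only on $p$. In particular, $C$ depends only on $p$, $\Omega$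 and $\tilde\Omega$, and not otherwise on $\phi$. (ii) $K_\phi\to0$ as $\|\mathrm{id}-\phi\|_{W^{2,\infty}(\Omega;\mathbb R^2)}\to0$: for every $\varepsilon>0$ there is $\delta>0$ (independent of $\Omega$, $\tilde\Omega$ and $\phi$) such that every $p$-admissible $\phi\colon\Omega\to\tilde\Omega$ with $\|\mathrm{id}-\phi\|_{W^{2,\infty}(\Omega;\mathbb R^2)}<\delta$ satisfies $K_\phi<\varepsilon$. -/

import Mathlib

open MeasureTheory Set Filter Topology
open scoped ENNReal

noncomputable section

namespace DirichletPerturbation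

/-- The Euclidean plane. -/
abbrev Plane : Type := EuclideanSpace ℝ (Fin 2)

/-- Lebesgue measure on the open set `Ω`. -/
abbrev vol (Ω : TopologicalSpace.Opens Plane) : Measure Plane :=
  (volume : Measure Plane).restrict (Ω : Set Plane)

/-- The (real) Lebesgue space `L^p(Ω)`. -/
abbrev LpOn (p : ℝ≥0∞) (Ω : TopologicalSpace.Opens Plane) := Lp ℝ p (vol Ω)

/-- The classical partial derivative `∂f/∂x_i`. -/
def classicalPartial (i : Fin 2) (f : Plane → ℝ) (x : Plane) : ℝ :=
  fderiv ℝ f x (EuclideanSpace.single i 1)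

open scoped ContDiff in
/-- `ψ ∈ C_c^∞(Ω)`. -/
structure IsTestFunction (Ω : TopologicalSpace.Opens Plane) (ψ : Plane → ℝ) : Prop where
  smooth : ContDiff ℝ ∞ ψ
  compact : HasCompactSupport ψ
  support : tsupport ψ ⊆ (Ω : Set Plane)

/-- `g` is a weak partial derivative of `f` on `Ω` in the direction `x_i`. -/
structure HasWeakPartial (Ω : TopologicalSpace.Opens Plane) (i : Fin 2) (f g : Plane → ℝ) :
    Prop where
  locInt : LocallyIntegrableOn f (Ω : Set Plane) volume
  locInt_deriv : LocallyIntegrableOn g (Ω : Set Plane) volume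
  integral_eq : ∀ ψ, IsTestFunction Ω ψ →
    ∫ x in (Ω : Set Plane), f x * classicalPartial i ψ x = - ∫ x in (Ω : Set Plane), g x * ψ x

open Classical in
/-- The weak partial derivative, which is unique almost everywhere on `Ω`
(and `0` by convention where it does not exist). -/
def weakPartial (Ω : TopologicalSpace.Opens Plane) (i : Fin 2) (f : Plane → ℝ) : Plane → ℝ :=
  if h : ∃ g, HasWeakPartial Ω i f g then h.choose else 0

/-- Membership in the Sobolev space `W^{k,p}(Ω)`. -/
def MemSobolev : ℕ → ℝ≥0∞ → TopologicalSpace.Opens Plane → (Plane → ℝ) → Prop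
  | 0, p, Ω, f => MemLp f p (vol Ω)
  | k + 1, p, Ω, f =>
      MemLp f p (vol Ω) ∧ ∀ i, ∃ g, HasWeakPartial Ω i f g ∧ MemSobolev k p Ω g

/-- The norm of `W^{k,p}(Ω)`: the sum of the `L^p` norms of the weak derivatives up to order `k`. -/
def sobolevNorm : ℕ → ℝ≥0∞ → TopologicalSpace.Opens Plane → (Plane → ℝ) → ℝ≥0∞
  | 0, p, Ω, f => eLpNorm f p (vol Ω)
  | k + 1, p, Ω, f => eLpNorm f p (vol Ω) + ∑ i, sobolevNorm k p Ω (weakPartial Ω i f)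

/-- Membership in `W_0^{1,p}(Ω)`, the closure of `C_c^∞(Ω)` in `W^{1,p}(Ω)`. -/
def MemSobolevZero (p : ℝ≥0∞) (Ω : TopologicalSpace.Opens Plane) (f : Plane → ℝ) : Prop :=
  MemSobolev 1 p Ω f ∧
    ∀ ε : ℝ≥0∞, 0 < ε → ∃ ψ, IsTestFunction Ω ψ ∧ sobolevNorm 1 p Ω (f - ψ) < ε

/-- The weak Laplacian. -/
def weakLaplacian (Ω : TopologicalSpace.Opens Plane) (f : Plane → ℝ) (x : Plane) : ℝ :=
  ∑ i, weakPartial Ω i (weakPartial Ω i f) x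

section Basic

variable {Ω : TopologicalSpace.Opens Plane} {i : Fin 2} {p : ℝ≥0∞} {f f' g g' ψ : Plane → ℝ}

theorem IsTestFunction.continuous_partial (h : IsTestFunction Ω ψ) (i : Fin 2) :
    Continuous (classicalPartial i ψ) :=
  (h.smooth.continuous_fderiv (by simp)).clm_apply continuous_const

theorem tsupport_classicalPartial_subset (i : Fin 2) (ψ : Plane → ℝ) :
    tsupport (classicalPartial i ψ) ⊆ tsupport ψ :=
  tsupport_fderiv_apply_subset ℝ _

theorem integrableOn_mul_of_locallyIntegrableOn (hf : LocallyIntegrableOn f (Ω : Set Plane) volume)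
    (hc : Continuous g) (hs : HasCompactSupport g) (hsub : tsupport g ⊆ (Ω : Set Plane)) :
    IntegrableOn (fun x => f x * g x) (Ω : Set Plane) volume := by
  have h1 : IntegrableOn (fun x => f x * g x) (tsupport g) volume :=
    (hf.integrableOn_compact_subset hsub hs).mul_continuousOn hc.continuousOn hs
  refine h1.of_forall_sdiff_eq_zero Ω.isOpen.measurableSet ?_
  intro x hx
  rw [image_eq_zero_of_notMem_tsupport hx.2, mul_zero]

theorem HasWeakPartial.integrableOn_left (h : HasWeakPartial Ω i f g) (hψ : IsTestFunction Ω ψ) :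
    IntegrableOn (fun x => f x * classicalPartial i ψ x) (Ω : Set Plane) volume := by
  refine integrableOn_mul_of_locallyIntegrableOn h.locInt (hψ.continuous_partial i) ?_ ?_
  · exact hψ.compact.of_isClosed_subset (isClosed_tsupport _)
      (tsupport_classicalPartial_subset i ψ)
  · exact (tsupport_classicalPartial_subset i ψ).trans hψ.support

theorem HasWeakPartial.integrableOn_right (h : HasWeakPartial Ω i f g)
    (hψ : IsTestFunction Ω ψ) :
    IntegrableOn (fun x => g x * ψ x) (Ω : Set Plane) volume :=
  integrableOn_mul_of_locallyIntegrableOn h.locInt_deriv hψ.smooth.continuous hψ.compact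
    hψ.support

theorem HasWeakPartial.unique (h : HasWeakPartial Ω i f g) (h' : HasWeakPartial Ω i f g') :
    g =ᵐ[vol Ω] g' := by
  have key : ∀ᵐ x ∂(volume : Measure Plane), x ∈ (Ω : Set Plane) → (g - g') x = 0 := by
    refine Ω.isOpen.ae_eq_zero_of_integral_contDiff_smul_eq_zero
      (h.locInt_deriv.sub h'.locInt_deriv) ?_
    intro ψ h1 h2 h3
    have hψ : IsTestFunction Ω ψ := ⟨h1, h2, h3⟩
    have e1 := h.integral_eq ψ hψ
    have e2 := h'.integral_eq ψ hψ
    have e3 : ∫ x in (Ω : Set Plane), (g x * ψ x - g' x * ψ x) = 0 := by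
      rw [integral_sub (h.integrableOn_right hψ) (h'.integrableOn_right hψ)]
      linarith
    rw [← e3, ← setIntegral_eq_integral_of_forall_compl_eq_zero (s := (Ω : Set Plane))]
    · refine integral_congr_ae (Eventually.of_forall fun x => ?_)
      simp only [Pi.sub_apply, smul_eq_mul]
      ring
    · intro x hx
      rw [image_eq_zero_of_notMem_tsupport (fun hx' => hx (h3 hx')), zero_smul]
  have := (ae_restrict_iff' Ω.isOpen.measurableSet).2 key
  filter_upwards [this] with x hx
  exact sub_eq_zero.1 hx

theorem HasWeakPartial.add (h : HasWeakPartial Ω i f g) (h' : HasWeakPartial Ω i f' g') :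
    HasWeakPartial Ω i (f + f') (g + g') := by
  refine ⟨h.locInt.add h'.locInt, h.locInt_deriv.add h'.locInt_deriv, fun ψ hψ => ?_⟩
  simp only [Pi.add_apply, add_mul]
  rw [integral_add (h.integrableOn_left hψ) (h'.integrableOn_left hψ),
    integral_add (h.integrableOn_right hψ) (h'.integrableOn_right hψ),
    h.integral_eq ψ hψ, h'.integral_eq ψ hψ]
  ring

theorem HasWeakPartial.const_smul (c : ℝ) (h : HasWeakPartial Ω i f g) :
    HasWeakPartial Ω i (c • f) (c • g) := by
  refine ⟨h.locInt.smul c, h.locInt_deriv.smul c, fun ψ hψ => ?_⟩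
  simp only [Pi.smul_apply, smul_eq_mul, mul_assoc]
  rw [integral_const_mul, integral_const_mul, h.integral_eq ψ hψ]
  ring

theorem locallyIntegrableOn_congr (hf : LocallyIntegrableOn f (Ω : Set Plane) volume)
    (e : f =ᵐ[vol Ω] f') : LocallyIntegrableOn f' (Ω : Set Plane) volume := by
  rw [locallyIntegrableOn_iff Ω.isOpen.isLocallyClosed] at hf ⊢
  intro K hK hc
  exact (hf K hK hc).congr (ae_restrict_of_ae_restrict_of_subset hK e)

theorem HasWeakPartial.congr (h : HasWeakPartial Ω i f g) (ef : f =ᵐ[vol Ω] f')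
    (eg : g =ᵐ[vol Ω] g') : HasWeakPartial Ω i f' g' := by
  refine ⟨locallyIntegrableOn_congr h.locInt ef, locallyIntegrableOn_congr h.locInt_deriv eg,
    fun ψ hψ => ?_⟩
  have e1 : ∫ x in (Ω : Set Plane), f' x * classicalPartial i ψ x
      = ∫ x in (Ω : Set Plane), f x * classicalPartial i ψ x :=
    integral_congr_ae (by filter_upwards [ef] with x hx; rw [hx])
  have e2 : ∫ x in (Ω : Set Plane), g' x * ψ x = ∫ x in (Ω : Set Plane), g x * ψ x :=
    integral_congr_ae (by filter_upwards [eg] with x hx; rw [hx])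
  rw [e1, e2, h.integral_eq ψ hψ]

theorem HasWeakPartial.weakPartial (h : HasWeakPartial Ω i f g) :
    HasWeakPartial Ω i f (weakPartial Ω i f) := by
  have h' : ∃ g, HasWeakPartial Ω i f g := ⟨g, h⟩
  unfold DirichletPerturbation.weakPartial
  rw [dif_pos h']
  exact h'.choose_spec

theorem HasWeakPartial.ae_eq (h : HasWeakPartial Ω i f g) :
    DirichletPerturbation.weakPartial Ω i f =ᵐ[vol Ω] g :=
  h.weakPartial.unique h

theorem IsTestFunction.hasWeakPartial (h : IsTestFunction Ω ψ) (i : Fin 2) :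
    HasWeakPartial Ω i ψ (classicalPartial i ψ) := by
  refine ⟨h.smooth.continuous.locallyIntegrable.locallyIntegrableOn _,
    (h.continuous_partial i).locallyIntegrable.locallyIntegrableOn _, fun χ hχ => ?_⟩
  have hz : ∀ (a b : Plane → ℝ), tsupport b ⊆ (Ω : Set Plane) →
      ∫ x in (Ω : Set Plane), a x * b x = ∫ x, a x * b x := by
    intro a b hb
    refine setIntegral_eq_integral_of_forall_compl_eq_zero fun x hx => ?_
    rw [image_eq_zero_of_notMem_tsupport (fun hx' => hx (hb hx')), mul_zero]
  rw [hz _ _ ((tsupport_classicalPartial_subset i χ).trans hχ.support), hz _ _ hχ.support]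
  refine integral_mul_fderiv_eq_neg_fderiv_mul_of_integrable ?_ ?_ ?_
    (fun x _ => h.smooth.differentiable (by simp) x)
    (fun x _ => hχ.smooth.differentiable (by simp) x)
  · exact ((h.continuous_partial i).mul hχ.smooth.continuous).integrable_of_hasCompactSupport
      hχ.compact.mul_left
  · refine (h.smooth.continuous.mul (hχ.continuous_partial i)).integrable_of_hasCompactSupport
      (HasCompactSupport.mul_right h.compact)
  · exact (h.smooth.continuous.mul hχ.smooth.continuous).integrable_of_hasCompactSupport
      hχ.compact.mul_left

theorem MemSobolev.memLp {k : ℕ} (h : MemSobolev k p Ω f) : MemLp f p (vol Ω) := by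
  cases k with
  | zero => exact h
  | succ k => exact h.1

theorem MemSobolev.add {k : ℕ} (h : MemSobolev k p Ω f) (h' : MemSobolev k p Ω f') :
    MemSobolev k p Ω (f + f') := by
  induction k generalizing f f' with
  | zero => exact MemLp.add h h'
  | succ k ih =>
    refine ⟨h.1.add h'.1, fun i => ?_⟩
    obtain ⟨g, h1, h2⟩ := h.2 i
    obtain ⟨g', h1', h2'⟩ := h'.2 i
    exact ⟨g + g', h1.add h1', ih h2 h2'⟩

theorem MemSobolev.const_smul {k : ℕ} (c : ℝ) (h : MemSobolev k p Ω f) :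
    MemSobolev k p Ω (c • f) := by
  induction k generalizing f with
  | zero => exact MemLp.const_smul h c
  | succ k ih =>
    refine ⟨h.1.const_smul c, fun i => ?_⟩
    obtain ⟨g, h1, h2⟩ := h.2 i
    exact ⟨c • g, h1.const_smul c, ih h2⟩

theorem MemSobolev.congr {k : ℕ} (h : MemSobolev k p Ω f) (e : f =ᵐ[vol Ω] f') :
    MemSobolev k p Ω f' := by
  cases k with
  | zero => exact (memLp_congr_ae e).1 h
  | succ k =>
    refine ⟨(memLp_congr_ae e).1 h.1, fun i => ?_⟩
    obtain ⟨g, h1, h2⟩ := h.2 i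
    exact ⟨g, h1.congr e (EventuallyEq.refl _ _), h2⟩

theorem MemSobolev.weakPartial {k : ℕ} (h : MemSobolev (k + 1) p Ω f) (i : Fin 2) :
    MemSobolev k p Ω (weakPartial Ω i f) := by
  obtain ⟨g, h1, h2⟩ := h.2 i
  exact h2.congr h1.ae_eq.symm

theorem MemSobolev.hasWeakPartial {k : ℕ} (h : MemSobolev (k + 1) p Ω f) (i : Fin 2) :
    HasWeakPartial Ω i f (DirichletPerturbation.weakPartial Ω i f) := by
  obtain ⟨g, h1, -⟩ := h.2 i
  exact h1.weakPartial

theorem sobolevNorm_one_eq {u : Fin 2 → Plane → ℝ} (h : ∀ i, HasWeakPartial Ω i f (u i)) :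
    sobolevNorm 1 p Ω f = eLpNorm f p (vol Ω) + ∑ i, eLpNorm (u i) p (vol Ω) := by
  simp only [sobolevNorm]
  congr 1
  exact Finset.sum_congr rfl fun i _ => eLpNorm_congr_ae (h i).ae_eq

theorem IsTestFunction.add (h : IsTestFunction Ω f) (h' : IsTestFunction Ω f') :
    IsTestFunction Ω (f + f') :=
  ⟨h.smooth.add h'.smooth, h.compact.add h'.compact,
    (tsupport_add f f').trans (union_subset h.support h'.support)⟩

theorem IsTestFunction.const_smul (c : ℝ) (h : IsTestFunction Ω f) :
    IsTestFunction Ω (c • f) :=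
  ⟨h.smooth.const_smul c, h.compact.smul_left,
    (closure_mono (Function.support_const_smul_subset c f)).trans h.support⟩

theorem HasWeakPartial.sub (h : HasWeakPartial Ω i f g) (h' : HasWeakPartial Ω i f' g') :
    HasWeakPartial Ω i (f - f') (g - g') := by
  have := h.add (h'.const_smul (-1))
  simpa [sub_eq_add_neg] using this

theorem MemSobolevZero.congr (h : MemSobolevZero p Ω f) (e : f =ᵐ[vol Ω] f') :
    MemSobolevZero p Ω f' := by
  refine ⟨h.1.congr e, fun ε hε => ?_⟩
  obtain ⟨ψ, hψ, hlt⟩ := h.2 ε hε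
  refine ⟨ψ, hψ, ?_⟩
  have e' : f - ψ =ᵐ[vol Ω] f' - ψ := e.sub (EventuallyEq.refl _ _)
  have hw : ∀ i, HasWeakPartial Ω i (f - ψ) (weakPartial Ω i f - classicalPartial i ψ) :=
    fun i => (h.1.hasWeakPartial i).sub (hψ.hasWeakPartial i)
  rw [sobolevNorm_one_eq hw] at hlt
  rw [sobolevNorm_one_eq fun i => (hw i).congr e' (EventuallyEq.refl _ _),
    ← eLpNorm_congr_ae e']
  exact hlt

theorem memSobolevZero_zero : MemSobolevZero p Ω (0 : Plane → ℝ) := by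
  have ht : IsTestFunction Ω (0 : Plane → ℝ) :=
    ⟨contDiff_const, HasCompactSupport.zero, by simp⟩
  have h0 : ∀ i, HasWeakPartial Ω i (0 : Plane → ℝ) 0 := fun i => by
    have := (ht.hasWeakPartial i).const_smul 0
    simpa using this
  refine ⟨⟨MemLp.zero', fun i => ⟨0, h0 i, MemLp.zero'⟩⟩, fun ε hε => ⟨0, ht, ?_⟩⟩
  rw [sub_zero, sobolevNorm_one_eq h0]
  simpa using hε

theorem MemSobolevZero.add (hp : 1 ≤ p) (h : MemSobolevZero p Ω f)
    (h' : MemSobolevZero p Ω f') : MemSobolevZero p Ω (f + f') := by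
  refine ⟨h.1.add h'.1, fun ε hε => ?_⟩
  obtain ⟨ψ, hψ, hlt⟩ := h.2 (ε / 2) (ENNReal.half_pos hε.ne')
  obtain ⟨ψ', hψ', hlt'⟩ := h'.2 (ε / 2) (ENNReal.half_pos hε.ne')
  refine ⟨ψ + ψ', hψ.add hψ', ?_⟩
  have hw : ∀ i, HasWeakPartial Ω i (f - ψ) (weakPartial Ω i f - classicalPartial i ψ) :=
    fun i => (h.1.hasWeakPartial i).sub (hψ.hasWeakPartial i)
  have hw' : ∀ i, HasWeakPartial Ω i (f' - ψ') (weakPartial Ω i f' - classicalPartial i ψ') :=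
    fun i => (h'.1.hasWeakPartial i).sub (hψ'.hasWeakPartial i)
  have aes : ∀ {a : Plane → ℝ}, LocallyIntegrableOn a (Ω : Set Plane) volume →
      AEStronglyMeasurable a (vol Ω) := fun ha => ha.aestronglyMeasurable
  rw [sobolevNorm_one_eq hw] at hlt
  rw [sobolevNorm_one_eq hw'] at hlt'
  have e : f + f' - (ψ + ψ') = (f - ψ) + (f' - ψ') := by abel
  rw [e, sobolevNorm_one_eq fun i => (hw i).add (hw' i)]
  calc _ ≤ (eLpNorm (f - ψ) p (vol Ω) + eLpNorm (f' - ψ') p (vol Ω)) +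
        ∑ i, (eLpNorm (weakPartial Ω i f - classicalPartial i ψ) p (vol Ω) +
          eLpNorm (weakPartial Ω i f' - classicalPartial i ψ') p (vol Ω)) := by
        refine add_le_add (eLpNorm_add_le (aes (hw 0).locInt) (aes (hw' 0).locInt) hp)
          (Finset.sum_le_sum fun i _ =>
            eLpNorm_add_le (aes (hw i).locInt_deriv) (aes (hw' i).locInt_deriv) hp)
    _ = (eLpNorm (f - ψ) p (vol Ω) +
          ∑ i, eLpNorm (weakPartial Ω i f - classicalPartial i ψ) p (vol Ω)) +
        (eLpNorm (f' - ψ') p (vol Ω) +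
          ∑ i, eLpNorm (weakPartial Ω i f' - classicalPartial i ψ') p (vol Ω)) := by
        rw [Finset.sum_add_distrib, add_add_add_comm]
    _ < ε / 2 + ε / 2 := ENNReal.add_lt_add hlt hlt'
    _ = ε := ENNReal.add_halves ε

theorem MemSobolevZero.const_smul (c : ℝ) (h : MemSobolevZero p Ω f) :
    MemSobolevZero p Ω (c • f) := by
  rcases eq_or_ne c 0 with rfl | hc
  · rw [zero_smul]
    exact memSobolevZero_zero
  refine ⟨h.1.const_smul c, fun ε hε => ?_⟩
  have hc0 : ‖c‖ₑ ≠ 0 := by simpa using hc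
  obtain ⟨ψ, hψ, hlt⟩ := h.2 (ε / ‖c‖ₑ) (ENNReal.div_pos hε.ne' (by simp))
  refine ⟨c • ψ, hψ.const_smul c, ?_⟩
  have hw : ∀ i, HasWeakPartial Ω i (f - ψ) (weakPartial Ω i f - classicalPartial i ψ) :=
    fun i => (h.1.hasWeakPartial i).sub (hψ.hasWeakPartial i)
  rw [sobolevNorm_one_eq hw] at hlt
  rw [← smul_sub, sobolevNorm_one_eq fun i => (hw i).const_smul c]
  simp only [eLpNorm_const_smul]
  rw [← Finset.mul_sum, ← mul_add, mul_comm]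
  exact (ENNReal.lt_div_iff_mul_lt (Or.inl hc0) (Or.inl (by simp))).1 hlt

end Basic

/-- The space `X_p(Ω) = W^{2,p}(Ω) ∩ W_0^{1,p}(Ω)`, as a subspace of `L^p(Ω)`. -/
def sobolevX (p : ℝ≥0∞) [Fact (1 ≤ p)] (Ω : TopologicalSpace.Opens Plane) :
    Submodule ℝ (LpOn p Ω) where
  carrier := {u | MemSobolev 2 p Ω u ∧ MemSobolevZero p Ω u}
  add_mem' := fun {u v} hu hv =>
    ⟨(hu.1.add hv.1).congr (Lp.coeFn_add u v).symm,
      (hu.2.add Fact.out hv.2).congr (Lp.coeFn_add u v).symm⟩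
  zero_mem' := by
    have e : (0 : Plane → ℝ) =ᵐ[vol Ω] ((0 : LpOn p Ω) : Plane → ℝ) :=
      (Lp.coeFn_zero ℝ p (vol Ω)).symm
    have h0 : ∀ i, HasWeakPartial Ω i (0 : Plane → ℝ) 0 := fun i => by
      have := ((memSobolevZero_zero (p := p) (Ω := Ω)).1.hasWeakPartial i).const_smul 0
      simpa using this
    have h2 : MemSobolev 2 p Ω (0 : Plane → ℝ) :=
      ⟨MemLp.zero', fun i => ⟨0, h0 i, MemLp.zero', fun j => ⟨0, h0 j, MemLp.zero'⟩⟩⟩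
    exact ⟨h2.congr e, memSobolevZero_zero.congr e⟩
  smul_mem' := fun c u hu =>
    ⟨(hu.1.const_smul c).congr (Lp.coeFn_smul c u).symm,
      (hu.2.const_smul c).congr (Lp.coeFn_smul c u).symm⟩

section Laplacian

variable {Ω : TopologicalSpace.Opens Plane} {p : ℝ≥0∞} {f f' : Plane → ℝ}

theorem memLp_weakLaplacian (h : MemSobolev 2 p Ω f) : MemLp (weakLaplacian Ω f) p (vol Ω) :=
  memLp_finsetSum Finset.univ fun i _ => ((h.weakPartial i).weakPartial i).memLp

theorem weakLaplacian_congr (h : MemSobolev 2 p Ω f) (e : f =ᵐ[vol Ω] f') :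
    weakLaplacian Ω f' =ᵐ[vol Ω] weakLaplacian Ω f := by
  have key : ∀ i, weakPartial Ω i (weakPartial Ω i f') =ᵐ[vol Ω]
      weakPartial Ω i (weakPartial Ω i f) := fun i => by
    have h1 : weakPartial Ω i f' =ᵐ[vol Ω] weakPartial Ω i f :=
      ((h.hasWeakPartial i).congr e (EventuallyEq.refl _ _)).ae_eq
    exact (((h.weakPartial i).hasWeakPartial i).congr h1.symm (EventuallyEq.refl _ _)).ae_eq
  filter_upwards [ae_all_iff.2 key] with x hx
  exact Finset.sum_congr rfl fun i _ => hx i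

theorem weakLaplacian_add (h : MemSobolev 2 p Ω f) (h' : MemSobolev 2 p Ω f') :
    weakLaplacian Ω (f + f') =ᵐ[vol Ω] weakLaplacian Ω f + weakLaplacian Ω f' := by
  have key : ∀ i, weakPartial Ω i (weakPartial Ω i (f + f')) =ᵐ[vol Ω]
      weakPartial Ω i (weakPartial Ω i f) + weakPartial Ω i (weakPartial Ω i f') := fun i => by
    have h1 := ((h.hasWeakPartial i).add (h'.hasWeakPartial i)).ae_eq
    exact ((((h.weakPartial i).hasWeakPartial i).add
      ((h'.weakPartial i).hasWeakPartial i)).congr h1.symm (EventuallyEq.refl _ _)).ae_eq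
  filter_upwards [ae_all_iff.2 key] with x hx
  simp only [weakLaplacian, Pi.add_apply, ← Finset.sum_add_distrib]
  exact Finset.sum_congr rfl fun i _ => hx i

theorem weakLaplacian_smul (c : ℝ) (h : MemSobolev 2 p Ω f) :
    weakLaplacian Ω (c • f) =ᵐ[vol Ω] c • weakLaplacian Ω f := by
  have key : ∀ i, weakPartial Ω i (weakPartial Ω i (c • f)) =ᵐ[vol Ω]
      c • weakPartial Ω i (weakPartial Ω i f) := fun i => by
    have h1 := ((h.hasWeakPartial i).const_smul c).ae_eq
    exact ((((h.weakPartial i).hasWeakPartial i).const_smul c).congr h1.symm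
      (EventuallyEq.refl _ _)).ae_eq
  filter_upwards [ae_all_iff.2 key] with x hx
  simp only [weakLaplacian, Pi.smul_apply, Finset.smul_sum]
  exact Finset.sum_congr rfl fun i _ => hx i

end Laplacian

/-- The Dirichlet Laplacian `Δ : X_p(Ω) → L^p(Ω)`. -/
def dirichletLaplacian (p : ℝ≥0∞) [Fact (1 ≤ p)] (Ω : TopologicalSpace.Opens Plane) :
    sobolevX p Ω →ₗ[ℝ] LpOn p Ω where
  toFun u := (memLp_weakLaplacian u.2.1).toLp _
  map_add' u v := by
    rw [← MemLp.toLp_add, MemLp.toLp_eq_toLp_iff]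
    exact (weakLaplacian_congr (u.2.1.add v.2.1) (Lp.coeFn_add (u : LpOn p Ω) v).symm).trans
      (weakLaplacian_add u.2.1 v.2.1)
  map_smul' c u := by
    rw [RingHom.id_apply, ← MemLp.toLp_const_smul, MemLp.toLp_eq_toLp_iff]
    exact (weakLaplacian_congr (u.2.1.const_smul c) (Lp.coeFn_smul c (u : LpOn p Ω)).symm).trans
      (weakLaplacian_smul c u.2.1)

/-- `Δ : X_p(Ω) → L^p(Ω)` is invertible. -/
def LaplacianInvertible (p : ℝ≥0∞) [Fact (1 ≤ p)] (Ω : TopologicalSpace.Opens Plane) : Prop :=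
  Function.Bijective (dirichletLaplacian p Ω)

/-- The inverse Laplacian `T = Δ_Ω⁻¹ : L^p(Ω) → X_p(Ω) ↪ L^p(Ω)`. -/
def inverseLaplacian {p : ℝ≥0∞} [Fact (1 ≤ p)] {Ω : TopologicalSpace.Opens Plane}
    (h : LaplacianInvertible p Ω) : LpOn p Ω →ₗ[ℝ] LpOn p Ω :=
  (sobolevX p Ω).subtype ∘ₗ (LinearEquiv.ofBijective (dirichletLaplacian p Ω) h).symm.toLinearMap

/-- The norm of `Δ_Ω⁻¹` as an operator `L^p(Ω) → W^{k,p}(Ω)`. -/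
def inverseLaplacianNorm {p : ℝ≥0∞} [Fact (1 ≤ p)] {Ω : TopologicalSpace.Opens Plane}
    (h : LaplacianInvertible p Ω) (k : ℕ) : ℝ≥0∞ :=
  ⨆ (f : LpOn p Ω) (_ : ‖f‖ ≤ 1), sobolevNorm k p Ω (inverseLaplacian h f)

/-- The Jacobian matrix `Dφ` of weak partial derivatives of `φ` on `Ω`. -/
def jacobian (Ω : TopologicalSpace.Opens Plane) (φ : Plane → Plane) (x : Plane) :
    Matrix (Fin 2) (Fin 2) ℝ :=
  Matrix.of fun i j => weakPartial Ω j (fun y => φ y i) x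

/-- `inf_Ω |det Dφ|`. -/
def jacobianInf (Ω : TopologicalSpace.Opens Plane) (φ : Plane → Plane) : ℝ :=
  essInf (fun x => |(jacobian Ω φ x).det|) (vol Ω)

/-- The triple `(Ω, φ, Ω')` is `p`-admissible: `φ` is a homeomorphism of `Ω` onto `Ω'` whose weak
derivatives of first and second order are bounded, `|det Dφ|` is bounded away from zero, and the
Dirichlet Laplacian is invertible on both domains. -/
structure Admissible (p : ℝ≥0∞) [Fact (1 ≤ p)] (Ω Ω' : TopologicalSpace.Opens Plane)
    (φ : OpenPartialHomeomorph Plane Plane) : Prop where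
  source_eq : φ.source = (Ω : Set Plane)
  target_eq : φ.target = (Ω' : Set Plane)
  bounded : ∀ i j, ∃ g, HasWeakPartial Ω j (fun x => φ x i) g ∧ MemSobolev 1 ∞ Ω g
  inf_pos : 0 < jacobianInf Ω φ
  invertible_source : LaplacianInvertible p Ω
  invertible_target : LaplacianInvertible p Ω'

open Classical in
/-- The composition operator `C_φ : L^p(Ω') → L^p(Ω)`, `v ↦ v ∘ φ`
(`0` by convention where `v ∘ φ` is not in `L^p(Ω)`). -/
def compLp {p : ℝ≥0∞} {Ω Ω' : TopologicalSpace.Opens Plane} (φ : Plane → Plane)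
    (v : LpOn p Ω') : LpOn p Ω :=
  if h : MemLp (v ∘ φ) p (vol Ω) then h.toLp _ else 0

/-- `v ↦ v ∘ φ` is a well-defined map `L^p(Ω') → L^p(Ω)`. -/
def CompWellDefined (p : ℝ≥0∞) (Ω Ω' : TopologicalSpace.Opens Plane) (φ : Plane → Plane) : Prop :=
  (∀ v : Plane → ℝ, MemLp v p (vol Ω') → MemLp (v ∘ φ) p (vol Ω)) ∧
    ∀ v w : Plane → ℝ, v =ᵐ[vol Ω'] w → v ∘ φ =ᵐ[vol Ω] w ∘ φ

/-- The pulled-back inverse Laplacian `T_φ = C_φ ∘ Δ_{Ω'}⁻¹ ∘ C_{φ⁻¹} : L^p(Ω) → L^p(Ω)`. -/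
def pulledInverse {p : ℝ≥0∞} [Fact (1 ≤ p)] {Ω Ω' : TopologicalSpace.Opens Plane}
    (h : LaplacianInvertible p Ω') (φ : OpenPartialHomeomorph Plane Plane)
    (u : LpOn p Ω) : LpOn p Ω :=
  compLp φ (inverseLaplacian h (compLp φ.symm u))

/-- The matrix field `M_φ = Dφ⁻¹ Dφ⁻ᵗ |det Dφ| - I`. -/
def defectMatrix (Ω : TopologicalSpace.Opens Plane) (φ : Plane → Plane) (x : Plane) :
    Matrix (Fin 2) (Fin 2) ℝ :=
  |(jacobian Ω φ x).det| • ((jacobian Ω φ x)⁻¹ * ((jacobian Ω φ x)⁻¹).transpose) - 1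

/-- The constant `K_φ`: the sum of the `L^∞` norms of the entries of `M_φ` and of the
(row-wise) weak divergence of `M_φ`. -/
def constK (Ω : TopologicalSpace.Opens Plane) (φ : Plane → Plane) : ℝ≥0∞ :=
  (∑ i, ∑ j, eLpNorm (fun x => defectMatrix Ω φ x i j) ∞ (vol Ω)) +
    ∑ i, eLpNorm (fun x => ∑ j, weakPartial Ω j (fun y => defectMatrix Ω φ y i j) x) ∞ (vol Ω)

/-- The norm `‖id - φ‖` in `W^{2,∞}(Ω; ℝ²)`. -/
def distToId (Ω : TopologicalSpace.Opens Plane) (φ : Plane → Plane) : ℝ≥0∞ :=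
  ∑ i, sobolevNorm 2 ∞ Ω (fun x => x i - φ x i)

end DirichletPerturbation

end

/-!
An admissible `φ` has bounded weak derivatives of first and second order, so that its components
have locally Lipschitz gradients (`exists_classicalJacobian_regular`). Since `det Dφ` is bounded
away from zero, `φ` is a diffeomorphism whose inverse is again of class `C¹`
(`Admissible.isBoundedDiffeo`), the entries of `Dφ⁻¹` and of `M_φ` are smooth functions of `Dφ`,
and the values of `Dφ` stay in a compact set of invertible matrices. This gives `M_φ ∈ W^{1,∞}`
(`IsBoundedDiffeo.exists_bound_comp`), and part (ii), as `M_φ` is the value at `Dφ` of a fixed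
smooth function which vanishes at the identity matrix (`exists_constK_lt`).

For the estimate, let `f ∈ L^p(Ω)`, `u = Δ_Ω⁻¹ f`, `W = u ∘ φ⁻¹` and `v = Δ_Ω'⁻¹ (f ∘ φ⁻¹)`. Then
`W ∈ X_p(Ω')` (`IsBoundedDiffeo.memSobolev_two_comp_symm` and
`IsBoundedDiffeo.memSobolevZero_comp_symm`), and `ΔW = (|det Dφ|⁻¹ (Δu + div (M_φ ∇u))) ∘ φ⁻¹`
(`IsBoundedDiffeo.weakLaplacian_comp_symm`). Hence `Δ(W - v) = (|det Dφ|⁻¹ ((1 - |det Dφ|) f + div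
(M_φ ∇u))) ∘ φ⁻¹`, and `W - v` is the image of the right-hand side under `Δ_Ω'⁻¹`. Expanding the
divergence, the `L^p(Ω)` norm of `(1 - |det Dφ|) f + div (M_φ ∇u)` is at most `‖1 - |det Dφ|‖_∞
‖f‖_p + K_φ ‖u‖_{W^{2,p}}`. The change of variables from `Ω'` to `Ω` in `W - v` and the one from
`Ω` to `Ω'` in the right-hand side together cost the factor `1 / inf |det Dφ|`, so the inequality
holds with `C_p = 1` (`IsBoundedDiffeo.eLpNorm_sub_pulledInverse_le`). The norms of the inverse
Laplacians are finite by the closed graph theorem (`continuous_inverseLaplacianJet`).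

The chain rule behind these identities is obtained by duality
(`IsBoundedDiffeo.hasWeakPartial_comp_symm`): a test function on `Ω'` is pulled back and multiplied
by a column of `|det Dφ| Dφ⁻¹`, which is divergence free (`IsBoundedDiffeo.piola`). The result is
only locally Lipschitz, and weak derivatives may be tested against such functions by mollification
(`HasWeakPartial.integral_eq_of_locallyLipschitzOn`).
-/

namespace DirichletPerturbation

/-! ### Locally Lipschitz functions -/

section LocallyLipschitz

variable {Ω : TopologicalSpace.Opens Plane} {f g : Plane → ℝ}

/-- A property which holds almost everywhere near each point of `Ω` holds almost everywhere
on `Ω`. -/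
theorem ae_vol_of_locally {P : Plane → Prop}
    (h : ∀ x ∈ Ω, ∃ U ∈ 𝓝 x, ∀ᵐ y ∂(volume : Measure Plane), y ∈ U → P y) :
    ∀ᵐ y ∂(vol Ω), P y := by
  rw [ae_restrict_iff' Ω.isOpen.measurableSet, ae_iff]
  refine measure_null_of_locally_null _ fun x hx => ?_
  have hxΩ : x ∈ Ω := by
    by_contra hc
    exact hx fun h' => absurd h' hc
  obtain ⟨U, hU, hP⟩ := h x hxΩ
  rw [ae_iff] at hP
  refine ⟨{y | ¬ (y ∈ (Ω : Set Plane) → P y)} ∩ U,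
    inter_mem self_mem_nhdsWithin (mem_nhdsWithin_of_mem_nhds hU),
    measure_mono_null (fun y hy => ?_) hP⟩
  simp only [mem_inter_iff, mem_ofPred_eq, Classical.not_imp] at hy ⊢
  exact ⟨hy.2, hy.1.2⟩

theorem exists_lipschitzWith_eqOn (hf : LocallyLipschitzOn (Ω : Set Plane) f) {K : Set Plane}
    (hK : IsCompact K) (hKΩ : K ⊆ (Ω : Set Plane)) :
    ∃ (K' : Set Plane) (C : NNReal) (F : Plane → ℝ), IsCompact K' ∧ K ⊆ interior K' ∧
      K' ⊆ (Ω : Set Plane) ∧ LipschitzWith C F ∧ EqOn f F K' := by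
  obtain ⟨K', h1, h2, h3⟩ := exists_compact_between hK Ω.isOpen hKΩ
  obtain ⟨C, hC⟩ := (hf.mono h3).exists_lipschitzOnWith_of_compact h1
  obtain ⟨F, hF, e⟩ := hC.extend_real
  exact ⟨K', C, F, h1, h2, h3, hF, e⟩

/-- Rademacher's theorem for locally Lipschitz functions. -/
theorem ae_differentiableAt (hf : LocallyLipschitzOn (Ω : Set Plane) f) :
    ∀ᵐ x ∂(vol Ω), DifferentiableAt ℝ f x := by
  refine ae_vol_of_locally fun x hx => ?_
  obtain ⟨K, C, F, -, h2, -, hF, e⟩ := exists_lipschitzWith_eqOn hf (isCompact_singleton (x := x))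
    (singleton_subset_iff.2 hx)
  refine ⟨interior K, isOpen_interior.mem_nhds (h2 rfl), ?_⟩
  filter_upwards [hF.ae_differentiableAt] with y hy hyK
  exact hy.congr_of_eventuallyEq (e.eventuallyEq_of_mem (mem_interior_iff_mem_nhds.1 hyK))

theorem classicalPartial_congr {x : Plane} (e : f =ᶠ[𝓝 x] g) (i : Fin 2) :
    classicalPartial i f x = classicalPartial i g x := by
  simp only [classicalPartial, e.fderiv_eq]

theorem abs_classicalPartial_le_of_lipschitzWith {C : NNReal} (hf : LipschitzWith C f) (i : Fin 2)
    (x : Plane) : |classicalPartial i f x| ≤ C := by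
  have h := (fderiv ℝ f x).le_opNorm (EuclideanSpace.single i 1)
  rw [PiLp.norm_single, norm_one, mul_one] at h
  exact h.trans (norm_fderiv_le_of_lipschitz ℝ hf)

theorem exists_abs_classicalPartial_le (hf : LocallyLipschitzOn (Ω : Set Plane) f) {K : Set Plane}
    (hK : IsCompact K) (hKΩ : K ⊆ (Ω : Set Plane)) (i : Fin 2) :
    ∃ C : ℝ, ∀ x ∈ K, |classicalPartial i f x| ≤ C := by
  obtain ⟨K', C, F, -, h2, -, hF, e⟩ := exists_lipschitzWith_eqOn hf hK hKΩ
  refine ⟨C, fun x hx => ?_⟩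
  rw [classicalPartial_congr (e.eventuallyEq_of_mem (mem_interior_iff_mem_nhds.1 (h2 hx)))]
  exact abs_classicalPartial_le_of_lipschitzWith hF i x

theorem measurable_classicalPartial (i : Fin 2) (f : Plane → ℝ) :
    Measurable (classicalPartial i f) :=
  measurable_fderiv_apply_const ℝ f _

theorem locallyIntegrableOn_of_bounded (hm : AEStronglyMeasurable g (vol Ω))
    (hb : ∀ K : Set Plane, IsCompact K → K ⊆ (Ω : Set Plane) → ∃ C : ℝ, ∀ x ∈ K, |g x| ≤ C) :
    LocallyIntegrableOn g (Ω : Set Plane) volume := by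
  rw [locallyIntegrableOn_iff Ω.isOpen.isLocallyClosed]
  intro K hK hc
  obtain ⟨C, hC⟩ := hb K hc hK
  have : IsFiniteMeasure ((volume : Measure Plane).restrict K) := ⟨by simpa using hc.measure_lt_top⟩
  refine Integrable.of_bound (hm.mono_measure (Measure.restrict_mono hK le_rfl)) C ?_
  filter_upwards [ae_restrict_mem hc.measurableSet] with x hx using hC x hx

/-- The weak partial derivatives of a locally Lipschitz function are its classical ones. -/
theorem hasWeakPartial_of_locallyLipschitzOn (hf : LocallyLipschitzOn (Ω : Set Plane) f)
    (i : Fin 2) : HasWeakPartial Ω i f (classicalPartial i f) := by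
  refine ⟨hf.continuousOn.locallyIntegrableOn Ω.isOpen.measurableSet,
    locallyIntegrableOn_of_bounded (measurable_classicalPartial i f).aestronglyMeasurable
      fun K hK hc => exists_abs_classicalPartial_le hf hK hc i, fun ψ hψ => ?_⟩
  obtain ⟨K, C, F, -, h2, h3, hF, e⟩ := exists_lipschitzWith_eqOn hf hψ.compact hψ.support
  have hz : ∀ a b c : Plane → ℝ, tsupport b ⊆ tsupport ψ → (∀ x ∈ interior K, a x = c x) →
      ∫ x in (Ω : Set Plane), a x * b x = ∫ x, c x * b x := by
    intro a b c hb hac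
    rw [setIntegral_eq_integral_of_forall_compl_eq_zero]
    · refine integral_congr_ae (Eventually.of_forall fun x => ?_)
      by_cases hx : x ∈ tsupport b
      · simp only [hac x (h2 (hb hx))]
      · simp only [image_eq_zero_of_notMem_tsupport hx, mul_zero]
    · intro x hx
      rw [image_eq_zero_of_notMem_tsupport (fun hx' => hx (hψ.support (hb hx'))), mul_zero]
  rw [hz f _ F (tsupport_classicalPartial_subset i ψ) fun x hx => e (interior_subset hx),
    hz _ ψ (classicalPartial i F) subset_rfl fun x hx =>
      classicalPartial_congr (e.eventuallyEq_of_mem (mem_interior_iff_mem_nhds.1 hx)) i]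
  obtain ⟨D, hD⟩ := hψ.smooth.lipschitzWith_of_hasCompactSupport hψ.compact (by simp)
  have key := hF.integral_lineDeriv_mul_eq (μ := volume) hD hψ.compact (EuclideanSpace.single i 1)
  have e1 : ∫ x, lineDeriv ℝ F x (EuclideanSpace.single i 1) * ψ x
      = ∫ x, classicalPartial i F x * ψ x := by
    refine integral_congr_ae ?_
    filter_upwards [hF.ae_differentiableAt (μ := volume)] with x hx
    rw [hx.lineDeriv_eq_fderiv, classicalPartial]
  have e2 : ∫ x, lineDeriv ℝ ψ x (-EuclideanSpace.single i 1) * F x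
      = - ∫ x, F x * classicalPartial i ψ x := by
    rw [← integral_neg]
    refine integral_congr_ae (Eventually.of_forall fun x => ?_)
    simp only [classicalPartial]
    rw [lineDeriv_neg, (hψ.smooth.differentiable (by simp) x).lineDeriv_eq_fderiv]
    ring
  rw [e1, e2] at key
  linarith

theorem locallyLipschitzOn_of_contDiffAt {E F : Type*} [NormedAddCommGroup E] [NormedSpace ℝ E]
    [NormedAddCommGroup F] [NormedSpace ℝ F] {s : Set E} {f : E → F}
    (h : ∀ x ∈ s, ContDiffAt ℝ 1 f x) : LocallyLipschitzOn s f := by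
  intro x hx
  obtain ⟨K, t, ht, hl⟩ := (h x hx).exists_lipschitzOnWith
  exact ⟨K, t, mem_nhdsWithin_of_mem_nhds ht, hl⟩

theorem LocallyLipschitzOn.comp_of_mapsTo {E F G : Type*} [PseudoEMetricSpace E]
    [PseudoEMetricSpace F] [PseudoEMetricSpace G] {s : Set E} {t : Set F} {f : E → F} {g : F → G}
    (hg : LocallyLipschitzOn t g) (hf : LocallyLipschitzOn s f) (hst : MapsTo f s t) :
    LocallyLipschitzOn s (g ∘ f) := by
  intro x hx
  obtain ⟨Kg, u, hu, hl⟩ := hg (hst hx)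
  obtain ⟨Kf, v, hv, hl'⟩ := hf hx
  have hc := (hf.continuousOn x hx).tendsto_nhdsWithin hst
  refine ⟨Kg * Kf, v ∩ f ⁻¹' u, inter_mem hv (hc hu), ?_⟩
  exact hl.comp (hl'.mono inter_subset_left) fun y hy => hy.2

theorem locallyLipschitzOn_prodMk {E F G : Type*} [PseudoEMetricSpace E]
    [PseudoEMetricSpace F] [PseudoEMetricSpace G] {s : Set E} {f : E → F} {g : E → G}
    (hf : LocallyLipschitzOn s f) (hg : LocallyLipschitzOn s g) :
    LocallyLipschitzOn s fun x => (f x, g x) := by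
  intro x hx
  obtain ⟨Kf, u, hu, hl⟩ := hf hx
  obtain ⟨Kg, v, hv, hl'⟩ := hg hx
  exact ⟨max Kf Kg, u ∩ v, inter_mem hu hv, (hl.mono inter_subset_left).prodMk
    (hl'.mono inter_subset_right)⟩

theorem locallyLipschitzOn_pi {E ι : Type*} [Fintype ι] {F : ι → Type*} [PseudoEMetricSpace E]
    [∀ i, PseudoEMetricSpace (F i)] {s : Set E} {f : E → ∀ i, F i}
    (hf : ∀ i, LocallyLipschitzOn s fun x => f x i) : LocallyLipschitzOn s f := by
  intro x hx
  choose K u hu hl using fun i => hf i hx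
  refine ⟨Finset.univ.sup K, ⋂ i, u i, (iInter_mem).2 hu, fun y hy z hz => ?_⟩
  refine edist_pi_le_iff.2 fun i => ((hl i) (mem_iInter.1 hy i) (mem_iInter.1 hz i)).trans ?_
  gcongr
  exact Finset.le_sup (Finset.mem_univ i)

theorem LocallyLipschitzOn.mul_real {E : Type*} [PseudoEMetricSpace E] {s : Set E} {f g : E → ℝ}
    (hf : LocallyLipschitzOn s f) (hg : LocallyLipschitzOn s g) :
    LocallyLipschitzOn s fun x => f x * g x :=
  LocallyLipschitzOn.comp_of_mapsTo (t := univ) (g := fun q : ℝ × ℝ => q.1 * q.2)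
    (locallyLipschitzOn_of_contDiffAt fun _ _ => contDiffAt_fst.mul contDiffAt_snd)
    (locallyLipschitzOn_prodMk hf hg) (mapsTo_univ _ _)

end LocallyLipschitz

/-! ### Mollification -/

section Mollification

variable {Ω : TopologicalSpace.Opens Plane} {f g h h' : Plane → ℝ}

/-- A sequence of bump functions shrinking to the origin. -/
noncomputable def shrinkingBump (n : ℕ) : ContDiffBump (0 : Plane) where
  rIn := 1 / (2 * ((n : ℝ) + 1))
  rOut := 1 / ((n : ℝ) + 1)
  rIn_pos := by positivity
  rIn_lt_rOut := by
    apply one_div_lt_one_div_of_lt <;> linarith [(Nat.cast_nonneg n : (0 : ℝ) ≤ n)]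

theorem tendsto_rOut_shrinkingBump :
    Tendsto (fun n => (shrinkingBump n).rOut) atTop (𝓝 0) :=
  tendsto_one_div_add_atTop_nhds_zero_nat

open scoped Convolution in
/-- The mollification of `f` at the scale `1 / (n + 1)`. -/
noncomputable def mollify (n : ℕ) (f : Plane → ℝ) : Plane → ℝ :=
  (shrinkingBump n).normed volume ⋆[ContinuousLinearMap.lsmul ℝ ℝ, volume] f

theorem mollify_apply (n : ℕ) (f : Plane → ℝ) (x : Plane) :
    mollify n f x = ∫ t, (shrinkingBump n).normed volume (x - t) * f t := by
  simp only [mollify, convolution_eq_swap, ContinuousLinearMap.lsmul_apply, smul_eq_mul]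

theorem normed_shrinkingBump_eq_zero {n : ℕ} {x t : Plane}
    (h : t ∉ Metric.ball x (shrinkingBump n).rOut) :
    (shrinkingBump n).normed volume (x - t) = 0 := by
  rw [← Function.notMem_support, ContDiffBump.support_normed_eq]
  rw [Metric.mem_ball, dist_comm] at h
  simpa [dist_eq_norm] using h

open scoped ContDiff in
theorem contDiff_mollify (n : ℕ) (hf : LocallyIntegrable f) : ContDiff ℝ ∞ (mollify n f) :=
  (shrinkingBump n).hasCompactSupport_normed.contDiff_convolution_left _
    (shrinkingBump n).contDiff_normed hf

theorem ae_tendsto_mollify (hf : LocallyIntegrable f) :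
    ∀ᵐ x, Tendsto (fun n => mollify n f x) atTop (𝓝 (f x)) := by
  refine ContDiffBump.ae_convolution_tendsto_right_of_locallyIntegrable (K := 2)
    tendsto_rOut_shrinkingBump (Eventually.of_forall fun n => le_of_eq ?_) hf
  change 1 / ((n : ℝ) + 1) = 2 * (1 / (2 * ((n : ℝ) + 1)))
  field_simp

theorem abs_mollify_le {n : ℕ} {x : Plane} {C : ℝ}
    (h : ∀ᵐ t, t ∈ Metric.ball x (shrinkingBump n).rOut → |f t| ≤ C) : |mollify n f x| ≤ C := by
  have hi : Integrable (fun t => (shrinkingBump n).normed volume (x - t)) :=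
    (shrinkingBump n).integrable_normed.comp_sub_left x
  have h1 : ∫ t, (shrinkingBump n).normed volume (x - t) * C = C := by
    rw [integral_mul_const, integral_sub_left_eq_self, ContDiffBump.integral_normed, one_mul]
  rw [mollify_apply, ← Real.norm_eq_abs]
  refine (norm_integral_le_of_norm_le (hi.mul_const C) ?_).trans h1.le
  filter_upwards [h] with t ht
  have h0 := (shrinkingBump n).nonneg_normed (μ := volume) (x - t)
  by_cases hx : t ∈ Metric.ball x (shrinkingBump n).rOut
  · rw [norm_mul, Real.norm_of_nonneg h0]
    exact mul_le_mul_of_nonneg_left (ht hx) h0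
  · simp [normed_shrinkingBump_eq_zero hx]

open scoped ContDiff in
/-- Weak derivatives commute with mollification, at points whose distance to the complement of `Ω`
exceeds the scale. -/
theorem classicalPartial_mollify {i : Fin 2} (hw : HasWeakPartial Ω i h h') {n : ℕ} {x : Plane}
    (hx : Metric.closedBall x (shrinkingBump n).rOut ⊆ (Ω : Set Plane))
    (hf : LocallyIntegrable f) (ef : ∀ t ∈ Metric.ball x (shrinkingBump n).rOut, f t = h t)
    (eg : ∀ t ∈ Metric.ball x (shrinkingBump n).rOut, g t = h' t) :
    classicalPartial i (mollify n f) x = mollify n g x := by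
  set ρ := (shrinkingBump n).normed (volume : Measure Plane) with hρ
  have hρs : ContDiff ℝ ∞ ρ := (shrinkingBump n).contDiff_normed
  have hρc : HasCompactSupport ρ := (shrinkingBump n).hasCompactSupport_normed
  have hts : tsupport (fun t => ρ (x - t)) ⊆ Metric.closedBall x (shrinkingBump n).rOut := by
    refine closure_minimal (fun t ht => ?_) Metric.isClosed_closedBall
    by_contra hc
    exact ht (normed_shrinkingBump_eq_zero fun h => hc (Metric.ball_subset_closedBall h))
  have htest : IsTestFunction Ω fun t => ρ (x - t) :=
    ⟨hρs.comp (contDiff_const.sub contDiff_id),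
      (isCompact_closedBall _ _).of_isClosed_subset (isClosed_tsupport _) hts, hts.trans hx⟩
  have hd : ∀ t, classicalPartial i (fun t => ρ (x - t)) t
      = - fderiv ℝ ρ (x - t) (EuclideanSpace.single i 1) := by
    intro t
    have h1 : HasFDerivAt (fun t => x - t) (-ContinuousLinearMap.id ℝ Plane) t :=
      (hasFDerivAt_id t).const_sub x
    have h2 := ((hρs.differentiable (by simp) (x - t)).hasFDerivAt).comp t h1
    have h3 : fderiv ℝ (fun t => ρ (x - t)) t = _ := h2.fderiv
    rw [classicalPartial, h3]
    simp
  have hD := hρc.hasFDerivAt_convolution_left (ContinuousLinearMap.lsmul ℝ ℝ)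
    (hρs.of_le (by simp)) hf x
  have e0 : classicalPartial i (mollify n f) x
      = ∫ t, fderiv ℝ ρ (x - t) (EuclideanSpace.single i 1) * f t := by
    have : fderiv ℝ (mollify n f) x = _ := hD.fderiv
    rw [classicalPartial, this, convolution_eq_swap, ContinuousLinearMap.integral_apply]
    · rfl
    · have hex := (hρc.fderiv ℝ).convolutionExists_left
        ((ContinuousLinearMap.lsmul ℝ ℝ : ℝ →L[ℝ] ℝ →L[ℝ] ℝ).precompL Plane)
        (hρs.continuous_fderiv (by simp)) hf x
      exact hex.integrable_swap
  have hz : ∀ a b : Plane → ℝ, (∀ t ∉ (Ω : Set Plane), b t = 0) →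
      ∫ t in (Ω : Set Plane), a t * b t = ∫ t, a t * b t := fun a b hb =>
    setIntegral_eq_integral_of_forall_compl_eq_zero fun t ht => by rw [hb t ht, mul_zero]
  have key := hw.integral_eq _ htest
  rw [hz _ _ fun t ht => image_eq_zero_of_notMem_tsupport fun hc =>
      ht (htest.support (tsupport_classicalPartial_subset i _ hc)),
    hz _ _ fun t ht => image_eq_zero_of_notMem_tsupport fun hc => ht (htest.support hc)] at key
  have k1 : ∫ t, h t * classicalPartial i (fun t => ρ (x - t)) t
      = - ∫ t, fderiv ℝ ρ (x - t) (EuclideanSpace.single i 1) * f t := by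
    rw [← integral_neg]
    refine integral_congr_ae ?_
    -- `f` and `h` agree on the open ball only, but the sphere is a null set
    have hae : ∀ᵐ t, t ∉ Metric.sphere x (shrinkingBump n).rOut :=
      measure_eq_zero_iff_ae_notMem.1 (Measure.addHaar_sphere _ x _)
    filter_upwards [hae] with t ht
    by_cases hb : t ∈ Metric.ball x (shrinkingBump n).rOut
    · rw [ef t hb, hd]
      ring
    · have hc : t ∉ Metric.closedBall x (shrinkingBump n).rOut := by
        rw [← Metric.ball_union_sphere]
        exact fun h => h.elim hb ht
      have h0 : classicalPartial i (fun t => ρ (x - t)) t = 0 :=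
        image_eq_zero_of_notMem_tsupport fun hc' =>
          hc (hts (tsupport_classicalPartial_subset i _ hc'))
      have h1 := hd t
      rw [h0] at h1 ⊢
      rw [show fderiv ℝ ρ (x - t) (EuclideanSpace.single i 1) = 0 by linarith]
      simp
  have k2 : ∫ t, h' t * ρ (x - t) = mollify n g x := by
    rw [mollify_apply]
    refine integral_congr_ae (Eventually.of_forall fun t => ?_)
    by_cases hb : t ∈ Metric.ball x (shrinkingBump n).rOut
    · simp only [eg t hb, hρ, mul_comm]
    · simp [hρ, normed_shrinkingBump_eq_zero hb]
  rw [k1, k2] at key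
  rw [e0]
  linarith

/-- A locally Lipschitz function vanishing off a compact subset of `Ω` is a pointwise limit of test
functions which are supported in a fixed compact set and whose values and first derivatives are
uniformly bounded; the derivatives converge almost everywhere. -/
theorem exists_testFunction_approx (hf : LocallyLipschitzOn (Ω : Set Plane) f) {K : Set Plane}
    (hK : IsCompact K) (hKΩ : K ⊆ (Ω : Set Plane)) (h0 : ∀ x ∉ K, f x = 0) :
    ∃ (F : ℕ → Plane → ℝ) (K' : Set Plane) (C : ℝ), IsCompact K' ∧ K' ⊆ (Ω : Set Plane) ∧
      (∀ n, IsTestFunction Ω (F n)) ∧ (∀ n, ∀ x ∉ K', F n x = 0) ∧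
      (∀ n i, ∀ x ∉ K', classicalPartial i (F n) x = 0) ∧
      (∀ n x, |F n x| ≤ C) ∧ (∀ n i x, |classicalPartial i (F n) x| ≤ C) ∧
      (∀ᵐ x, Tendsto (fun n => F n x) atTop (𝓝 (f x))) ∧
      (∀ i, ∀ᵐ x, Tendsto (fun n => classicalPartial i (F n) x) atTop
        (𝓝 (classicalPartial i f x))) := by
  have hz : ∀ x ∉ K, f =ᶠ[𝓝 x] 0 := fun x hx => by
    filter_upwards [hK.isClosed.isOpen_compl.mem_nhds hx] with y hy using h0 y hy
  have hloc : LocallyLipschitzOn ((⊤ : TopologicalSpace.Opens Plane) : Set Plane) f := by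
    intro x _
    by_cases hx : x ∈ K
    · obtain ⟨C, t, ht, hl⟩ := hf (hKΩ hx)
      rw [Ω.isOpen.nhdsWithin_eq (hKΩ hx)] at ht
      exact ⟨C, t, mem_nhdsWithin_of_mem_nhds ht, hl⟩
    · refine ⟨0, Kᶜ, mem_nhdsWithin_of_mem_nhds (hK.isClosed.isOpen_compl.mem_nhds hx), ?_⟩
      intro y hy z hz
      simp [h0 y hy, h0 z hz]
  have hcont : Continuous f := by
    rw [← continuousOn_univ]
    exact hloc.continuousOn
  have hd0 : ∀ i, ∀ x ∉ K, classicalPartial i f x = 0 := fun i x hx => by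
    rw [classicalPartial_congr (hz x hx)]
    simp [classicalPartial]
  obtain ⟨C₀, hC₀⟩ := hK.exists_bound_of_continuousOn hcont.continuousOn
  choose C₁ hC₁ using fun i => exists_abs_classicalPartial_le hf hK hKΩ i
  set C := |C₀| + ∑ i, |C₁ i| with hC
  have hCnn : 0 ≤ C := by positivity
  have b0 : ∀ x, |f x| ≤ C := fun x => by
    by_cases hx : x ∈ K
    · have h1 := hC₀ x hx
      have h2 : 0 ≤ ∑ i, |C₁ i| := by positivity
      rw [Real.norm_eq_abs] at h1
      linarith [le_abs_self C₀]
    · rw [h0 x hx, abs_zero]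
      exact hCnn
  have b1 : ∀ i x, |classicalPartial i f x| ≤ C := fun i x => by
    by_cases hx : x ∈ K
    · have h1 := hC₁ i x hx
      have h2 : |C₁ i| ≤ ∑ i, |C₁ i| :=
        Finset.single_le_sum (f := fun i => |C₁ i|) (fun j _ => abs_nonneg _) (Finset.mem_univ i)
      linarith [le_abs_self (C₁ i), abs_nonneg C₀]
    · rw [hd0 i x hx, abs_zero]
      exact hCnn
  have hwp := fun i => hasWeakPartial_of_locallyLipschitzOn hloc i
  have hfi : LocallyIntegrable f := hcont.locallyIntegrable
  have hdi : ∀ i, LocallyIntegrable (classicalPartial i f) := fun i => by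
    have := (hwp i).locInt_deriv
    rwa [TopologicalSpace.Opens.coe_top, locallyIntegrableOn_univ] at this
  have hcomm : ∀ n i x, classicalPartial i (mollify n f) x = mollify n (classicalPartial i f) x :=
    fun n i x => classicalPartial_mollify (hwp i) (by simp) hfi (fun _ _ => rfl) fun _ _ => rfl
  obtain ⟨δ, hδ, hδΩ⟩ := hK.exists_cthickening_subset_open Ω.isOpen hKΩ
  obtain ⟨N, hN⟩ := ((tendsto_order.1 tendsto_rOut_shrinkingBump).2 δ hδ).exists_forall_of_atTop
  have hv : ∀ n, N ≤ n → ∀ a : Plane → ℝ, (∀ x ∉ K, a x = 0) →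
      ∀ x ∉ Metric.cthickening δ K, mollify n a x = 0 := by
    intro n hn a ha x hx
    rw [mollify_apply]
    refine integral_eq_zero_of_ae (Eventually.of_forall fun t => ?_)
    by_cases ht : t ∈ K
    · have : t ∉ Metric.ball x (shrinkingBump n).rOut := fun hb => hx <|
        Metric.mem_cthickening_of_dist_le x t δ K ht
          ((dist_comm x t).le.trans ((Metric.mem_ball.1 hb).le.trans (hN n hn).le))
      simp [normed_shrinkingBump_eq_zero this]
    · simp [ha t ht]
  have hcl := Metric.isClosed_cthickening (δ := δ) (E := K)
  have hcc : IsCompact (Metric.cthickening δ K) := hK.cthickening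
  have hts : ∀ n, tsupport (mollify (n + N) f) ⊆ Metric.cthickening δ K := fun n =>
    closure_minimal (fun x hx => by
      by_contra hc
      exact hx (hv _ (Nat.le_add_left N n) f h0 x hc)) hcl
  refine ⟨fun n => mollify (n + N) f, Metric.cthickening δ K, C, hcc, hδΩ,
    fun n => ⟨contDiff_mollify _ hfi, hcc.of_isClosed_subset (isClosed_tsupport _) (hts n),
      (hts n).trans hδΩ⟩, fun n x hx => hv _ (Nat.le_add_left N n) f h0 x hx,
    fun n i x hx => ?_, fun n x => ?_, fun n i x => ?_, ?_, fun i => ?_⟩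
  · rw [hcomm]
    exact hv _ (Nat.le_add_left N n) _ (hd0 i) x hx
  · exact abs_mollify_le (Eventually.of_forall fun t _ => b0 t)
  · rw [hcomm]
    exact abs_mollify_le (Eventually.of_forall fun t _ => b1 i t)
  · filter_upwards [ae_tendsto_mollify hfi] with x hx
    exact hx.comp (tendsto_add_atTop_nat N)
  · filter_upwards [ae_tendsto_mollify (hdi i)] with x hx
    simp only [hcomm]
    exact hx.comp (tendsto_add_atTop_nat N)

theorem tendsto_setIntegral_mul (hh : LocallyIntegrableOn h (Ω : Set Plane) volume)
    {F : ℕ → Plane → ℝ} {K : Set Plane} {C : ℝ} (hK : IsCompact K) (hKΩ : K ⊆ (Ω : Set Plane))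
    (hF : ∀ n, Continuous (F n)) (h0 : ∀ n, ∀ x ∉ K, F n x = 0) (hb : ∀ n x, |F n x| ≤ C)
    (hlim : ∀ᵐ x, Tendsto (fun n => F n x) atTop (𝓝 (f x))) :
    Tendsto (fun n => ∫ x in (Ω : Set Plane), h x * F n x) atTop
      (𝓝 (∫ x in (Ω : Set Plane), h x * f x)) := by
  refine tendsto_integral_of_dominated_convergence (K.indicator fun x => |h x| * C) ?_ ?_ ?_ ?_
  · exact fun n => hh.aestronglyMeasurable.mul (hF n).aestronglyMeasurable
  · have h1 : IntegrableOn (fun x => |h x| * C) K :=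
      ((hh.integrableOn_compact_subset hKΩ hK).abs).mul_const C
    exact ((integrable_indicator_iff hK.measurableSet).2 h1).restrict
  · refine fun n => Eventually.of_forall fun x => ?_
    by_cases hx : x ∈ K
    · rw [indicator_of_mem hx, norm_mul]
      exact mul_le_mul_of_nonneg_left (hb n x) (abs_nonneg _)
    · simp [h0 n x hx, indicator_of_notMem hx]
  · filter_upwards [ae_restrict_of_ae hlim] with x hx using hx.const_mul _

/-- Integration by parts against locally Lipschitz functions vanishing off a compact subset
of `Ω`. -/
theorem HasWeakPartial.integral_eq_of_locallyLipschitzOn {i : Fin 2} (hw : HasWeakPartial Ω i h h')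
    (hf : LocallyLipschitzOn (Ω : Set Plane) f) {K : Set Plane}
    (hK : IsCompact K) (hKΩ : K ⊆ (Ω : Set Plane)) (h0 : ∀ x ∉ K, f x = 0) :
    ∫ x in (Ω : Set Plane), h x * classicalPartial i f x
      = - ∫ x in (Ω : Set Plane), h' x * f x := by
  obtain ⟨F, K', C, hK', hKΩ', ht, hF, hF', hb, hb', hl, hl'⟩ :=
    exists_testFunction_approx hf hK hKΩ h0
  have t1 := tendsto_setIntegral_mul hw.locInt hK' hKΩ' (fun n => (ht n).continuous_partial i)
    (fun n => hF' n i) (fun n => hb' n i) (hl' i)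
  have t2 := tendsto_setIntegral_mul hw.locInt_deriv hK' hKΩ' (fun n => (ht n).smooth.continuous)
    hF hb hl
  refine tendsto_nhds_unique t1 ?_
  simp only [fun n => hw.integral_eq _ (ht n)]
  exact t2.neg

theorem locallyIntegrableOn_mul (hh : LocallyIntegrableOn h (Ω : Set Plane) volume)
    (hm : AEStronglyMeasurable g (vol Ω)) {C : ℝ} (hb : ∀ᵐ x ∂(vol Ω), |g x| ≤ C) :
    LocallyIntegrableOn (fun x => g x * h x) (Ω : Set Plane) volume := by
  rw [locallyIntegrableOn_iff Ω.isOpen.isLocallyClosed] at hh ⊢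
  intro K hK hc
  exact (hh K hK hc).bdd_mul (c := C) (hm.mono_measure (Measure.restrict_mono hK le_rfl))
    (ae_restrict_of_ae_restrict_of_subset hK hb)

/-- The product rule, for a bounded locally Lipschitz factor with bounded derivative. -/
theorem HasWeakPartial.mul_locallyLipschitzOn {i : Fin 2} (hw : HasWeakPartial Ω i h h')
    (hg : LocallyLipschitzOn (Ω : Set Plane) g) {C : ℝ} (hb : ∀ᵐ x ∂(vol Ω), |g x| ≤ C)
    (hb' : ∀ᵐ x ∂(vol Ω), |classicalPartial i g x| ≤ C) :
    HasWeakPartial Ω i (fun x => g x * h x)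
      (fun x => g x * h' x + classicalPartial i g x * h x) := by
  have hgm : AEStronglyMeasurable g (vol Ω) :=
    hg.continuousOn.aestronglyMeasurable Ω.isOpen.measurableSet
  have hgm' := (measurable_classicalPartial i g).aestronglyMeasurable (μ := vol Ω)
  have i1 := locallyIntegrableOn_mul hw.locInt hgm hb
  have i2 := locallyIntegrableOn_mul hw.locInt_deriv hgm hb
  have i3 := locallyIntegrableOn_mul hw.locInt hgm' hb'
  refine ⟨i1, i2.add i3, fun ψ hψ => ?_⟩
  have key := hw.integral_eq_of_locallyLipschitzOn (f := fun x => g x * ψ x)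
    (LocallyLipschitzOn.mul_real hg (locallyLipschitzOn_of_contDiffAt fun x _ =>
      (hψ.smooth.of_le (by simp)).contDiffAt)) hψ.compact hψ.support
    fun x hx => by rw [image_eq_zero_of_notMem_tsupport hx, mul_zero]
  have hs := (tsupport_classicalPartial_subset i ψ)
  have j1 := integrableOn_mul_of_locallyIntegrableOn i1 (hψ.continuous_partial i)
    (hψ.compact.of_isClosed_subset (isClosed_tsupport _) hs) (hs.trans hψ.support)
  have j2 := integrableOn_mul_of_locallyIntegrableOn i2 hψ.smooth.continuous hψ.compact hψ.support
  have j3 := integrableOn_mul_of_locallyIntegrableOn i3 hψ.smooth.continuous hψ.compact hψ.support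
  have e1 : ∫ x in (Ω : Set Plane), h x * classicalPartial i (fun x => g x * ψ x) x
      = (∫ x in (Ω : Set Plane), g x * h x * classicalPartial i ψ x)
        + ∫ x in (Ω : Set Plane), classicalPartial i g x * h x * ψ x := by
    rw [← integral_add j1 j3]
    refine integral_congr_ae ?_
    filter_upwards [ae_differentiableAt hg] with x hx
    have hd : HasFDerivAt (fun x => g x * ψ x) (g x • fderiv ℝ ψ x + ψ x • fderiv ℝ g x) x :=
      hx.hasFDerivAt.mul (hψ.smooth.differentiable (by simp) x).hasFDerivAt
    simp only [classicalPartial, hd.fderiv, add_apply, smul_apply,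
      smul_eq_mul]
    ring
  have e2 : ∫ x in (Ω : Set Plane), (g x * h' x + classicalPartial i g x * h x) * ψ x
      = (∫ x in (Ω : Set Plane), h' x * (g x * ψ x))
        + ∫ x in (Ω : Set Plane), classicalPartial i g x * h x * ψ x := by
    have : ∀ x, h' x * (g x * ψ x) = g x * h' x * ψ x := fun x => by ring
    simp only [this, add_mul]
    exact integral_add j2 j3
  rw [e2]
  linarith

end Mollification

/-! ### Regularity of functions with bounded or continuous weak derivatives -/

section Regularity

variable {Ω : TopologicalSpace.Opens Plane} {f : Plane → ℝ} {g : Fin 2 → Plane → ℝ}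

theorem sum_smul_single (v : Plane) : ∑ i, v i • (EuclideanSpace.single i 1 : Plane) = v := by
  ext j
  fin_cases j <;> simp [Fin.sum_univ_two]

theorem clm_apply_eq_sum {F : Type*} [NormedAddCommGroup F] [NormedSpace ℝ F] (L : Plane →L[ℝ] F)
    (v : Plane) : L v = ∑ i, v i • L (EuclideanSpace.single i 1) := by
  conv_lhs => rw [← sum_smul_single v]
  rw [map_sum]
  simp

theorem norm_clm_le_sum {F : Type*} [NormedAddCommGroup F] [NormedSpace ℝ F] (L : Plane →L[ℝ] F) :
    ‖L‖ ≤ ∑ i, ‖L (EuclideanSpace.single i 1)‖ := by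
  refine L.opNorm_le_bound (by positivity) fun v => ?_
  rw [clm_apply_eq_sum L v, Finset.sum_mul]
  refine (norm_sum_le _ _).trans (Finset.sum_le_sum fun i _ => ?_)
  rw [norm_smul, mul_comm]
  exact mul_le_mul_of_nonneg_left (PiLp.norm_apply_le v i) (norm_nonneg _)

/-- A function whose weak derivatives are bounded by `C` on a ball coincides almost everywhere on
every smaller concentric ball with a `2C`-Lipschitz function: its mollifications are `2C`-Lipschitz
there, hence so is `f` on the set where they converge to it, and `f` extends from that set. -/
theorem exists_lipschitzWith_of_hasWeakPartial (hw : ∀ i, HasWeakPartial Ω i f (g i)) {x : Plane}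
    {r R : ℝ} (hr : r < R) (hR : Metric.closedBall x R ⊆ (Ω : Set Plane)) {C : NNReal}
    (hC : ∀ i, ∀ᵐ y, y ∈ Metric.ball x R → |g i y| ≤ C) :
    ∃ H : Plane → ℝ, LipschitzWith (2 * C) H ∧ ∀ᵐ y, y ∈ Metric.ball x r → f y = H y := by
  set B := Metric.closedBall x R with hB
  have hBc : IsCompact B := isCompact_closedBall _ _
  have hloc : ∀ a : Plane → ℝ, LocallyIntegrableOn a (Ω : Set Plane) volume →
      LocallyIntegrable (B.indicator a) := fun a ha =>
    ((integrable_indicator_iff hBc.measurableSet).2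
      (ha.integrableOn_compact_subset hR hBc)).locallyIntegrable
  have hf := hloc f (hw 0).locInt
  obtain ⟨N, hN⟩ :=
    ((tendsto_order.1 tendsto_rOut_shrinkingBump).2 (R - r) (by linarith)).exists_forall_of_atTop
  have hsub : ∀ n, N ≤ n → ∀ y ∈ Metric.ball x r,
      Metric.closedBall y (shrinkingBump n).rOut ⊆ Metric.ball x R := by
    intro n hn y hy
    refine Metric.closedBall_subset_ball' ?_
    have := hN n hn
    have := Metric.mem_ball.1 hy
    linarith
  have hlip : ∀ n, N ≤ n → LipschitzOnWith (2 * C) (mollify n (B.indicator f))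
      (Metric.ball x r) := by
    intro n hn
    refine (convex_ball x r).lipschitzOnWith_of_nnnorm_fderiv_le
      (fun y _ => (contDiff_mollify n hf).differentiable (by simp) y) fun y hy => ?_
    have hin : ∀ t ∈ Metric.ball y (shrinkingBump n).rOut, t ∈ Metric.ball x R := fun t ht =>
      hsub n hn y hy (Metric.ball_subset_closedBall ht)
    have hp : ∀ i, |classicalPartial i (mollify n (B.indicator f)) y| ≤ C := fun i => by
      rw [classicalPartial_mollify (hw i) (g := B.indicator (g i))
        ((hsub n hn y hy).trans (Metric.ball_subset_closedBall.trans hR)) hf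
        (fun t ht => indicator_of_mem (Metric.ball_subset_closedBall (hin t ht)) _)
        (fun t ht => indicator_of_mem (Metric.ball_subset_closedBall (hin t ht)) _)]
      refine abs_mollify_le ?_
      filter_upwards [hC i] with t ht htb
      rw [indicator_of_mem (Metric.ball_subset_closedBall (hin t htb))]
      exact ht (hin t htb)
    rw [← NNReal.coe_le_coe, coe_nnnorm]
    refine (norm_clm_le_sum _).trans ?_
    rw [Fin.sum_univ_two]
    push_cast
    have h1 := hp 0
    have h2 := hp 1
    simp only [classicalPartial, ← Real.norm_eq_abs] at h1 h2
    linarith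
  set S := {y | y ∈ Metric.ball x r ∧
    Tendsto (fun n => mollify n (B.indicator f) y) atTop (𝓝 (B.indicator f y))} with hS
  have hSf : LipschitzOnWith (2 * C) f S := by
    refine LipschitzOnWith.of_dist_le_mul fun y hy z hz => ?_
    have e : ∀ y ∈ S, B.indicator f y = f y := fun y hy =>
      indicator_of_mem (Metric.ball_subset_closedBall (Metric.ball_subset_ball hr.le hy.1)) _
    have hl := hy.2.dist hz.2
    rw [e y hy, e z hz] at hl
    refine le_of_tendsto hl ?_
    filter_upwards [eventually_ge_atTop N] with n hn
    exact (hlip n hn).dist_le_mul y hy.1 z hz.1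
  obtain ⟨H, hH, e⟩ := hSf.extend_real
  refine ⟨H, hH, ?_⟩
  filter_upwards [ae_tendsto_mollify hf] with y hy hyr
  exact e ⟨hyr, hy⟩

/-- A function with bounded weak derivatives has a locally Lipschitz representative. -/
theorem exists_locallyLipschitzOn_ae_eq (hw : ∀ i, HasWeakPartial Ω i f (g i)) {C : NNReal}
    (hC : ∀ i, ∀ᵐ y ∂(vol Ω), |g i y| ≤ C) :
    ∃ H : Plane → ℝ, LocallyLipschitzOn (Ω : Set Plane) H ∧ f =ᵐ[vol Ω] H := by
  have hloc : ∀ x : Plane, ∃ (r : ℝ) (H : Plane → ℝ), x ∈ Ω →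
      0 < r ∧ LipschitzWith (2 * C) H ∧ ∀ᵐ y, y ∈ Metric.ball x r → f y = H y := by
    intro x
    by_cases hx : x ∈ Ω
    · obtain ⟨R, hR, hRΩ⟩ := Metric.nhds_basis_closedBall.mem_iff.1 (Ω.isOpen.mem_nhds hx)
      obtain ⟨H, h1, h2⟩ := exists_lipschitzWith_of_hasWeakPartial hw (half_lt_self hR) hRΩ (C := C)
        fun i => by
          filter_upwards [(ae_restrict_iff' Ω.isOpen.measurableSet).1 (hC i)] with y hy hyb
          exact hy (hRΩ (Metric.ball_subset_closedBall hyb))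
      exact ⟨R / 2, H, fun _ => ⟨half_pos hR, h1, h2⟩⟩
    · exact ⟨0, 0, fun h => absurd h hx⟩
  choose r H hH using hloc
  -- the local representatives are continuous, hence agree on overlaps
  have key : ∀ x ∈ Ω, ∀ y ∈ Ω, y ∈ Metric.ball x (r x) → H y y = H x y := by
    intro x hx y hy hyx
    have hU : IsOpen (Metric.ball x (r x) ∩ Metric.ball y (r y)) :=
      Metric.isOpen_ball.inter Metric.isOpen_ball
    refine Measure.eqOn_open_of_ae_eq (μ := volume) ?_ hU (hH y hy).2.1.continuous.continuousOn
      (hH x hx).2.1.continuous.continuousOn ⟨hyx, Metric.mem_ball_self (hH y hy).1⟩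
    refine (ae_restrict_iff' hU.measurableSet).2 ?_
    filter_upwards [(hH x hx).2.2, (hH y hy).2.2] with z h1 h2 hz
    rw [← h1 hz.1, ← h2 hz.2]
  refine ⟨fun y => H y y, fun x hx => ?_, ae_vol_of_locally fun x hx => ?_⟩
  · refine ⟨2 * C, Metric.ball x (r x) ∩ (Ω : Set Plane), inter_mem
      (mem_nhdsWithin_of_mem_nhds (Metric.ball_mem_nhds x (hH x hx).1)) self_mem_nhdsWithin, ?_⟩
    intro y hy z hz
    simp only [key x hx y hy.2 hy.1, key x hx z hz.2 hz.1]
    exact (hH x hx).2.1 y z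
  · refine ⟨Metric.ball x (r x) ∩ (Ω : Set Plane),
      inter_mem (Metric.ball_mem_nhds x (hH x hx).1) (Ω.isOpen.mem_nhds hx), ?_⟩
    filter_upwards [(hH x hx).2.2] with y hy hyx
    rw [key x hx y hyx.2 hyx.1, hy hyx.1]

/-- The linear functional with the given partial derivatives. -/
noncomputable def linearOfPartials (c : Fin 2 → ℝ) : Plane →L[ℝ] ℝ :=
  ∑ i, c i • EuclideanSpace.proj i

theorem linearOfPartials_single (c : Fin 2 → ℝ) (i : Fin 2) :
    linearOfPartials c (EuclideanSpace.single i 1) = c i := by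
  fin_cases i <;> simp [linearOfPartials, Fin.sum_univ_two]

theorem hasWeakPartial_clm (L : Plane →L[ℝ] ℝ) (i : Fin 2) :
    HasWeakPartial Ω i L fun _ => L (EuclideanSpace.single i 1) := by
  have h := hasWeakPartial_of_locallyLipschitzOn (Ω := Ω) (f := L)
    (locallyLipschitzOn_of_contDiffAt fun x _ => L.contDiff.contDiffAt) i
  refine h.congr (EventuallyEq.refl _ _) (Eventually.of_forall fun x => ?_)
  simp [classicalPartial]

/-- A continuous function with continuous weak derivatives is continuously differentiable. -/
theorem hasFDerivAt_of_hasWeakPartial (hw : ∀ i, HasWeakPartial Ω i f (g i))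
    (hf : ContinuousOn f (Ω : Set Plane)) (hg : ∀ i, ContinuousOn (g i) (Ω : Set Plane))
    {x : Plane} (hx : x ∈ Ω) : HasFDerivAt f (linearOfPartials fun i => g i x) x := by
  rw [hasFDerivAt_iff_isLittleO, Asymptotics.isLittleO_iff]
  intro ε hε
  set L := linearOfPartials fun i => g i x with hL
  have hev : ∀ᶠ y in 𝓝 x, y ∈ Ω ∧ ∀ i, |g i y - g i x| < ε / 2 := by
    refine Eventually.and (show ∀ᶠ y in 𝓝 x, y ∈ Ω from Ω.isOpen.mem_nhds hx)
      (eventually_all.2 fun i => ?_)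
    have h1 := ((hg i).continuousAt (Ω.isOpen.mem_nhds hx)).tendsto
    have h2 := (h1.sub_const (g i x)).abs
    rw [sub_self, abs_zero] at h2
    exact (tendsto_order.1 h2).2 _ (half_pos hε)
  obtain ⟨R, hR, hRΩ⟩ := Metric.nhds_basis_closedBall.mem_iff.1 hev
  have hw' : ∀ i, HasWeakPartial Ω i (f - ⇑L) (g i - fun _ => g i x) := fun i => by
    have h := hasWeakPartial_clm (Ω := Ω) L i
    simp only [hL, linearOfPartials_single] at h
    exact (hw i).sub h
  have hnn : 0 ≤ ε / 2 := by positivity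
  obtain ⟨H, h1, h2⟩ := exists_lipschitzWith_of_hasWeakPartial hw' (half_lt_self hR)
    (fun y hy => (hRΩ hy).1) (C := (ε / 2).toNNReal) fun i => Eventually.of_forall fun y hy =>
      ((hRΩ (Metric.ball_subset_closedBall hy)).2 i).le.trans (Real.le_coe_toNNReal _)
  have hsub : Metric.ball x (R / 2) ⊆ (Ω : Set Plane) := fun y hy =>
    (hRΩ (Metric.ball_subset_closedBall (Metric.ball_subset_ball (by linarith) hy))).1
  have heq : EqOn (f - ⇑L) H (Metric.ball x (R / 2)) :=
    Measure.eqOn_open_of_ae_eq (μ := volume)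
      ((ae_restrict_iff' Metric.isOpen_ball.measurableSet).2 h2) Metric.isOpen_ball
      ((hf.mono hsub).sub L.continuous.continuousOn) h1.continuous.continuousOn
  filter_upwards [Metric.ball_mem_nhds x (half_pos hR)] with y hy
  have e1 := heq hy
  have e2 := heq (Metric.mem_ball_self (half_pos hR))
  simp only [Pi.sub_apply] at e1 e2
  have e3 : f y - f x - L (y - x) = H y - H x := by
    rw [map_sub, ← e1, ← e2]
    ring
  rw [e3]
  have h3 := h1.dist_le_mul y x
  rw [dist_eq_norm, dist_eq_norm] at h3
  refine h3.trans_eq ?_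
  rw [NNReal.coe_mul, Real.coe_toNNReal _ hnn, NNReal.coe_ofNat]
  ring

theorem classicalPartial_of_hasFDerivAt {c : Fin 2 → ℝ} {x : Plane}
    (h : HasFDerivAt f (linearOfPartials c) x) (i : Fin 2) : classicalPartial i f x = c i := by
  rw [classicalPartial, h.fderiv, linearOfPartials_single]

end Regularity

/-! ### Admissible maps are diffeomorphisms with Lipschitz derivative -/

section Diffeo

variable {Ω Ω' : TopologicalSpace.Opens Plane} {φ : OpenPartialHomeomorph Plane Plane} {c C : ℝ}

/-- The Jacobian matrix built from classical partial derivatives, with zero entries where the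
corresponding component of `φ` is not differentiable. -/
noncomputable def classicalJacobian (φ : Plane → Plane) (x : Plane) : Matrix (Fin 2) (Fin 2) ℝ :=
  Matrix.of fun i j => classicalPartial j (fun y => φ y i) x

/-- `φ` is a diffeomorphism of `Ω` onto `Ω'` whose derivative is locally Lipschitz; the entries of
the Jacobian matrix and their derivatives are bounded by `C`, and the Jacobian determinant is at
least `c` in absolute value. -/
structure IsBoundedDiffeo (Ω Ω' : TopologicalSpace.Opens Plane)
    (φ : OpenPartialHomeomorph Plane Plane) (c C : ℝ) : Prop where
  source_eq : φ.source = (Ω : Set Plane)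
  target_eq : φ.target = (Ω' : Set Plane)
  pos : 0 < c
  hasFDerivAt : ∀ i, ∀ x ∈ Ω, HasFDerivAt (fun y => φ y i)
    (linearOfPartials fun j => classicalJacobian φ x i j) x
  lipschitz : ∀ i j, LocallyLipschitzOn (Ω : Set Plane) fun x => classicalJacobian φ x i j
  bound : ∀ i j, ∀ x ∈ Ω, |classicalJacobian φ x i j| ≤ C
  bound_partial : ∀ i j k, ∀ᵐ x ∂(vol Ω),
    |classicalPartial k (fun y => classicalJacobian φ y i j) x| ≤ C
  le_det : ∀ x ∈ Ω, c ≤ |(classicalJacobian φ x).det|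

theorem exists_ae_abs_le_of_memLp_top {g : Plane → ℝ} {μ : Measure Plane} (h : MemLp g ∞ μ) :
    ∃ C : ℝ, ∀ᵐ x ∂μ, |g x| ≤ C := by
  refine ⟨(eLpNorm g ∞ μ).toReal, ?_⟩
  rw [eLpNorm_exponent_top]
  have hfin : eLpNormEssSup g μ ≠ ∞ := by
    rw [← eLpNorm_exponent_top]
    exact h.2.ne
  filter_upwards [ae_le_eLpNormEssSup (f := g) (μ := μ)] with x hx
  have := ENNReal.toReal_mono hfin hx
  simpa using this

theorem forall_le_of_ae_le {f g : Plane → ℝ} (hf : ContinuousOn f (Ω : Set Plane))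
    (hg : ContinuousOn g (Ω : Set Plane)) (h : ∀ᵐ x ∂(vol Ω), f x ≤ g x) :
    ∀ x ∈ Ω, f x ≤ g x := by
  intro x hx
  have : EqOn (fun x => max (f x) (g x)) g (Ω : Set Plane) :=
    Measure.eqOn_open_of_ae_eq (μ := volume) (h.mono fun x hx => max_eq_right hx) Ω.isOpen
      (ContinuousOn.sup hf hg) hg
  exact (le_max_left _ _).trans (this hx).le

theorem continuousOn_det {f : Plane → Matrix (Fin 2) (Fin 2) ℝ} {s : Set Plane}
    (h : ∀ i j, ContinuousOn (fun x => f x i j) s) : ContinuousOn (fun x => (f x).det) s := by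
  simp only [Matrix.det_fin_two]
  exact ((h 0 0).mul (h 1 1)).sub ((h 0 1).mul (h 1 0))

theorem continuousOn_component (hs : φ.source = (Ω : Set Plane)) (i : Fin 2) :
    ContinuousOn (fun y => φ y i) (Ω : Set Plane) :=
  (EuclideanSpace.proj (𝕜 := ℝ) i).continuous.comp_continuousOn (hs ▸ φ.continuousOn)

/-- The components of a homeomorphism with bounded weak derivatives of first and second order have
locally Lipschitz gradients: their first weak derivatives have locally Lipschitz
representatives, which are then the classical derivatives. -/
theorem exists_classicalJacobian_regular (hs : φ.source = (Ω : Set Plane))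
    (hb : ∀ i j, ∃ g, HasWeakPartial Ω j (fun x => φ x i) g ∧ MemSobolev 1 ∞ Ω g) (i : Fin 2) :
    (∀ x ∈ Ω, HasFDerivAt (fun y => φ y i)
      (linearOfPartials fun j => classicalJacobian φ x i j) x) ∧
    (∀ j, LocallyLipschitzOn (Ω : Set Plane) fun x => classicalJacobian φ x i j) ∧
    (∀ j, (fun x => classicalJacobian φ x i j) =ᵐ[vol Ω] weakPartial Ω j fun x => φ x i) := by
  choose g hg hg' using hb i
  have hrep : ∀ j, ∃ H : Plane → ℝ, LocallyLipschitzOn (Ω : Set Plane) H ∧ g j =ᵐ[vol Ω] H := by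
    intro j
    choose C hC using fun k => exists_ae_abs_le_of_memLp_top ((hg' j).weakPartial k).memLp
    refine exists_locallyLipschitzOn_ae_eq (fun k => (hg' j).hasWeakPartial k)
      (C := ∑ k, (C k).toNNReal) fun k => ?_
    filter_upwards [hC k] with x hx
    refine hx.trans ((Real.le_coe_toNNReal _).trans ?_)
    exact NNReal.coe_le_coe.2 (Finset.single_le_sum (f := fun k => (C k).toNNReal)
      (fun _ _ => zero_le) (Finset.mem_univ k))
  choose H hH hgH using hrep
  have hd : ∀ x ∈ Ω, HasFDerivAt (fun y => φ y i) (linearOfPartials fun j => H j x) x :=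
    fun x hx => hasFDerivAt_of_hasWeakPartial
      (fun j => (hg j).congr (EventuallyEq.refl _ _) (hgH j)) (continuousOn_component hs i)
      (fun j => (hH j).continuousOn) hx
  have e : ∀ x ∈ Ω, ∀ j, classicalJacobian φ x i j = H j x := fun x hx j =>
    classicalPartial_of_hasFDerivAt (hd x hx) j
  refine ⟨fun x hx => ?_, fun j x hx => ?_, fun j => ?_⟩
  · simp only [e x hx]
    exact hd x hx
  · obtain ⟨K, t, ht, hl⟩ := hH j hx
    refine ⟨K, t ∩ (Ω : Set Plane), inter_mem ht self_mem_nhdsWithin, ?_⟩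
    intro y hy z hz
    simp only [e y hy.2, e z hz.2]
    exact hl hy.1 hz.1
  · filter_upwards [ae_restrict_mem Ω.isOpen.measurableSet, hgH j, (hg j).ae_eq] with x hx h1 h2
    rw [e x hx, h2, h1]

theorem Admissible.jacobian_ae_eq {p : ℝ≥0∞} [Fact (1 ≤ p)] (h : Admissible p Ω Ω' φ) :
    jacobian Ω φ =ᵐ[vol Ω] classicalJacobian φ := by
  have h1 := fun i j => (exists_classicalJacobian_regular h.source_eq h.bounded i).2.2 j
  filter_upwards [ae_all_iff.2 fun i => ae_all_iff.2 (h1 i)] with x hx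
  ext i j
  exact (hx i j).symm

theorem Admissible.isBoundedDiffeo {p : ℝ≥0∞} [Fact (1 ≤ p)] (h : Admissible p Ω Ω' φ) :
    ∃ C, IsBoundedDiffeo Ω Ω' φ (jacobianInf Ω φ) C := by
  have hr := fun i => exists_classicalJacobian_regular h.source_eq h.bounded i
  have hm : ∀ i j, MemSobolev 1 ∞ Ω fun x => classicalJacobian φ x i j := fun i j => by
    obtain ⟨g, h1, h2⟩ := h.bounded i j
    exact h2.congr (h1.ae_eq.symm.trans ((hr i).2.2 j).symm)
  choose C₀ hC₀ using fun i j => exists_ae_abs_le_of_memLp_top (hm i j).memLp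
  choose C₁ hC₁ using fun i j k => exists_ae_abs_le_of_memLp_top ((hm i j).weakPartial k).memLp
  have hsum : ∀ (i j : Fin 2) (a : Fin 2 → Fin 2 → ℝ), a i j ≤ ∑ i, ∑ j, |a i j| := fun i j a =>
    (le_abs_self _).trans <| (Finset.single_le_sum (f := fun j => |a i j|)
      (fun _ _ => abs_nonneg _) (Finset.mem_univ j)).trans
      (Finset.single_le_sum (f := fun i => ∑ j, |a i j|)
        (fun _ _ => by positivity) (Finset.mem_univ i))
  set D₀ := ∑ i, ∑ j, |C₀ i j|
  set D₁ := ∑ k, ∑ i, ∑ j, |C₁ i j k|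
  have h0 : 0 ≤ D₀ := by positivity
  have h1 : 0 ≤ D₁ := by positivity
  refine ⟨D₀ + D₁, h.source_eq, h.target_eq, h.inf_pos, fun i => (hr i).1, fun i => (hr i).2.1,
    fun i j => ?_, fun i j k => ?_, ?_⟩
  · refine forall_le_of_ae_le (((hr i).2.1 j).continuousOn.abs) continuousOn_const ?_
    filter_upwards [hC₀ i j] with x hx
    have := hsum i j C₀
    linarith
  · have e := (hasWeakPartial_of_locallyLipschitzOn ((hr i).2.1 j) k).ae_eq
    filter_upwards [hC₁ i j k, e] with x hx ex
    rw [ex] at hx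
    have h2 := hsum i j (fun i j => C₁ i j k)
    have h3 : ∑ i, ∑ j, |C₁ i j k| ≤ D₁ :=
      Finset.single_le_sum (f := fun k => ∑ i, ∑ j, |C₁ i j k|)
        (fun _ _ => by positivity) (Finset.mem_univ k)
    have h4 : C₁ i j k ≤ ∑ i, ∑ j, |C₁ i j k| := h2
    linarith
  · refine forall_le_of_ae_le continuousOn_const
      (continuousOn_det fun i j => ((hr i).2.1 j).continuousOn).abs ?_
    have h2 : ∀ᵐ x ∂(vol Ω), jacobianInf Ω φ ≤ |(jacobian Ω φ x).det| :=
      ae_essInf_le ⟨0, eventually_map.2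
        (Eventually.of_forall fun x => abs_nonneg (jacobian Ω φ x).det)⟩
    filter_upwards [h2, h.jacobian_ae_eq] with x hx ex
    rwa [ex] at hx

namespace IsBoundedDiffeo

theorem hasFDerivAt_toLin (h : IsBoundedDiffeo Ω Ω' φ c C) {x : Plane} (hx : x ∈ Ω) : HasFDerivAt φ
    (LinearMap.toContinuousLinearMap
      (Matrix.toLpLin 2 2 (classicalJacobian φ x)) : Plane →L[ℝ] Plane) x := by
  rw [← hasFDerivWithinAt_univ, hasFDerivWithinAt_euclidean]
  intro i
  rw [hasFDerivWithinAt_univ]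
  refine (h.hasFDerivAt i x hx).congr_fderiv ?_
  ext v
  fin_cases i <;> simp [linearOfPartials, Matrix.toLpLin_apply]

theorem det_ne_zero (h : IsBoundedDiffeo Ω Ω' φ c C) {x : Plane} (hx : x ∈ Ω) :
    (classicalJacobian φ x).det ≠ 0 :=
  abs_pos.1 (h.pos.trans_le (h.le_det x hx))

theorem det_toLin (φ : Plane → Plane) (x : Plane) : (LinearMap.toContinuousLinearMap
      (Matrix.toLpLin 2 2 (classicalJacobian φ x)) : Plane →L[ℝ] Plane).det
    = (classicalJacobian φ x).det := by
  simp [ContinuousLinearMap.det, LinearMap.det_toLpLin]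

theorem contDiffAt (h : IsBoundedDiffeo Ω Ω' φ c C) {x : Plane} (hx : x ∈ Ω) :
    ContDiffAt ℝ 1 φ x := by
  rw [contDiffAt_euclidean]
  intro i
  rw [contDiffAt_one_iff]
  refine ⟨fun y => linearOfPartials fun j => classicalJacobian φ y i j, Ω, Ω.isOpen.mem_nhds hx,
    ?_, h.hasFDerivAt i⟩
  simp only [linearOfPartials]
  exact continuousOn_finsetSum _ fun j _ => (h.lipschitz i j).continuousOn.smul continuousOn_const

theorem mapsTo (h : IsBoundedDiffeo Ω Ω' φ c C) {x : Plane} (hx : x ∈ Ω) : φ x ∈ Ω' := by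
  have := φ.map_source (h.source_eq ▸ hx : x ∈ φ.source)
  rwa [h.target_eq] at this

theorem mapsTo_symm (h : IsBoundedDiffeo Ω Ω' φ c C) {y : Plane} (hy : y ∈ Ω') : φ.symm y ∈ Ω := by
  have := φ.map_target (h.target_eq ▸ hy : y ∈ φ.target)
  rwa [h.source_eq] at this

theorem left_inv (h : IsBoundedDiffeo Ω Ω' φ c C) {x : Plane} (hx : x ∈ Ω) : φ.symm (φ x) = x :=
  φ.left_inv (h.source_eq ▸ hx)

theorem right_inv (h : IsBoundedDiffeo Ω Ω' φ c C) {y : Plane} (hy : y ∈ Ω') : φ (φ.symm y) = y :=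
  φ.right_inv (h.target_eq ▸ hy)

theorem contDiffAt_symm (h : IsBoundedDiffeo Ω Ω' φ c C) {y : Plane} (hy : y ∈ Ω') :
    ContDiffAt ℝ 1 φ.symm y := by
  have hx := h.mapsTo_symm hy
  have hd := h.hasFDerivAt_toLin hx
  have hdet := h.det_ne_zero hx
  rw [← det_toLin] at hdet
  exact φ.contDiffAt_symm (h.target_eq ▸ hy)
    (f₀' := ContinuousLinearMap.toContinuousLinearEquivOfDetNeZero _ hdet) hd (h.contDiffAt hx)

end IsBoundedDiffeo

end Diffeo

/-! ### Smooth functions of the Jacobian matrix -/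

section SmoothFunctions

variable {Ω Ω' : TopologicalSpace.Opens Plane} {φ : OpenPartialHomeomorph Plane Plane} {c C : ℝ}
  {G : Plane → Fin 2 → Fin 2 → ℝ} {F : (Fin 2 → Fin 2 → ℝ) → ℝ} {U : Set (Fin 2 → Fin 2 → ℝ)}

theorem locallyLipschitzOn_comp_contDiffOn (hU : IsOpen U) (hF : ContDiffOn ℝ 1 F U)
    (hG : ∀ i j, LocallyLipschitzOn (Ω : Set Plane) fun x => G x i j)
    (hGU : MapsTo G (Ω : Set Plane) U) : LocallyLipschitzOn (Ω : Set Plane) fun x => F (G x) :=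
  LocallyLipschitzOn.comp_of_mapsTo (t := U) (g := F)
    (locallyLipschitzOn_of_contDiffAt fun _ hA => hF.contDiffAt (hU.mem_nhds hA))
    (locallyLipschitzOn_pi fun i => locallyLipschitzOn_pi fun j => hG i j) hGU

theorem ae_classicalPartial_comp (hU : IsOpen U) (hF : ContDiffOn ℝ 1 F U)
    (hG : ∀ i j, LocallyLipschitzOn (Ω : Set Plane) fun x => G x i j)
    (hGU : MapsTo G (Ω : Set Plane) U) : ∀ᵐ x ∂(vol Ω), ∀ k,
      classicalPartial k (fun x => F (G x)) x
        = fderiv ℝ F (G x) fun i j => classicalPartial k (fun y => G y i j) x := by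
  filter_upwards [ae_restrict_mem Ω.isOpen.measurableSet,
    ae_all_iff.2 fun i => ae_all_iff.2 fun j => ae_differentiableAt (hG i j)] with x hx hd k
  have h1 : HasFDerivAt G (ContinuousLinearMap.pi fun i => ContinuousLinearMap.pi fun j =>
      fderiv ℝ (fun y => G y i j) x) x :=
    hasFDerivAt_pi.2 fun i => hasFDerivAt_pi.2 fun j => (hd i j).hasFDerivAt
  have h2 : HasFDerivAt F (fderiv ℝ F (G x)) (G x) :=
    ((hF.contDiffAt (hU.mem_nhds (hGU hx))).differentiableAt (by simp)).hasFDerivAt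
  have h3 : HasFDerivAt (fun x => F (G x)) _ x := h2.comp x h1
  rw [classicalPartial, h3.fderiv]
  rfl

/-- The set of invertible matrices. Matrices are viewed as elements of `Fin 2 → Fin 2 → ℝ`, which
carries a norm, unlike the type of matrices. -/
def invertibleMatrices : Set (Fin 2 → Fin 2 → ℝ) := {A | (Matrix.of A).det ≠ 0}

theorem contDiff_det : ContDiff ℝ 1 fun A : Fin 2 → Fin 2 → ℝ => (Matrix.of A).det := by
  simp only [Matrix.det_fin_two, Matrix.of_apply]
  fun_prop

theorem isOpen_invertibleMatrices : IsOpen invertibleMatrices :=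
  isOpen_ne_fun contDiff_det.continuous continuous_const

theorem contDiffOn_inv (i j : Fin 2) :
    ContDiffOn ℝ 1 (fun A : Fin 2 → Fin 2 → ℝ => (Matrix.of A)⁻¹ i j) invertibleMatrices := by
  have h : ContDiff ℝ 1 fun A : Fin 2 → Fin 2 → ℝ => (Matrix.of A).adjugate i j := by
    simp only [Matrix.adjugate_fin_two]
    fin_cases i <;> fin_cases j <;> simp <;> fun_prop
  have e : (fun A : Fin 2 → Fin 2 → ℝ => (Matrix.of A)⁻¹ i j)
      = fun A : Fin 2 → Fin 2 → ℝ => ((Matrix.of A).det)⁻¹ * (Matrix.of A).adjugate i j := by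
    funext A
    rw [Matrix.inv_def, Matrix.smul_apply, Ring.inverse_eq_inv', smul_eq_mul]
  have h2 : ContDiffOn ℝ 1 (fun A : Fin 2 → Fin 2 → ℝ => ((Matrix.of A).det)⁻¹)
      invertibleMatrices := ContDiffOn.inv contDiff_det.contDiffOn fun A hA => hA
  rw [e]
  exact h2.mul h.contDiffOn

theorem contDiffOn_abs_det :
    ContDiffOn ℝ 1 (fun A : Fin 2 → Fin 2 → ℝ => |(Matrix.of A).det|) invertibleMatrices :=
  fun A hA => ((contDiffAt_abs (n := 1) (x := (Matrix.of A).det) hA).comp A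
    contDiff_det.contDiffAt).contDiffWithinAt

/-- The matrix `|det A| A⁻¹`, which is the adjugate of `A` up to the sign of `det A`. -/
noncomputable def signedCofactor (A : Matrix (Fin 2) (Fin 2) ℝ) : Matrix (Fin 2) (Fin 2) ℝ :=
  |A.det| • A⁻¹

/-- The matrix `A⁻¹ A⁻ᵗ |det A| - I`, whose value at `A = Dφ` is the defect matrix `M_φ`. -/
noncomputable def matrixDefect (A : Matrix (Fin 2) (Fin 2) ℝ) : Matrix (Fin 2) (Fin 2) ℝ :=
  |A.det| • (A⁻¹ * A⁻¹.transpose) - 1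

theorem contDiffOn_signedCofactor (i j : Fin 2) :
    ContDiffOn ℝ 1 (fun A : Fin 2 → Fin 2 → ℝ => signedCofactor (Matrix.of A) i j)
      invertibleMatrices := by
  simp only [signedCofactor, Matrix.smul_apply, smul_eq_mul]
  exact contDiffOn_abs_det.mul (contDiffOn_inv i j)

theorem contDiffOn_matrixDefect (i j : Fin 2) :
    ContDiffOn ℝ 1 (fun A : Fin 2 → Fin 2 → ℝ => matrixDefect (Matrix.of A) i j)
      invertibleMatrices := by
  simp only [matrixDefect, Matrix.sub_apply, Matrix.smul_apply, smul_eq_mul, Matrix.mul_apply,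
    Fin.sum_univ_two, Matrix.transpose_apply]
  exact (contDiffOn_abs_det.mul (((contDiffOn_inv i 0).mul (contDiffOn_inv j 0)).add
    ((contDiffOn_inv i 1).mul (contDiffOn_inv j 1)))).sub contDiffOn_const

theorem isCompact_boundedMatrices (c C : ℝ) :
    IsCompact {A : Fin 2 → Fin 2 → ℝ | (∀ i j, |A i j| ≤ C) ∧ c ≤ |(Matrix.of A).det|} := by
  refine Metric.isCompact_of_isClosed_isBounded (IsClosed.inter ?_ ?_) ?_
  · have e : {A : Fin 2 → Fin 2 → ℝ | ∀ i j, |A i j| ≤ C} = ⋂ i, ⋂ j, {A | |A i j| ≤ C} := by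
      ext A
      simp
    have hcl : IsClosed {A : Fin 2 → Fin 2 → ℝ | ∀ i j, |A i j| ≤ C} := by
      rw [e]
      exact isClosed_iInter fun i => isClosed_iInter fun j =>
        isClosed_le (continuous_abs.comp (continuous_apply_apply i j)) continuous_const
    exact hcl
  · exact isClosed_le continuous_const contDiff_det.continuous.abs
  · refine (Metric.isBounded_closedBall (x := 0) (r := |C|)).subset fun A hA => ?_
    rw [mem_closedBall_zero_iff]
    refine (pi_norm_le_iff_of_nonneg (abs_nonneg C)).2 fun i =>
      (pi_norm_le_iff_of_nonneg (abs_nonneg C)).2 fun j => ?_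
    exact (hA.1 i j).trans (le_abs_self C)

theorem IsBoundedDiffeo.mapsTo_invertibleMatrices (h : IsBoundedDiffeo Ω Ω' φ c C) :
    MapsTo (fun x i j => classicalJacobian φ x i j) (Ω : Set Plane) invertibleMatrices :=
  fun _ hx => h.det_ne_zero hx

theorem IsBoundedDiffeo.locallyLipschitzOn_comp (h : IsBoundedDiffeo Ω Ω' φ c C)
    (hF : ContDiffOn ℝ 1 F invertibleMatrices) :
    LocallyLipschitzOn (Ω : Set Plane) fun x => F fun i j => classicalJacobian φ x i j :=
  locallyLipschitzOn_comp_contDiffOn isOpen_invertibleMatrices hF h.lipschitz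
    h.mapsTo_invertibleMatrices

theorem abs_clm_apply_le {L : (Fin 2 → Fin 2 → ℝ) →L[ℝ] ℝ} {M D : ℝ} (hL : ‖L‖ ≤ M) (hD : 0 ≤ D)
    {A : Fin 2 → Fin 2 → ℝ} (hA : ∀ i j, |A i j| ≤ D) : |L A| ≤ M * D := by
  refine (L.le_opNorm A).trans (mul_le_mul hL ?_ (norm_nonneg _) ((norm_nonneg _).trans hL))
  exact (pi_norm_le_iff_of_nonneg hD).2 fun i => (pi_norm_le_iff_of_nonneg hD).2 fun j => hA i j

/-- A smooth function of the Jacobian matrix is bounded and has bounded derivatives, since the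
Jacobian matrix stays in a compact set of invertible matrices. -/
theorem IsBoundedDiffeo.exists_bound_comp (h : IsBoundedDiffeo Ω Ω' φ c C)
    (hF : ContDiffOn ℝ 1 F invertibleMatrices) : ∃ D : ℝ,
      (∀ x ∈ Ω, |F fun i j => classicalJacobian φ x i j| ≤ D) ∧
      ∀ k, ∀ᵐ x ∂(vol Ω),
        |classicalPartial k (fun x => F fun i j => classicalJacobian φ x i j) x| ≤ D := by
  set S := {A : Fin 2 → Fin 2 → ℝ | (∀ i j, |A i j| ≤ C) ∧ c ≤ |(Matrix.of A).det|} with hS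
  have hSc : IsCompact S := isCompact_boundedMatrices c C
  have hSU : S ⊆ invertibleMatrices := fun A hA => abs_pos.1 (h.pos.trans_le hA.2)
  have hxS : ∀ x ∈ Ω, (fun i j => classicalJacobian φ x i j) ∈ S := fun x hx =>
    ⟨fun i j => h.bound i j x hx, h.le_det x hx⟩
  obtain ⟨D₀, hD₀⟩ := hSc.exists_bound_of_continuousOn (hF.continuousOn.mono hSU)
  obtain ⟨D₁, hD₁⟩ := hSc.exists_bound_of_continuousOn
    ((hF.continuousOn_fderiv_of_isOpen isOpen_invertibleMatrices le_rfl).mono hSU)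
  refine ⟨max D₀ (D₁ * |C|), fun x hx => (hD₀ _ (hxS x hx)).trans (le_max_left _ _), fun k => ?_⟩
  filter_upwards [ae_restrict_mem Ω.isOpen.measurableSet,
    ae_classicalPartial_comp isOpen_invertibleMatrices hF h.lipschitz h.mapsTo_invertibleMatrices,
    ae_all_iff.2 fun i => ae_all_iff.2 fun j => h.bound_partial i j k] with x hx e hb
  rw [e k]
  exact (abs_clm_apply_le (hD₁ _ (hxS x hx)) (abs_nonneg C)
    fun i j => (hb i j).trans (le_abs_self C)).trans (le_max_right _ _)

theorem memSobolev_one_top {f : Plane → ℝ} (hf : LocallyLipschitzOn (Ω : Set Plane) f) {D : ℝ}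
    (hb : ∀ᵐ x ∂(vol Ω), |f x| ≤ D) (hb' : ∀ k, ∀ᵐ x ∂(vol Ω), |classicalPartial k f x| ≤ D) :
    MemSobolev 1 ∞ Ω f :=
  ⟨memLp_top_of_bound (hf.continuousOn.aestronglyMeasurable Ω.isOpen.measurableSet) D hb,
    fun k => ⟨_, hasWeakPartial_of_locallyLipschitzOn hf k,
      memLp_top_of_bound (measurable_classicalPartial k f).aestronglyMeasurable D (hb' k)⟩⟩

theorem IsBoundedDiffeo.memSobolev_comp (h : IsBoundedDiffeo Ω Ω' φ c C)
    (hF : ContDiffOn ℝ 1 F invertibleMatrices) :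
    MemSobolev 1 ∞ Ω fun x => F fun i j => classicalJacobian φ x i j := by
  obtain ⟨D, h1, h2⟩ := h.exists_bound_comp hF
  refine memSobolev_one_top (h.locallyLipschitzOn_comp hF) (D := D) ?_ h2
  filter_upwards [ae_restrict_mem Ω.isOpen.measurableSet] with x hx using h1 x hx

end SmoothFunctions

/-! ### Change of variables -/

section ChangeOfVariables

variable {Ω Ω' : TopologicalSpace.Opens Plane} {φ : OpenPartialHomeomorph Plane Plane} {c C : ℝ}
  {p : ℝ≥0∞}

theorem comp_ae_eq_comp {e : OpenPartialHomeomorph Plane Plane} (hs : e.source = (Ω : Set Plane))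
    (ht : e.target = (Ω' : Set Plane)) (hd : DifferentiableOn ℝ e.symm (Ω' : Set Plane))
    {v w : Plane → ℝ} (hvw : v =ᵐ[vol Ω'] w) : v ∘ e =ᵐ[vol Ω] w ∘ e := by
  have h1 : volume ({y | v y ≠ w y} ∩ (Ω' : Set Plane)) = 0 := by
    rw [← Measure.restrict_apply₀' Ω'.isOpen.measurableSet.nullMeasurableSet]
    exact hvw
  have h2 := addHaar_image_eq_zero_of_differentiableOn_of_addHaar_eq_zero volume
    (hd.mono inter_subset_right) h1
  have h3 : (volume : Measure Plane).restrict (Ω : Set Plane)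
      {x | ¬ (v ∘ e) x = (w ∘ e) x} = 0 := by
    rw [Measure.restrict_apply₀' Ω.isOpen.measurableSet.nullMeasurableSet]
    refine measure_mono_null ?_ h2
    rintro x ⟨hx, hxΩ⟩
    have hxs : x ∈ e.source := hs ▸ hxΩ
    exact ⟨e x, ⟨hx, ht ▸ e.map_source hxs⟩, e.left_inv hxs⟩
  exact h3

theorem aestronglyMeasurable_comp {e : OpenPartialHomeomorph Plane Plane}
    (hs : e.source = (Ω : Set Plane)) (ht : e.target = (Ω' : Set Plane))
    (hd : DifferentiableOn ℝ e.symm (Ω' : Set Plane)) {v : Plane → ℝ}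
    (hv : AEStronglyMeasurable v (vol Ω')) : AEStronglyMeasurable (v ∘ e) (vol Ω) := by
  have he : AEMeasurable e (vol Ω) :=
    ContinuousOn.aemeasurable (hs ▸ e.continuousOn) Ω.isOpen.measurableSet
  have h1 := hv.stronglyMeasurable_mk.measurable.comp_aemeasurable he
  exact h1.aestronglyMeasurable.congr (comp_ae_eq_comp hs ht hd hv.ae_eq_mk).symm

namespace IsBoundedDiffeo

theorem differentiableOn (h : IsBoundedDiffeo Ω Ω' φ c C) :
    DifferentiableOn ℝ φ (Ω : Set Plane) := fun _ hx =>
  ((h.contDiffAt hx).differentiableAt (by simp)).differentiableWithinAt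

theorem differentiableOn_symm (h : IsBoundedDiffeo Ω Ω' φ c C) :
    DifferentiableOn ℝ φ.symm (Ω' : Set Plane) := fun _ hy =>
  ((h.contDiffAt_symm hy).differentiableAt (by simp)).differentiableWithinAt

theorem comp_ae_eq (h : IsBoundedDiffeo Ω Ω' φ c C) {v w : Plane → ℝ} (hvw : v =ᵐ[vol Ω'] w) :
    v ∘ φ =ᵐ[vol Ω] w ∘ φ :=
  comp_ae_eq_comp h.source_eq h.target_eq h.differentiableOn_symm hvw

theorem comp_symm_ae_eq (h : IsBoundedDiffeo Ω Ω' φ c C) {v w : Plane → ℝ}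
    (hvw : v =ᵐ[vol Ω] w) : v ∘ φ.symm =ᵐ[vol Ω'] w ∘ φ.symm :=
  comp_ae_eq_comp (e := φ.symm) h.target_eq h.source_eq (by simpa using h.differentiableOn) hvw

theorem aestronglyMeasurable_comp (h : IsBoundedDiffeo Ω Ω' φ c C) {v : Plane → ℝ}
    (hv : AEStronglyMeasurable v (vol Ω')) : AEStronglyMeasurable (v ∘ φ) (vol Ω) :=
  DirichletPerturbation.aestronglyMeasurable_comp h.source_eq h.target_eq
    h.differentiableOn_symm hv

theorem aestronglyMeasurable_comp_symm (h : IsBoundedDiffeo Ω Ω' φ c C) {v : Plane → ℝ}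
    (hv : AEStronglyMeasurable v (vol Ω)) : AEStronglyMeasurable (v ∘ φ.symm) (vol Ω') :=
  DirichletPerturbation.aestronglyMeasurable_comp (e := φ.symm) h.target_eq h.source_eq
    (by simpa using h.differentiableOn) hv

theorem setIntegral_eq (h : IsBoundedDiffeo Ω Ω' φ c C) (a : Plane → ℝ) :
    ∫ y in (Ω' : Set Plane), a y
      = ∫ x in (Ω : Set Plane), |(classicalJacobian φ x).det| * a (φ x) := by
  have h1 : ∀ x ∈ φ.source, HasFDerivAt φ (LinearMap.toContinuousLinearMap
      (Matrix.toLpLin 2 2 (classicalJacobian φ x)) : Plane →L[ℝ] Plane) x := fun x hx =>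
    h.hasFDerivAt_toLin (by rwa [h.source_eq] at hx)
  have := integral_target_eq_integral_abs_det_fderiv_smul volume h1 a
  simpa only [det_toLin, h.source_eq, h.target_eq, smul_eq_mul] using this

theorem setLIntegral_eq (h : IsBoundedDiffeo Ω Ω' φ c C) (a : Plane → ℝ≥0∞) :
    ∫⁻ y in (Ω' : Set Plane), a y
      = ∫⁻ x in (Ω : Set Plane), ENNReal.ofReal |(classicalJacobian φ x).det| * a (φ x) := by
  have h1 : ∀ x ∈ (Ω : Set Plane), HasFDerivWithinAt φ (LinearMap.toContinuousLinearMap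
      (Matrix.toLpLin 2 2 (classicalJacobian φ x)) : Plane →L[ℝ] Plane) (Ω : Set Plane) x :=
    fun x hx => (h.hasFDerivAt_toLin hx).hasFDerivWithinAt
  have h2 : InjOn φ (Ω : Set Plane) := h.source_eq ▸ φ.injOn
  have h3 : φ '' (Ω : Set Plane) = (Ω' : Set Plane) := by
    rw [← h.source_eq, ← h.target_eq, φ.image_source_eq_target]
  have := lintegral_image_eq_lintegral_abs_det_fderiv_mul volume Ω.isOpen.measurableSet h1 h2 a
  simpa only [det_toLin, h3] using this

theorem eLpNorm_comp_symm_eq (h : IsBoundedDiffeo Ω Ω' φ c C) (hp0 : p ≠ 0) (hp : p ≠ ∞)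
    (u : Plane → ℝ) : eLpNorm (u ∘ φ.symm) p (vol Ω')
      = (∫⁻ x in (Ω : Set Plane), ENNReal.ofReal |(classicalJacobian φ x).det|
          * ‖u x‖ₑ ^ p.toReal) ^ (1 / p.toReal) := by
  rw [eLpNorm_eq_lintegral_rpow_enorm_toReal hp0 hp, h.setLIntegral_eq]
  congr 1
  refine setLIntegral_congr_fun Ω.isOpen.measurableSet fun x hx => ?_
  simp only [Function.comp_apply, h.left_inv hx]

theorem le_eLpNorm_comp_symm (h : IsBoundedDiffeo Ω Ω' φ c C) (hp0 : p ≠ 0) (hp : p ≠ ∞)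
    (u : Plane → ℝ) : ENNReal.ofReal c ^ (1 / p.toReal) * eLpNorm u p (vol Ω)
      ≤ eLpNorm (u ∘ φ.symm) p (vol Ω') := by
  rw [h.eLpNorm_comp_symm_eq hp0 hp, eLpNorm_eq_lintegral_rpow_enorm_toReal hp0 hp,
    ← ENNReal.mul_rpow_of_nonneg _ _ (by positivity), ← lintegral_const_mul' _ _ (by simp)]
  gcongr ?_ ^ _
  refine setLIntegral_mono_ae' Ω.isOpen.measurableSet (Eventually.of_forall fun x hx => ?_)
  gcongr
  exact h.le_det x hx

theorem eLpNorm_comp_symm_le (h : IsBoundedDiffeo Ω Ω' φ c C) (hp0 : p ≠ 0) (hp : p ≠ ∞)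
    (u : Plane → ℝ) : eLpNorm (u ∘ φ.symm) p (vol Ω')
      ≤ ENNReal.ofReal (2 * C ^ 2) ^ (1 / p.toReal) * eLpNorm u p (vol Ω) := by
  rw [h.eLpNorm_comp_symm_eq hp0 hp, eLpNorm_eq_lintegral_rpow_enorm_toReal hp0 hp,
    ← ENNReal.mul_rpow_of_nonneg _ _ (by positivity),
    ← lintegral_const_mul' _ _ ENNReal.ofReal_ne_top]
  gcongr ?_ ^ _
  refine setLIntegral_mono_ae' Ω.isOpen.measurableSet (Eventually.of_forall fun x hx => ?_)
  gcongr
  have hC : 0 ≤ C := (abs_nonneg _).trans (h.bound 0 0 x hx)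
  have hm : ∀ i j k l, |classicalJacobian φ x i j * classicalJacobian φ x k l| ≤ C ^ 2 := by
    intro i j k l
    rw [abs_mul, sq]
    exact mul_le_mul (h.bound i j x hx) (h.bound k l x hx) (abs_nonneg _) hC
  rw [Matrix.det_fin_two]
  refine (abs_sub _ _).trans ?_
  linarith [hm 0 0 1 1, hm 0 1 1 0]

theorem eLpNorm_comp_le (h : IsBoundedDiffeo Ω Ω' φ c C) (hp0 : p ≠ 0) (hp : p ≠ ∞)
    (v : Plane → ℝ) : ENNReal.ofReal c ^ (1 / p.toReal) * eLpNorm (v ∘ φ) p (vol Ω)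
      ≤ eLpNorm v p (vol Ω') := by
  refine (h.le_eLpNorm_comp_symm hp0 hp _).trans_eq (eLpNorm_congr_ae ?_)
  filter_upwards [ae_restrict_mem Ω'.isOpen.measurableSet] with y hy
  simp only [Function.comp_apply, h.right_inv hy]

/-- Since `p ≥ 1`, dividing by the Jacobian before the change of variables costs at most
the factor `c ^ (1 / p - 1)`. -/
theorem eLpNorm_div_comp_symm_le (h : IsBoundedDiffeo Ω Ω' φ c C) (hp1 : 1 ≤ p) (hp : p ≠ ∞)
    (q : Plane → ℝ) :
    ENNReal.ofReal c * eLpNorm ((fun x => q x / |(classicalJacobian φ x).det|) ∘ φ.symm) p (vol Ω')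
      ≤ ENNReal.ofReal c ^ (1 / p.toReal) * eLpNorm q p (vol Ω) := by
  have hp0 : p ≠ 0 := (zero_lt_one.trans_le hp1).ne'
  have hr : 1 ≤ p.toReal := by
    rw [← ENNReal.toReal_one]
    exact ENNReal.toReal_mono hp hp1
  have hr0 : 0 < p.toReal := zero_lt_one.trans_le hr
  have e : ENNReal.ofReal c = (ENNReal.ofReal c ^ p.toReal) ^ (1 / p.toReal) := by
    rw [← ENNReal.rpow_mul, mul_one_div_cancel hr0.ne', ENNReal.rpow_one]
  have hfin : ENNReal.ofReal c ^ p.toReal ≠ ∞ :=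
    ENNReal.rpow_ne_top_of_nonneg hr0.le ENNReal.ofReal_ne_top
  rw [h.eLpNorm_comp_symm_eq hp0 hp, eLpNorm_eq_lintegral_rpow_enorm_toReal hp0 hp,
    ← ENNReal.mul_rpow_of_nonneg _ _ (by positivity)]
  nth_rewrite 1 [e]
  rw [← ENNReal.mul_rpow_of_nonneg _ _ (by positivity), ← lintegral_const_mul' _ _ hfin,
    ← lintegral_const_mul' _ _ ENNReal.ofReal_ne_top]
  gcongr ?_ ^ _
  refine setLIntegral_mono_ae' Ω.isOpen.measurableSet (Eventually.of_forall fun x hx => ?_)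
  set J := |(classicalJacobian φ x).det| with hJ
  have hJc : c ≤ J := h.le_det x hx
  have hJ0 : 0 < J := h.pos.trans_le hJc
  have e1 : ‖q x‖ₑ = ENNReal.ofReal J * ‖q x / J‖ₑ := by
    rw [← Real.enorm_of_nonneg hJ0.le, ← enorm_mul, mul_div_cancel₀ _ hJ0.ne']
  have e2 : ∀ a : ℝ, 0 < a →
      ENNReal.ofReal a ^ p.toReal = ENNReal.ofReal a * ENNReal.ofReal a ^ (p.toReal - 1) := by
    intro a ha
    have ha0 : ENNReal.ofReal a ≠ 0 := by simpa using ha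
    nth_rewrite 2 [← ENNReal.rpow_one (ENNReal.ofReal a)]
    rw [← ENNReal.rpow_add _ _ ha0 ENNReal.ofReal_ne_top, add_sub_cancel]
  rw [e1, ENNReal.mul_rpow_of_nonneg _ _ hr0.le, e2 c h.pos, e2 J hJ0]
  calc ENNReal.ofReal c * ENNReal.ofReal c ^ (p.toReal - 1)
        * (ENNReal.ofReal J * ‖q x / J‖ₑ ^ p.toReal)
      ≤ ENNReal.ofReal c * ENNReal.ofReal J ^ (p.toReal - 1)
        * (ENNReal.ofReal J * ‖q x / J‖ₑ ^ p.toReal) := by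
        gcongr
    _ = _ := by ring

theorem memLp_comp (h : IsBoundedDiffeo Ω Ω' φ c C) (hp0 : p ≠ 0) (hp : p ≠ ∞) {v : Plane → ℝ}
    (hv : MemLp v p (vol Ω')) : MemLp (v ∘ φ) p (vol Ω) := by
  refine ⟨h.aestronglyMeasurable_comp hv.1, ?_⟩
  have hr0 : 0 < p.toReal := ENNReal.toReal_pos hp0 hp
  have hc : ENNReal.ofReal c ^ (1 / p.toReal) ≠ 0 := by
    simp [ENNReal.rpow_eq_zero_iff, h.pos]
  by_contra hcon
  rw [not_lt, top_le_iff] at hcon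
  have := h.eLpNorm_comp_le hp0 hp v
  rw [hcon, ENNReal.mul_top hc, top_le_iff] at this
  exact hv.2.ne this

theorem memLp_comp_symm (h : IsBoundedDiffeo Ω Ω' φ c C) (hp0 : p ≠ 0) (hp : p ≠ ∞)
    {u : Plane → ℝ} (hu : MemLp u p (vol Ω)) : MemLp (u ∘ φ.symm) p (vol Ω') := by
  refine ⟨h.aestronglyMeasurable_comp_symm hu.1, (h.eLpNorm_comp_symm_le hp0 hp u).trans_lt ?_⟩
  exact ENNReal.mul_lt_top (ENNReal.rpow_lt_top_of_nonneg (by positivity) ENNReal.ofReal_ne_top)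
    hu.2

theorem compWellDefined (h : IsBoundedDiffeo Ω Ω' φ c C) (hp0 : p ≠ 0) (hp : p ≠ ∞) :
    CompWellDefined p Ω Ω' φ :=
  ⟨fun _ hv => h.memLp_comp hp0 hp hv, fun _ _ hvw => h.comp_ae_eq hvw⟩

theorem compWellDefined_symm (h : IsBoundedDiffeo Ω Ω' φ c C) (hp0 : p ≠ 0) (hp : p ≠ ∞) :
    CompWellDefined p Ω' Ω φ.symm :=
  ⟨fun _ hv => h.memLp_comp_symm hp0 hp hv, fun _ _ hvw => h.comp_symm_ae_eq hvw⟩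

end IsBoundedDiffeo

end ChangeOfVariables

/-! ### The Piola identity -/

section Piola

variable {Ω Ω' : TopologicalSpace.Opens Plane} {φ : OpenPartialHomeomorph Plane Plane} {c C : ℝ}
  {p : ℝ≥0∞} {f g g' : Plane → ℝ}

theorem LocallyLipschitzOn.congr_eqOn {s : Set Plane} (hf : LocallyLipschitzOn s f)
    (e : EqOn f g s) : LocallyLipschitzOn s g := by
  intro x hx
  obtain ⟨K, t, ht, hl⟩ := hf hx
  refine ⟨K, t ∩ s, inter_mem ht self_mem_nhdsWithin, fun y hy z hz => ?_⟩
  rw [← e hy.2, ← e hz.2]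
  exact hl hy.1 hz.1

open scoped ContDiff in
theorem IsTestFunction.classicalPartial {ψ : Plane → ℝ} (h : IsTestFunction Ω ψ) (i : Fin 2) :
    IsTestFunction Ω (classicalPartial i ψ) :=
  ⟨(h.smooth.fderiv_right (m := ∞) (by simp)).clm_apply contDiff_const,
    h.compact.of_isClosed_subset (isClosed_tsupport _) (tsupport_classicalPartial_subset i ψ),
    (tsupport_classicalPartial_subset i ψ).trans h.support⟩

theorem classicalPartial_comm {ψ : Plane → ℝ} (h : IsTestFunction Ω ψ) (i j : Fin 2) :
    classicalPartial i (classicalPartial j ψ) = classicalPartial j (classicalPartial i ψ) := by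
  have key : ∀ (i j : Fin 2) (x : Plane), classicalPartial i (classicalPartial j ψ) x
      = fderiv ℝ (fderiv ℝ ψ) x (EuclideanSpace.single i 1) (EuclideanSpace.single j 1) := by
    intro i j x
    have hd : DifferentiableAt ℝ (fderiv ℝ ψ) x :=
      (h.smooth.fderiv_right (m := 1) (by norm_cast)).differentiable (by simp) x
    have h1 : HasFDerivAt (fun y => fderiv ℝ ψ y (EuclideanSpace.single j 1)) _ x :=
      hd.hasFDerivAt.clm_apply (hasFDerivAt_const (EuclideanSpace.single j 1) x)
    have h2 : fderiv ℝ (DirichletPerturbation.classicalPartial j ψ) x = _ := h1.fderiv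
    rw [DirichletPerturbation.classicalPartial, h2]
    simp
  funext x
  rw [key, key]
  exact ((h.smooth.of_le (m := 2) (by norm_cast)).contDiffAt.isSymmSndFDerivAt (by simp)) _ _

/-- Weak second derivatives are symmetric. -/
theorem HasWeakPartial.comm {i j : Fin 2} {h : Plane → ℝ} (hi : HasWeakPartial Ω i f g)
    (hj : HasWeakPartial Ω j f g') (hij : HasWeakPartial Ω i g' h) : HasWeakPartial Ω j g h := by
  refine ⟨hi.locInt_deriv, hij.locInt_deriv, fun ψ hψ => ?_⟩
  have h1 := hi.integral_eq _ (hψ.classicalPartial j)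
  have h2 := hj.integral_eq _ (hψ.classicalPartial i)
  have h3 := hij.integral_eq ψ hψ
  rw [classicalPartial_comm hψ] at h1
  linarith

theorem IsBoundedDiffeo.hasWeakPartial (h : IsBoundedDiffeo Ω Ω' φ c C) (i j : Fin 2) :
    HasWeakPartial Ω j (fun x => φ x i) fun x => classicalJacobian φ x i j :=
  hasWeakPartial_of_locallyLipschitzOn (locallyLipschitzOn_of_contDiffAt fun _ hx =>
    contDiffAt_euclidean.1 (h.contDiffAt hx) i) j

theorem IsBoundedDiffeo.ae_partial_comm (h : IsBoundedDiffeo Ω Ω' φ c C) (i : Fin 2) :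
    ∀ᵐ x ∂(vol Ω), classicalPartial 0 (fun y => classicalJacobian φ y i 1) x
      = classicalPartial 1 (fun y => classicalJacobian φ y i 0) x :=
  ((h.hasWeakPartial i 0).comm (h.hasWeakPartial i 1)
    (hasWeakPartial_of_locallyLipschitzOn (h.lipschitz i 1) 0)).unique
    (hasWeakPartial_of_locallyLipschitzOn (h.lipschitz i 0) 1)

theorem classicalPartial_const_mul (s : ℝ) (i : Fin 2) (f : Plane → ℝ) (x : Plane) :
    classicalPartial i (fun y => s * f y) x = s * classicalPartial i f x := by
  have : fderiv ℝ (fun y => s * f y) x = s • fderiv ℝ f x :=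
    congrFun (fderiv_const_smul_field (f := f) s) x
  simp only [classicalPartial, this, smul_apply, smul_eq_mul]

theorem signedCofactor_apply {A : Matrix (Fin 2) (Fin 2) ℝ} (hA : A.det ≠ 0) (k i : Fin 2) :
    signedCofactor A k i = SignType.sign A.det * A.adjugate k i := by
  have e : |A.det| = SignType.sign A.det * A.det := (sign_mul_self A.det).symm
  rw [signedCofactor, Matrix.smul_apply, Matrix.inv_def, Matrix.smul_apply,
    Ring.inverse_eq_inv', smul_eq_mul, smul_eq_mul, e]
  field_simp

/-- The Piola identity: the columns of `|det Dφ| Dφ⁻¹` are divergence free. Up to the locally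
constant sign of `det Dφ`, these columns are rotated gradients. -/
theorem IsBoundedDiffeo.piola (h : IsBoundedDiffeo Ω Ω' φ c C) : ∀ᵐ x ∂(vol Ω), ∀ i,
    ∑ k, classicalPartial k (fun y => signedCofactor (classicalJacobian φ y) k i) x = 0 := by
  filter_upwards [ae_restrict_mem Ω.isOpen.measurableSet,
    ae_all_iff.2 fun i => h.ae_partial_comm i] with x hx hcomm
  -- near `x` the sign of the determinant is constant, and the columns are those of `± adj Dφ`
  have hcont : ContinuousAt (fun y => (classicalJacobian φ y).det) x :=
    (continuousOn_det fun i j => (h.lipschitz i j).continuousOn).continuousAt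
      (Ω.isOpen.mem_nhds hx)
  set s : ℝ := (SignType.sign (classicalJacobian φ x).det : ℝ) with hs
  have hsign : ∀ᶠ y in 𝓝 x, (SignType.sign (classicalJacobian φ y).det : ℝ) = s := by
    rcases lt_or_gt_of_ne (h.det_ne_zero hx) with h0 | h0
    · filter_upwards [(tendsto_order.1 hcont.tendsto).2 0 h0] with y hy
      rw [hs, sign_neg hy, sign_neg h0]
    · filter_upwards [(tendsto_order.1 hcont.tendsto).1 0 h0] with y hy
      rw [hs, sign_pos hy, sign_pos h0]
  have hB : ∀ k i, ∀ᶠ y in 𝓝 x, signedCofactor (classicalJacobian φ y) k i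
      = s * (classicalJacobian φ y).adjugate k i := fun k i => by
    filter_upwards [hsign, Ω.isOpen.mem_nhds hx] with y hy hyΩ
    rw [signedCofactor_apply (h.det_ne_zero hyΩ), hy]
  intro i
  rw [Fin.sum_univ_two, classicalPartial_congr (hB 0 i), classicalPartial_congr (hB 1 i),
    classicalPartial_const_mul, classicalPartial_const_mul, ← mul_add]
  refine mul_eq_zero_of_right _ ?_
  have hneg : ∀ k a b, classicalPartial k (fun y => -classicalJacobian φ y a b) x
      = -classicalPartial k (fun y => classicalJacobian φ y a b) x := fun k a b => by
    simpa using classicalPartial_const_mul (-1) k (fun y => classicalJacobian φ y a b) x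
  have h0 := hcomm 0
  have h1 := hcomm 1
  fin_cases i
  · simp [Matrix.adjugate_fin_two, hneg]
    linarith
  · simp [Matrix.adjugate_fin_two, hneg]
    linarith

end Piola

/-! ### Composition with the inverse diffeomorphism -/

section Composition

variable {Ω Ω' : TopologicalSpace.Opens Plane} {φ : OpenPartialHomeomorph Plane Plane} {c C : ℝ}
  {p : ℝ≥0∞} {u : Plane → ℝ} {u' : Fin 2 → Plane → ℝ}

theorem integrableOn_mul_of_bounded {b : Plane → ℝ}
    (hu : LocallyIntegrableOn u (Ω : Set Plane) volume) {K : Set Plane} (hK : IsCompact K)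
    (hKΩ : K ⊆ (Ω : Set Plane)) (hm : AEStronglyMeasurable b (vol Ω)) {D : ℝ}
    (hb : ∀ x ∈ K, |b x| ≤ D) (h0 : ∀ x ∉ K, b x = 0) :
    IntegrableOn (fun x => u x * b x) (Ω : Set Plane) := by
  have h1 : IntegrableOn (fun x => u x * b x) K :=
    Integrable.mul_bdd (c := D) (hu.integrableOn_compact_subset hKΩ hK)
      (hm.mono_measure (Measure.restrict_mono hKΩ le_rfl))
      (by filter_upwards [ae_restrict_mem hK.measurableSet] with x hx using hb x hx)
  refine h1.of_forall_sdiff_eq_zero Ω.isOpen.measurableSet fun x hx => ?_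
  rw [h0 x hx.2, mul_zero]

theorem classicalPartial_mul {f g : Plane → ℝ} {x : Plane} (hf : DifferentiableAt ℝ f x)
    (hg : DifferentiableAt ℝ g x) (k : Fin 2) : classicalPartial k (fun y => f y * g y) x
      = classicalPartial k f x * g x + f x * classicalPartial k g x := by
  have hd : HasFDerivAt (fun x => f x * g x) (f x • fderiv ℝ g x + g x • fderiv ℝ f x) x :=
    hf.hasFDerivAt.mul hg.hasFDerivAt
  simp only [classicalPartial, hd.fderiv, add_apply, smul_apply, smul_eq_mul]
  ring

namespace IsBoundedDiffeo

theorem classicalPartial_comp (h : IsBoundedDiffeo Ω Ω' φ c C) {χ : Plane → ℝ} {x : Plane}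
    (hx : x ∈ Ω) (hχ : DifferentiableAt ℝ χ (φ x)) (k : Fin 2) :
    classicalPartial k (fun y => χ (φ y)) x
      = ∑ m, classicalJacobian φ x m k * classicalPartial m χ (φ x) := by
  have h1 : HasFDerivAt (fun y => χ (φ y)) _ x := hχ.hasFDerivAt.comp x (h.hasFDerivAt_toLin hx)
  rw [classicalPartial, h1.fderiv, ContinuousLinearMap.comp_apply, clm_apply_eq_sum]
  refine Finset.sum_congr rfl fun m _ => ?_
  fin_cases k <;> fin_cases m <;> simp [Matrix.toLpLin_apply, classicalPartial]

theorem inv_bounded (h : IsBoundedDiffeo Ω Ω' φ c C) (k i : Fin 2) : ∃ D : ℝ,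
    (∀ x ∈ Ω, |(classicalJacobian φ x)⁻¹ k i| ≤ D) ∧ ∀ l, ∀ᵐ x ∂(vol Ω),
      |classicalPartial l (fun x => (classicalJacobian φ x)⁻¹ k i) x| ≤ D :=
  h.exists_bound_comp (contDiffOn_inv k i)

theorem inv_lipschitz (h : IsBoundedDiffeo Ω Ω' φ c C) (k i : Fin 2) :
    LocallyLipschitzOn (Ω : Set Plane) fun x => (classicalJacobian φ x)⁻¹ k i :=
  h.locallyLipschitzOn_comp (contDiffOn_inv k i)

theorem signedCofactor_lipschitz (h : IsBoundedDiffeo Ω Ω' φ c C) (k i : Fin 2) :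
    LocallyLipschitzOn (Ω : Set Plane) fun x => signedCofactor (classicalJacobian φ x) k i :=
  h.locallyLipschitzOn_comp (contDiffOn_signedCofactor k i)

theorem sum_mul_signedCofactor (h : IsBoundedDiffeo Ω Ω' φ c C) {x : Plane} (hx : x ∈ Ω)
    (m i : Fin 2) : ∑ k, classicalJacobian φ x m k * signedCofactor (classicalJacobian φ x) k i
      = |(classicalJacobian φ x).det| * (1 : Matrix (Fin 2) (Fin 2) ℝ) m i := by
  have e := Matrix.mul_nonsing_inv (classicalJacobian φ x) (isUnit_iff_ne_zero.2 (h.det_ne_zero hx))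
  rw [← e, Matrix.mul_apply, Finset.mul_sum]
  refine Finset.sum_congr rfl fun k _ => ?_
  rw [signedCofactor, Matrix.smul_apply, smul_eq_mul]
  ring

/-- The function is `(Dφ⁻ᵗ ∇u)ᵢ`, the `i`-th derivative of `u ∘ φ⁻¹` pulled back to `Ω`. -/
theorem memLp_sum_inv_mul (h : IsBoundedDiffeo Ω Ω' φ c C) (hu' : ∀ k, MemLp (u' k) p (vol Ω))
    (i : Fin 2) : MemLp (fun x => ∑ k, (classicalJacobian φ x)⁻¹ k i * u' k x) p (vol Ω) := by
  refine memLp_finsetSum _ fun k _ => ?_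
  obtain ⟨D, hD, -⟩ := h.inv_bounded k i
  refine MemLp.of_le_mul (c := D) (hu' k)
    (((h.inv_lipschitz k i).continuousOn.aestronglyMeasurable Ω.isOpen.measurableSet).mul
      (hu' k).1) ?_
  filter_upwards [ae_restrict_mem Ω.isOpen.measurableSet] with x hx
  rw [norm_mul]
  exact mul_le_mul_of_nonneg_right (hD x hx) (norm_nonneg _)

/-- The chain rule for Sobolev functions. Changing variables turns a test function `χ` on `Ω'` into
the vector field `η = (χ ∘ φ) |det Dφ| Dφ⁻¹ eᵢ`, which is locally Lipschitz with divergence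
`|det Dφ| (∂ᵢχ ∘ φ)` by the Piola identity, and `u` may be integrated by parts against `η`. -/
theorem hasWeakPartial_comp_symm (h : IsBoundedDiffeo Ω Ω' φ c C) (hp1 : 1 ≤ p) (hp : p ≠ ∞)
    (hw : ∀ k, HasWeakPartial Ω k u (u' k)) (hu : MemLp u p (vol Ω))
    (hu' : ∀ k, MemLp (u' k) p (vol Ω)) (i : Fin 2) :
    HasWeakPartial Ω' i (u ∘ φ.symm)
      ((fun x => ∑ k, (classicalJacobian φ x)⁻¹ k i * u' k x) ∘ φ.symm) := by
  have hp0 : p ≠ 0 := (zero_lt_one.trans_le hp1).ne'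
  have hloc : ∀ {a : Plane → ℝ}, MemLp a p (vol Ω') →
      LocallyIntegrableOn a (Ω' : Set Plane) volume := fun ha =>
    locallyIntegrableOn_of_locallyIntegrable_restrict (ha.locallyIntegrable hp1)
  refine ⟨hloc (h.memLp_comp_symm hp0 hp hu),
    hloc (h.memLp_comp_symm hp0 hp (h.memLp_sum_inv_mul hu' i)), fun χ hχ => ?_⟩
  set B : Fin 2 → Plane → ℝ := fun k x => signedCofactor (classicalJacobian φ x) k i with hB
  set η : Fin 2 → Plane → ℝ := fun k => (Ω : Set Plane).indicator fun x => B k x * χ (φ x) with hη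
  have hχd : Differentiable ℝ χ := hχ.smooth.differentiable (by simp)
  set K := φ.symm '' tsupport χ with hKdef
  have hK : IsCompact K := hχ.compact.image_of_continuousOn
    (φ.symm.continuousOn.mono (by simpa [h.target_eq] using hχ.support))
  have hKΩ : K ⊆ (Ω : Set Plane) := by
    rintro _ ⟨y, hy, rfl⟩
    exact h.mapsTo_symm (hχ.support hy)
  have hχ0 : ∀ x ∈ Ω, x ∉ K → χ (φ x) = 0 := fun x hx hxK =>
    image_eq_zero_of_notMem_tsupport fun hc => hxK ⟨φ x, hc, h.left_inv hx⟩
  have hη0 : ∀ k, ∀ x ∉ K, η k x = 0 := fun k x hx => by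
    by_cases hxΩ : x ∈ (Ω : Set Plane)
    · rw [hη]
      simp only [indicator_of_mem hxΩ, hχ0 x hxΩ hx, mul_zero]
    · exact indicator_of_notMem hxΩ _
  have hηe : ∀ k, EqOn (fun x => B k x * χ (φ x)) (η k) (Ω : Set Plane) := fun k x hx => by
    simp only [hη, indicator_of_mem hx]
  have hχφ : LocallyLipschitzOn (Ω : Set Plane) fun x => χ (φ x) :=
    locallyLipschitzOn_of_contDiffAt fun x hx =>
      (hχ.smooth.of_le (by simp)).contDiffAt.comp x (h.contDiffAt hx)
  have hηl : ∀ k, LocallyLipschitzOn (Ω : Set Plane) (η k) := fun k =>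
    LocallyLipschitzOn.congr_eqOn
      (LocallyLipschitzOn.mul_real (h.signedCofactor_lipschitz k i) hχφ) (hηe k)
  have hd : ∀ᵐ x ∂(vol Ω), ∑ k, classicalPartial k (η k) x
      = |(classicalJacobian φ x).det| * classicalPartial i χ (φ x) := by
    filter_upwards [ae_restrict_mem Ω.isOpen.measurableSet, h.piola,
      ae_all_iff.2 fun k => ae_differentiableAt (h.signedCofactor_lipschitz k i)] with x hx hP hdB
    have hxd : DifferentiableAt ℝ (fun y => χ (φ y)) x :=
      (hχd (φ x)).comp x ((h.contDiffAt hx).differentiableAt (by simp))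
    have e : ∀ k, classicalPartial k (η k) x = classicalPartial k (B k) x * χ (φ x)
        + B k x * ∑ m, classicalJacobian φ x m k * classicalPartial m χ (φ x) := fun k => by
      rw [← h.classicalPartial_comp hx (hχd (φ x)), ← classicalPartial_mul (hdB k) hxd]
      exact (classicalPartial_congr ((hηe k).eventuallyEq_of_mem (Ω.isOpen.mem_nhds hx)) k).symm
    have hP' : ∑ k, classicalPartial k (B k) x = 0 := hP i
    have hS := fun m => h.sum_mul_signedCofactor hx m i
    have hδ : ∑ m, (1 : Matrix (Fin 2) (Fin 2) ℝ) m i * classicalPartial m χ (φ x)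
        = classicalPartial i χ (φ x) := by
      fin_cases i <;> simp [Matrix.one_apply]
    rw [← hδ]
    simp only [e]
    simp only [Fin.sum_univ_two] at hP' hS ⊢
    have hS0 := hS 0
    have hS1 := hS 1
    simp only [hB] at hP' ⊢
    linear_combination χ (φ x) * hP' + classicalPartial 0 χ (φ x) * hS0
      + classicalPartial 1 χ (φ x) * hS1
  have i1 : ∀ k, IntegrableOn (fun x => u x * classicalPartial k (η k) x) (Ω : Set Plane) := by
    intro k
    obtain ⟨D, hD⟩ := exists_abs_classicalPartial_le (hηl k) hK hKΩ k
    refine integrableOn_mul_of_bounded (hw 0).locInt hK hKΩ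
      (measurable_classicalPartial k _).aestronglyMeasurable hD fun x hx => ?_
    have e : η k =ᶠ[𝓝 x] 0 := by
      filter_upwards [hK.isClosed.isOpen_compl.mem_nhds hx] with y hy using hη0 k y hy
    rw [classicalPartial_congr e]
    simp [classicalPartial]
  have i2 : ∀ k, IntegrableOn (fun x => u' k x * η k x) (Ω : Set Plane) := by
    intro k
    obtain ⟨D, hD⟩ := hK.exists_bound_of_continuousOn ((hηl k).continuousOn.mono hKΩ)
    exact integrableOn_mul_of_bounded (hw k).locInt_deriv hK hKΩ
      ((hηl k).continuousOn.aestronglyMeasurable Ω.isOpen.measurableSet) hD (hη0 k)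
  rw [h.setIntegral_eq, h.setIntegral_eq]
  have e1 : ∫ x in (Ω : Set Plane), |(classicalJacobian φ x).det|
        * ((u ∘ φ.symm) (φ x) * classicalPartial i χ (φ x))
      = ∑ k, ∫ x in (Ω : Set Plane), u x * classicalPartial k (η k) x := by
    rw [← integral_finsetSum _ fun k _ => i1 k]
    refine integral_congr_ae ?_
    filter_upwards [ae_restrict_mem Ω.isOpen.measurableSet, hd] with x hx hdx
    rw [← Finset.mul_sum, hdx, Function.comp_apply, h.left_inv hx]
    ring
  have e2 : ∫ x in (Ω : Set Plane), |(classicalJacobian φ x).det|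
        * (((fun x => ∑ k, (classicalJacobian φ x)⁻¹ k i * u' k x) ∘ φ.symm) (φ x) * χ (φ x))
      = ∑ k, ∫ x in (Ω : Set Plane), u' k x * η k x := by
    rw [← integral_finsetSum _ fun k _ => i2 k]
    refine integral_congr_ae ?_
    filter_upwards [ae_restrict_mem Ω.isOpen.measurableSet] with x hx
    simp only [Function.comp_apply, h.left_inv hx, ← hηe _ hx, hB, signedCofactor,
      Matrix.smul_apply, smul_eq_mul, Fin.sum_univ_two]
    ring
  rw [e1, e2, ← Finset.sum_neg_distrib]
  exact Finset.sum_congr rfl fun k _ =>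
    (hw k).integral_eq_of_locallyLipschitzOn (hηl k) hK hKΩ (hη0 k)

theorem memSobolev_one_comp_symm (h : IsBoundedDiffeo Ω Ω' φ c C) (hp1 : 1 ≤ p) (hp : p ≠ ∞)
    (hu : MemSobolev 1 p Ω u) : MemSobolev 1 p Ω' (u ∘ φ.symm) := by
  have hp0 : p ≠ 0 := (zero_lt_one.trans_le hp1).ne'
  have hu' : ∀ k, MemLp (weakPartial Ω k u) p (vol Ω) := fun k => (hu.weakPartial k).memLp
  exact ⟨h.memLp_comp_symm hp0 hp hu.memLp, fun i => ⟨_,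
    h.hasWeakPartial_comp_symm hp1 hp hu.hasWeakPartial hu.memLp hu' i,
    h.memLp_comp_symm hp0 hp (h.memLp_sum_inv_mul hu' i)⟩⟩

end IsBoundedDiffeo

end Composition

/-! ### The space of Sobolev functions with zero boundary values -/

section SobolevZero

variable {Ω Ω' : TopologicalSpace.Opens Plane} {φ : OpenPartialHomeomorph Plane Plane} {c C : ℝ}
  {p : ℝ≥0∞} {f g u : Plane → ℝ}

theorem sobolevNorm_one_congr (hf : MemSobolev 1 p Ω f) (e : f =ᵐ[vol Ω] g) :
    sobolevNorm 1 p Ω f = sobolevNorm 1 p Ω g := by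
  rw [sobolevNorm_one_eq hf.hasWeakPartial,
    sobolevNorm_one_eq fun i => (hf.hasWeakPartial i).congr e (EventuallyEq.refl _ _),
    eLpNorm_congr_ae e]

theorem MemSobolev.sub {k : ℕ} (hf : MemSobolev k p Ω f) (hg : MemSobolev k p Ω g) :
    MemSobolev k p Ω (f - g) := by
  have := hf.add (hg.const_smul (-1))
  simpa [sub_eq_add_neg] using this

theorem sobolevNorm_one_add_le (hp1 : 1 ≤ p) (hf : MemSobolev 1 p Ω f) (hg : MemSobolev 1 p Ω g) :
    sobolevNorm 1 p Ω (f + g) ≤ sobolevNorm 1 p Ω f + sobolevNorm 1 p Ω g := by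
  rw [sobolevNorm_one_eq hf.hasWeakPartial, sobolevNorm_one_eq hg.hasWeakPartial,
    sobolevNorm_one_eq fun i => (hf.hasWeakPartial i).add (hg.hasWeakPartial i),
    add_add_add_comm, ← Finset.sum_add_distrib]
  gcongr with i
  · exact eLpNorm_add_le hf.memLp.1 hg.memLp.1 hp1
  · exact eLpNorm_add_le (hf.weakPartial i).memLp.1 (hg.weakPartial i).memLp.1 hp1

theorem IsTestFunction.memSobolev_one {ψ : Plane → ℝ} (h : IsTestFunction Ω ψ) :
    MemSobolev 1 p Ω ψ :=
  ⟨(h.smooth.continuous.memLp_of_hasCompactSupport h.compact).restrict _,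
    fun i => ⟨_, h.hasWeakPartial i, ((h.continuous_partial i).memLp_of_hasCompactSupport
      (h.classicalPartial i).compact).restrict _⟩⟩

/-- `W_0^{1,p}(Ω)` is closed in `W^{1,p}(Ω)`. -/
theorem memSobolevZero_of_forall_approx (hp1 : 1 ≤ p) (hu : MemSobolev 1 p Ω u)
    (h : ∀ ε : ℝ≥0∞, 0 < ε → ∃ f, MemSobolevZero p Ω f ∧ sobolevNorm 1 p Ω (u - f) < ε) :
    MemSobolevZero p Ω u := by
  refine ⟨hu, fun ε hε => ?_⟩
  obtain ⟨f, hf, h1⟩ := h (ε / 2) (ENNReal.half_pos hε.ne')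
  obtain ⟨ψ, hψ, h2⟩ := hf.2 (ε / 2) (ENNReal.half_pos hε.ne')
  refine ⟨ψ, hψ, ?_⟩
  have e : u - ψ = (u - f) + (f - ψ) := by abel
  rw [e]
  refine (sobolevNorm_one_add_le hp1 (hu.sub hf.1) (hf.1.sub hψ.memSobolev_one)).trans_lt ?_
  exact (ENNReal.add_lt_add h1 h2).trans_eq (ENNReal.add_halves ε)

theorem tendsto_eLpNorm_sub_of_bounded (hp0 : p ≠ 0) (hp : p ≠ ∞) {F : ℕ → Plane → ℝ}
    {K : Set Plane} {D : ℝ} (hK : IsCompact K) (hF : ∀ n, AEStronglyMeasurable (F n) (vol Ω))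
    (hf : AEStronglyMeasurable f (vol Ω)) (h0 : ∀ n, ∀ x ∉ K, F n x = 0)
    (hb : ∀ n x, |F n x| ≤ D) (hlim : ∀ᵐ x, Tendsto (fun n => F n x) atTop (𝓝 (f x))) :
    Tendsto (fun n => eLpNorm (f - F n) p (vol Ω)) atTop (𝓝 0) := by
  have hr0 : 0 < p.toReal := ENNReal.toReal_pos hp0 hp
  have key : Tendsto (fun n => ∫⁻ x in (Ω : Set Plane), ‖(f - F n) x‖ₑ ^ p.toReal) atTop
      (𝓝 (∫⁻ x in (Ω : Set Plane), 0)) := by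
    refine tendsto_lintegral_of_dominated_convergence' (bound := K.indicator fun _ =>
      ENNReal.ofReal (2 * D) ^ p.toReal) (fun n => ?_) (fun n => ?_) ?_ ?_
    · exact ((hf.sub (hF n)).enorm.pow_const _)
    · filter_upwards [ae_restrict_of_ae hlim] with x hx
      by_cases hxK : x ∈ K
      · rw [indicator_of_mem hxK]
        gcongr
        rw [← ofReal_norm]
        gcongr
        have h1 : |f x| ≤ D := le_of_tendsto hx.abs (Eventually.of_forall fun n => hb n x)
        have h2 := hb n x
        rw [Pi.sub_apply, Real.norm_eq_abs]
        exact (abs_sub _ _).trans (by linarith)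
      · have h1 : f x = 0 := tendsto_nhds_unique hx (by simp [h0 _ x hxK])
        simp [h1, h0 n x hxK, hr0]
    · rw [lintegral_indicator_const hK.measurableSet]
      refine ENNReal.mul_ne_top (ENNReal.rpow_ne_top_of_nonneg hr0.le ENNReal.ofReal_ne_top) ?_
      exact ((Measure.restrict_apply_le _ _).trans_lt hK.measure_lt_top).ne
    · filter_upwards [ae_restrict_of_ae hlim] with x hx
      have h1 : Tendsto (fun n => (f - F n) x) atTop (𝓝 0) := by
        simpa using hx.const_sub (f x)
      have h2 := (h1.enorm).ennrpow_const p.toReal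
      simpa [hr0] using h2
  simp only [lintegral_zero] at key
  have := key.ennrpow_const (1 / p.toReal)
  simp only [eLpNorm_eq_lintegral_rpow_enorm_toReal hp0 hp]
  simpa [hr0] using this

/-- Locally Lipschitz functions vanishing off a compact subset of `Ω` belong to
`W_0^{1,p}(Ω)`. -/
theorem memSobolevZero_of_locallyLipschitzOn (hp1 : 1 ≤ p) (hp : p ≠ ∞)
    (hf : LocallyLipschitzOn (Ω : Set Plane) f) {K : Set Plane}
    (hK : IsCompact K) (hKΩ : K ⊆ (Ω : Set Plane)) (h0 : ∀ x ∉ K, f x = 0) :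
    MemSobolevZero p Ω f := by
  have hp0 : p ≠ 0 := (zero_lt_one.trans_le hp1).ne'
  obtain ⟨F, K', D, hK', hKΩ', ht, hF, hF', hb, hb', hl, hl'⟩ :=
    exists_testFunction_approx hf hK hKΩ h0
  have hfm : AEStronglyMeasurable f (vol Ω) :=
    hf.continuousOn.aestronglyMeasurable Ω.isOpen.measurableSet
  have t0 := tendsto_eLpNorm_sub_of_bounded (Ω := Ω) hp0 hp hK'
    (fun n => (ht n).smooth.continuous.aestronglyMeasurable) hfm hF hb hl
  have t1 := fun i => tendsto_eLpNorm_sub_of_bounded (Ω := Ω) hp0 hp hK'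
    (fun n => ((ht n).continuous_partial i).aestronglyMeasurable)
    (measurable_classicalPartial i f).aestronglyMeasurable (fun n => hF' n i)
    (fun n => hb' n i) (hl' i)
  have hw := fun i => hasWeakPartial_of_locallyLipschitzOn hf i
  have hnorm : ∀ n, sobolevNorm 1 p Ω (f - F n) = eLpNorm (f - F n) p (vol Ω)
      + ∑ i, eLpNorm (classicalPartial i f - classicalPartial i (F n)) p (vol Ω) := fun n =>
    sobolevNorm_one_eq fun i => (hw i).sub ((ht n).hasWeakPartial i)
  have t2 : Tendsto (fun n => sobolevNorm 1 p Ω (f - F n)) atTop (𝓝 0) := by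
    simp only [hnorm]
    have := t0.add (tendsto_finsetSum Finset.univ fun i _ => t1 i)
    simpa using this
  have hmem : ∀ {a : Plane → ℝ} {b : ℕ → Plane → ℝ}, AEStronglyMeasurable a (vol Ω) →
      (∀ n, MemLp (b n) p (vol Ω)) →
      Tendsto (fun n => eLpNorm (a - b n) p (vol Ω)) atTop (𝓝 0) → MemLp a p (vol Ω) := by
    intro a b ha hb ht
    obtain ⟨n, hn⟩ := ((tendsto_order.1 ht).2 1 zero_lt_one).exists
    have h1 : MemLp (a - b n) p (vol Ω) := ⟨ha.sub (hb n).1, hn.trans ENNReal.one_lt_top⟩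
    simpa using h1.add (hb n)
  refine ⟨⟨hmem hfm (fun n => ((ht n).memSobolev_one (p := p)).memLp) t0, fun i => ⟨_, hw i,
    hmem (measurable_classicalPartial i f).aestronglyMeasurable (fun n =>
      (memLp_congr_ae ((ht n).hasWeakPartial i).ae_eq).1
        (((ht n).memSobolev_one (p := p)).weakPartial i).memLp) (t1 i)⟩⟩, fun ε hε => ?_⟩
  obtain ⟨n, hn⟩ := ((tendsto_order.1 t2).2 ε hε).exists
  exact ⟨F n, ht n, hn⟩

namespace IsBoundedDiffeo

theorem exists_sobolevNorm_comp_symm_le (h : IsBoundedDiffeo Ω Ω' φ c C) (hp1 : 1 ≤ p)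
    (hp : p ≠ ∞) : ∃ D : ℝ≥0∞, D ≠ ∞ ∧ ∀ u, MemSobolev 1 p Ω u →
      sobolevNorm 1 p Ω' (u ∘ φ.symm) ≤ D * sobolevNorm 1 p Ω u := by
  have hp0 : p ≠ 0 := (zero_lt_one.trans_le hp1).ne'
  choose D₀ hD₀ using fun k i => h.inv_bounded k i
  set E : ℝ≥0∞ := ∑ k, ∑ i, ENNReal.ofReal (D₀ k i) with hE
  have hEle : ∀ k i, ENNReal.ofReal (D₀ k i) ≤ E := fun k i =>
    (Finset.single_le_sum (f := fun i => ENNReal.ofReal (D₀ k i)) (fun _ _ => zero_le)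
      (Finset.mem_univ i)).trans (Finset.single_le_sum
        (f := fun k => ∑ i, ENNReal.ofReal (D₀ k i)) (fun _ _ => zero_le) (Finset.mem_univ k))
  set M := ENNReal.ofReal (2 * C ^ 2) ^ (1 / p.toReal) with hM
  have hMfin : M ≠ ∞ := ENNReal.rpow_ne_top_of_nonneg (by positivity) ENNReal.ofReal_ne_top
  have hEfin : E ≠ ∞ := by simp [hE]
  refine ⟨M * (1 + 2 * E), ENNReal.mul_ne_top hMfin (ENNReal.add_ne_top.2 ⟨by simp,
    ENNReal.mul_ne_top (by simp) hEfin⟩), fun u hu => ?_⟩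
  have hu' : ∀ k, MemLp (weakPartial Ω k u) p (vol Ω) := fun k => (hu.weakPartial k).memLp
  rw [sobolevNorm_one_eq fun i =>
    h.hasWeakPartial_comp_symm hp1 hp hu.hasWeakPartial hu.memLp hu' i,
    sobolevNorm_one_eq hu.hasWeakPartial]
  have hS : ∀ i, eLpNorm ((fun x => ∑ k, (classicalJacobian φ x)⁻¹ k i * weakPartial Ω k u x)
      ∘ φ.symm) p (vol Ω') ≤ M * (E * ∑ k, eLpNorm (weakPartial Ω k u) p (vol Ω)) := by
    intro i
    refine (h.eLpNorm_comp_symm_le hp0 hp _).trans ?_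
    gcongr
    have e : (fun x => ∑ k, (classicalJacobian φ x)⁻¹ k i * weakPartial Ω k u x)
        = ∑ k, fun x => (classicalJacobian φ x)⁻¹ k i * weakPartial Ω k u x := by
      funext x
      simp
    rw [e, Finset.mul_sum]
    refine (eLpNorm_sum_le (fun k _ => ((h.inv_lipschitz k i).continuousOn.aestronglyMeasurable
      Ω.isOpen.measurableSet).mul (hu' k).1) hp1).trans (Finset.sum_le_sum fun k _ => ?_)
    refine (eLpNorm_le_mul_eLpNorm_of_ae_le_mul (c := D₀ k i) ?_ p).trans
      (mul_le_mul_left (hEle k i) _)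
    filter_upwards [ae_restrict_mem Ω.isOpen.measurableSet] with x hx
    rw [Pi.mul_apply, norm_mul]
    exact mul_le_mul_of_nonneg_right ((hD₀ k i).1 x hx) (norm_nonneg _)
  refine (add_le_add (h.eLpNorm_comp_symm_le hp0 hp u)
    (Finset.sum_le_sum fun i _ => hS i)).trans ?_
  rw [Finset.sum_const, Finset.card_univ, Fintype.card_fin, nsmul_eq_mul]
  set a := eLpNorm u p (vol Ω)
  set b := ∑ k, eLpNorm (weakPartial Ω k u) p (vol Ω)
  calc M * a + ((2 : ℕ) : ℝ≥0∞) * (M * (E * b)) = M * (a + 2 * E * b) := by push_cast; ring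
    _ ≤ M * ((1 + 2 * E) * (a + b)) := by
        gcongr
        calc a + 2 * E * b ≤ (a + 2 * E * b) + (b + 2 * E * a) := le_self_add
          _ = (1 + 2 * E) * (a + b) := by ring
    _ = _ := by ring

/-- Transport by `φ` preserves `W_0^{1,p}`: test functions are transported to compactly supported
Lipschitz functions. -/
theorem memSobolevZero_comp_symm (h : IsBoundedDiffeo Ω Ω' φ c C) (hp1 : 1 ≤ p) (hp : p ≠ ∞)
    (hu : MemSobolevZero p Ω u) : MemSobolevZero p Ω' (u ∘ φ.symm) := by
  obtain ⟨D, hD, hle⟩ := h.exists_sobolevNorm_comp_symm_le hp1 hp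
  refine memSobolevZero_of_forall_approx hp1 (h.memSobolev_one_comp_symm hp1 hp hu.1)
    fun ε hε => ?_
  obtain ⟨ψ, hψ, hlt⟩ := hu.2 (ε / (D + 1)) (ENNReal.div_pos hε.ne' (by simp [hD]))
  -- `φ.symm` is arbitrary off `Ω'`, so the transported test function is extended by zero
  set f := (Ω' : Set Plane).indicator (ψ ∘ φ.symm) with hf
  have hfe : EqOn (ψ ∘ φ.symm) f (Ω' : Set Plane) := fun x hx => (indicator_of_mem hx _).symm
  have hfae : ψ ∘ φ.symm =ᵐ[vol Ω'] f := by
    filter_upwards [ae_restrict_mem Ω'.isOpen.measurableSet] with x hx using hfe hx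
  have hlip : LocallyLipschitzOn (Ω' : Set Plane) f :=
    LocallyLipschitzOn.congr_eqOn (locallyLipschitzOn_of_contDiffAt fun x hx =>
      (hψ.smooth.of_le (by simp)).contDiffAt.comp x (h.contDiffAt_symm hx)) hfe
  have hK : IsCompact (φ '' tsupport ψ) := hψ.compact.image_of_continuousOn
    (φ.continuousOn.mono (by simpa [h.source_eq] using hψ.support))
  have hKΩ : φ '' tsupport ψ ⊆ (Ω' : Set Plane) := by
    rintro _ ⟨y, hy, rfl⟩
    exact h.mapsTo (hψ.support hy)
  refine ⟨f, memSobolevZero_of_locallyLipschitzOn hp1 hp hlip hK hKΩ fun y hy => ?_, ?_⟩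
  · by_cases hyΩ : y ∈ (Ω' : Set Plane)
    · rw [← hfe hyΩ]
      exact image_eq_zero_of_notMem_tsupport (f := ψ)
        fun hc => hy ⟨φ.symm y, hc, h.right_inv hyΩ⟩
    · exact indicator_of_notMem hyΩ _
  · have hm : MemSobolev 1 p Ω (u - ψ) := hu.1.sub hψ.memSobolev_one
    have hm' := h.memSobolev_one_comp_symm hp1 hp hm
    have e : (u - ψ) ∘ φ.symm =ᵐ[vol Ω'] u ∘ φ.symm - f := by
      filter_upwards [hfae] with x hx
      simp only [Function.comp_apply, Pi.sub_apply] at hx ⊢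
      rw [hx]
    rw [← sobolevNorm_one_congr hm' e]
    calc sobolevNorm 1 p Ω' ((u - ψ) ∘ φ.symm) ≤ D * sobolevNorm 1 p Ω (u - ψ) := hle _ hm
      _ ≤ (D + 1) * sobolevNorm 1 p Ω (u - ψ) := by gcongr; exact le_self_add
      _ < ε := by
        rw [mul_comm]
        exact (ENNReal.lt_div_iff_mul_lt (Or.inl (by simp)) (Or.inl (by simp [hD]))).1 hlt

end IsBoundedDiffeo

end SobolevZero

/-! ### The Laplacian of a transported function -/

section TransportedLaplacian

variable {Ω Ω' : TopologicalSpace.Opens Plane} {φ : OpenPartialHomeomorph Plane Plane} {c C : ℝ}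
  {p : ℝ≥0∞} {u : Plane → ℝ}

theorem HasWeakPartial.sum {ι : Type*} [Fintype ι] [Nonempty ι] {i : Fin 2}
    {f g : ι → Plane → ℝ} (h : ∀ k, HasWeakPartial Ω i (f k) (g k)) :
    HasWeakPartial Ω i (fun x => ∑ k, f k x) (fun x => ∑ k, g k x) := by
  classical
  have key : ∀ s : Finset ι, HasWeakPartial Ω i (fun x => ∑ k ∈ s, f k x)
      (fun x => ∑ k ∈ s, g k x) := by
    intro s
    induction s using Finset.induction_on with
    | empty =>
      have h0 := (h (Classical.arbitrary ι)).const_smul 0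
      simp only [zero_smul] at h0
      simp only [Finset.sum_empty]
      exact h0
    | insert a s ha ih =>
      simp only [Finset.sum_insert ha]
      exact (h a).add ih
  exact key _

/-- The `i`-th derivative of `u ∘ φ⁻¹`, transported back to `Ω`: by the chain rule, the `i`-th entry
of `Dφ⁻ᵗ ∇u`. -/
noncomputable def transportedPartial (Ω : TopologicalSpace.Opens Plane) (φ : Plane → Plane)
    (i : Fin 2) (u : Plane → ℝ) (x : Plane) : ℝ :=
  ∑ k, (classicalJacobian φ x)⁻¹ k i * weakPartial Ω k u x

namespace IsBoundedDiffeo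

theorem hasWeakPartial_transported (h : IsBoundedDiffeo Ω Ω' φ c C) (hp1 : 1 ≤ p) (hp : p ≠ ∞)
    (hu : MemSobolev 1 p Ω u) (i : Fin 2) :
    HasWeakPartial Ω' i (u ∘ φ.symm) (transportedPartial Ω φ i u ∘ φ.symm) :=
  h.hasWeakPartial_comp_symm hp1 hp hu.hasWeakPartial hu.memLp
    (fun k => (hu.weakPartial k).memLp) i

theorem hasWeakPartial_transportedPartial (h : IsBoundedDiffeo Ω Ω' φ c C)
    (hu : MemSobolev 2 p Ω u) (i l : Fin 2) :
    HasWeakPartial Ω l (transportedPartial Ω φ i u) fun x =>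
      ∑ k, ((classicalJacobian φ x)⁻¹ k i * weakPartial Ω l (weakPartial Ω k u) x
        + classicalPartial l (fun y => (classicalJacobian φ y)⁻¹ k i) x * weakPartial Ω k u x) := by
  refine HasWeakPartial.sum fun k => ?_
  obtain ⟨D, h1, h2⟩ := h.inv_bounded k i
  refine ((hu.weakPartial k).hasWeakPartial l).mul_locallyLipschitzOn (h.inv_lipschitz k i)
    (C := D) ?_ (h2 l)
  filter_upwards [ae_restrict_mem Ω.isOpen.measurableSet] with x hx using h1 x hx

theorem memSobolev_transportedPartial (h : IsBoundedDiffeo Ω Ω' φ c C)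
    (hu : MemSobolev 2 p Ω u) (i : Fin 2) : MemSobolev 1 p Ω (transportedPartial Ω φ i u) := by
  refine ⟨h.memLp_sum_inv_mul (fun k => (hu.weakPartial k).memLp) i, fun l =>
    ⟨_, h.hasWeakPartial_transportedPartial hu i l, ?_⟩⟩
  refine memLp_finsetSum _ fun k _ => ?_
  obtain ⟨D, h1, h2⟩ := h.inv_bounded k i
  have m1 := ((hu.weakPartial k).weakPartial l).memLp
  have m2 := (hu.weakPartial k).memLp
  refine MemLp.add (MemLp.of_le_mul (c := D) m1
      (((h.inv_lipschitz k i).continuousOn.aestronglyMeasurable Ω.isOpen.measurableSet).mul m1.1)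
      ?_)
    (MemLp.of_le_mul (c := D) m2 ((measurable_classicalPartial l _).aestronglyMeasurable.mul m2.1)
      ?_)
  · filter_upwards [ae_restrict_mem Ω.isOpen.measurableSet] with x hx
    rw [norm_mul]
    exact mul_le_mul_of_nonneg_right (h1 x hx) (norm_nonneg _)
  · filter_upwards [h2 l] with x hx
    rw [norm_mul]
    exact mul_le_mul_of_nonneg_right hx (norm_nonneg _)

theorem memSobolev_two_comp_symm (h : IsBoundedDiffeo Ω Ω' φ c C) (hp1 : 1 ≤ p) (hp : p ≠ ∞)
    (hu : MemSobolev 2 p Ω u) : MemSobolev 2 p Ω' (u ∘ φ.symm) :=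
  have hu1 : MemSobolev 1 p Ω u :=
    ⟨hu.memLp, fun i => ⟨_, hu.hasWeakPartial i, (hu.weakPartial i).memLp⟩⟩
  ⟨h.memLp_comp_symm (zero_lt_one.trans_le hp1).ne' hp hu.memLp, fun i =>
    ⟨_, h.hasWeakPartial_transported hp1 hp hu1 i,
      h.memSobolev_one_comp_symm hp1 hp (h.memSobolev_transportedPartial hu i)⟩⟩

/-- The Laplacian of `u ∘ φ⁻¹`, transported back to `Ω`, is
`|det Dφ|⁻¹ (Δu + div (M_φ ∇u))`. The first derivatives of `Dφ⁻¹` combine into the divergence of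
`M_φ` by the Piola identity. -/
theorem weakLaplacian_comp_symm (h : IsBoundedDiffeo Ω Ω' φ c C) (hp1 : 1 ≤ p) (hp : p ≠ ∞)
    (hu : MemSobolev 2 p Ω u) :
    weakLaplacian Ω' (u ∘ φ.symm) =ᵐ[vol Ω'] (fun x => (weakLaplacian Ω u x
      + ∑ k, ∑ l, matrixDefect (classicalJacobian φ x) k l
          * weakPartial Ω l (weakPartial Ω k u) x
      + ∑ k, (∑ l, classicalPartial l (fun y => matrixDefect (classicalJacobian φ y) k l) x)
          * weakPartial Ω k u x) / |(classicalJacobian φ x).det|) ∘ φ.symm := by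
  have hu1 : MemSobolev 1 p Ω u :=
    ⟨hu.memLp, fun i => ⟨_, hu.hasWeakPartial i, (hu.weakPartial i).memLp⟩⟩
  have hv := fun i => h.memSobolev_transportedPartial hu i
  have e1 : ∀ i, weakPartial Ω' i (weakPartial Ω' i (u ∘ φ.symm)) =ᵐ[vol Ω']
      transportedPartial Ω φ i (transportedPartial Ω φ i u) ∘ φ.symm := fun i => by
    have h1 := (h.hasWeakPartial_transported hp1 hp hu1 i).ae_eq
    exact ((h.hasWeakPartial_transported hp1 hp (hv i) i).congr h1.symm
      (EventuallyEq.refl _ _)).ae_eq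
  have e2 : weakLaplacian Ω' (u ∘ φ.symm) =ᵐ[vol Ω']
      (fun x => ∑ i, transportedPartial Ω φ i (transportedPartial Ω φ i u) x) ∘ φ.symm := by
    filter_upwards [ae_all_iff.2 e1] with y hy
    exact Finset.sum_congr rfl fun i _ => hy i
  refine e2.trans (h.comp_symm_ae_eq ?_)
  have e3 := ae_all_iff.2 fun i => ae_all_iff.2 fun l =>
    (h.hasWeakPartial_transportedPartial hu i l).ae_eq
  filter_upwards [ae_restrict_mem Ω.isOpen.measurableSet, e3, h.piola,
    ae_all_iff.2 fun k => ae_all_iff.2 fun i =>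
      ae_differentiableAt (h.signedCofactor_lipschitz k i),
    ae_all_iff.2 fun k => ae_all_iff.2 fun i => ae_differentiableAt (h.inv_lipschitz k i)]
    with x hx he hP hdB hdg
  have hdet : |(classicalJacobian φ x).det| ≠ 0 := abs_ne_zero.2 (h.det_ne_zero hx)
  -- the derivative of `M = (|det Dφ| Dφ⁻¹) Dφ⁻ᵗ - I`
  have hM : ∀ k l, classicalPartial l (fun y => matrixDefect (classicalJacobian φ y) k l) x
      = ∑ i, (classicalPartial l (fun y => signedCofactor (classicalJacobian φ y) l i) x
          * (classicalJacobian φ x)⁻¹ k i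
        + signedCofactor (classicalJacobian φ x) l i
          * classicalPartial l (fun y => (classicalJacobian φ y)⁻¹ k i) x) := by
    intro k l
    have hrw : (fun y => matrixDefect (classicalJacobian φ y) k l) = fun y =>
        (signedCofactor (classicalJacobian φ y) l 0 * (classicalJacobian φ y)⁻¹ k 0
          + signedCofactor (classicalJacobian φ y) l 1 * (classicalJacobian φ y)⁻¹ k 1)
          - (1 : Matrix (Fin 2) (Fin 2) ℝ) k l := by
      funext y
      simp only [matrixDefect, signedCofactor, Matrix.sub_apply, Matrix.smul_apply,
        Matrix.mul_apply, Fin.sum_univ_two, Matrix.transpose_apply, smul_eq_mul]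
      ring
    have hd := fun i => ((hdB l i).mul (hdg k i)).hasFDerivAt
    have hs := ((hd 0).add (hd 1)).sub_const ((1 : Matrix (Fin 2) (Fin 2) ℝ) k l)
    have hs' : fderiv ℝ (fun y =>
        (signedCofactor (classicalJacobian φ y) l 0 * (classicalJacobian φ y)⁻¹ k 0
          + signedCofactor (classicalJacobian φ y) l 1 * (classicalJacobian φ y)⁻¹ k 1)
          - (1 : Matrix (Fin 2) (Fin 2) ℝ) k l) x = _ := hs.fderiv
    rw [hrw, classicalPartial, hs', Fin.sum_univ_two, ← classicalPartial_mul (hdB l 0) (hdg k 0),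
      ← classicalPartial_mul (hdB l 1) (hdg k 1)]
    rfl
  -- expanding `∑ᵢ |det Dφ| (Dφ⁻ᵗ ∇ (Dφ⁻ᵗ ∇u)ᵢ)ᵢ`, the two sides differ by terms containing the
  -- divergences of the columns of `|det Dφ| Dφ⁻¹`
  rw [eq_div_iff hdet]
  have hP0 := hP 0
  have hP1 := hP 1
  simp only [Fin.sum_univ_two] at hP0 hP1
  simp only [transportedPartial] at he ⊢
  simp only [hM, he]
  simp only [weakLaplacian, Fin.sum_univ_two, matrixDefect, Matrix.sub_apply, Matrix.smul_apply,
    Matrix.mul_apply, Matrix.transpose_apply, smul_eq_mul, Matrix.one_apply]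
  simp only [signedCofactor, Matrix.smul_apply, smul_eq_mul] at hP0 hP1 ⊢
  simp only [Fin.isValue, if_true, if_false, zero_ne_one, one_ne_zero]
  set J := |(classicalJacobian φ x).det|
  linear_combination
    (-((classicalJacobian φ x)⁻¹ 0 0 * weakPartial Ω 0 u x
      + (classicalJacobian φ x)⁻¹ 1 0 * weakPartial Ω 1 u x)) * hP0
    - ((classicalJacobian φ x)⁻¹ 0 1 * weakPartial Ω 0 u x
      + (classicalJacobian φ x)⁻¹ 1 1 * weakPartial Ω 1 u x) * hP1

end IsBoundedDiffeo

end TransportedLaplacian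

/-! ### Boundedness of the inverse Laplacian -/

section InverseLaplacian

variable {Ω : TopologicalSpace.Opens Plane} {p : ℝ≥0∞} {f g : Plane → ℝ}

theorem sobolevNorm_congr {k : ℕ} (hf : MemSobolev k p Ω f) (e : f =ᵐ[vol Ω] g) :
    sobolevNorm k p Ω f = sobolevNorm k p Ω g := by
  induction k generalizing f g with
  | zero => exact eLpNorm_congr_ae e
  | succ k ih =>
    simp only [sobolevNorm]
    rw [eLpNorm_congr_ae e]
    congr 1
    refine Finset.sum_congr rfl fun i _ => ih (hf.weakPartial i) ?_
    exact ((hf.hasWeakPartial i).congr e (EventuallyEq.refl _ _)).ae_eq.symm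

theorem sobolevNorm_const_smul {k : ℕ} (hf : MemSobolev k p Ω f) (c : ℝ) :
    sobolevNorm k p Ω (c • f) = ‖c‖ₑ * sobolevNorm k p Ω f := by
  induction k generalizing f with
  | zero => exact eLpNorm_const_smul c f p _
  | succ k ih =>
    simp only [sobolevNorm]
    rw [eLpNorm_const_smul, mul_add, Finset.mul_sum]
    congr 1
    refine Finset.sum_congr rfl fun i _ => ?_
    rw [← ih (hf.weakPartial i)]
    exact (sobolevNorm_congr ((hf.weakPartial i).const_smul c)
      ((hf.hasWeakPartial i).const_smul c).ae_eq.symm).symm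

variable [Fact (1 ≤ p)]

theorem tendsto_setIntegral_mul_Lp {f : ℕ → LpOn p Ω} {g : LpOn p Ω}
    (h : Tendsto f atTop (𝓝 g)) {b : Plane → ℝ} (hb : Continuous b) (hc : HasCompactSupport b) :
    Tendsto (fun n => ∫ x in (Ω : Set Plane), f n x * b x) atTop
      (𝓝 (∫ x in (Ω : Set Plane), g x * b x)) := by
  have hq : Fact (1 ≤ ENNReal.conjExponent p) := ⟨by simp [ENNReal.conjExponent]⟩
  have hbm : MemLp b (ENNReal.conjExponent p) (vol Ω) :=
    (hb.memLp_of_hasCompactSupport hc).restrict _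
  set L := (ContinuousLinearMap.lsmul ℝ ℝ : ℝ →L[ℝ] ℝ →L[ℝ] ℝ).lpPairing (vol Ω) p
    (ENNReal.conjExponent p)
  have e : ∀ a : LpOn p Ω, L.flip (hbm.toLp b) a = ∫ x in (Ω : Set Plane), a x * b x := by
    intro a
    rw [ContinuousLinearMap.flip_apply, ContinuousLinearMap.lpPairing_eq_integral]
    refine integral_congr_ae ?_
    filter_upwards [hbm.coeFn_toLp] with x hx
    simp [hx]
  simp only [← e]
  exact ((L.flip (hbm.toLp b)).continuous.tendsto g).comp h

theorem locallyIntegrableOn_Lp (f : LpOn p Ω) :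
    LocallyIntegrableOn f (Ω : Set Plane) volume :=
  locallyIntegrableOn_of_locallyIntegrable_restrict ((Lp.memLp f).locallyIntegrable Fact.out)

/-- Weak derivatives are closed under `L^p` limits. -/
theorem hasWeakPartial_of_tendsto {f f' : ℕ → LpOn p Ω} {g g' : LpOn p Ω} {i : Fin 2}
    (hw : ∀ n, HasWeakPartial Ω i (f n) (f' n)) (h : Tendsto f atTop (𝓝 g))
    (h' : Tendsto f' atTop (𝓝 g')) : HasWeakPartial Ω i g g' := by
  refine ⟨locallyIntegrableOn_Lp g, locallyIntegrableOn_Lp g', fun ψ hψ => ?_⟩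
  have t1 := tendsto_setIntegral_mul_Lp h (hψ.continuous_partial i) (hψ.classicalPartial i).compact
  have t2 := tendsto_setIntegral_mul_Lp h' hψ.smooth.continuous hψ.compact
  refine tendsto_nhds_unique t1 ?_
  simp only [fun n => (hw n).integral_eq ψ hψ]
  exact t2.neg

theorem inverseLaplacian_mem (h : LaplacianInvertible p Ω) (f : LpOn p Ω) :
    inverseLaplacian h f ∈ sobolevX p Ω :=
  Subtype.coe_prop _

theorem memSobolev_inverseLaplacian (h : LaplacianInvertible p Ω) (f : LpOn p Ω) :
    MemSobolev 2 p Ω (inverseLaplacian h f) :=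
  (inverseLaplacian_mem h f).1

theorem weakLaplacian_inverseLaplacian (h : LaplacianInvertible p Ω) (f : LpOn p Ω) :
    weakLaplacian Ω (inverseLaplacian h f) =ᵐ[vol Ω] f := by
  have e : dirichletLaplacian p Ω ⟨inverseLaplacian h f, inverseLaplacian_mem h f⟩ = f :=
    (LinearEquiv.ofBijective (dirichletLaplacian p Ω) h).apply_symm_apply f
  have e2 := (memLp_weakLaplacian (memSobolev_inverseLaplacian h f)).coeFn_toLp
  refine e2.symm.trans ?_
  have e3 : (memLp_weakLaplacian (memSobolev_inverseLaplacian h f)).toLp _ = f := e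
  rw [e3]

theorem eq_inverseLaplacian (h : LaplacianInvertible p Ω) {w f : LpOn p Ω}
    (hw : w ∈ sobolevX p Ω) (e : weakLaplacian Ω w =ᵐ[vol Ω] f) : w = inverseLaplacian h f := by
  have e1 : dirichletLaplacian p Ω ⟨w, hw⟩ = f :=
    Lp.ext ((memLp_weakLaplacian hw.1).coeFn_toLp.trans e)
  have e2 : (LinearEquiv.ofBijective (dirichletLaplacian p Ω) h).symm f = ⟨w, hw⟩ := by
    rw [LinearEquiv.symm_apply_eq]
    exact e1.symm
  exact (congrArg Subtype.val e2).symm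

/-- The product of seven copies of `L^p(Ω)`, holding a function, its first order derivatives `∂ᵢ`
and its second order derivatives `∂ⱼ∂ᵢ` (at the index `i j`). -/
abbrev JetSpace (p : ℝ≥0∞) (Ω : TopologicalSpace.Opens Plane) : Type :=
  LpOn p Ω × (Fin 2 → LpOn p Ω) × (Fin 2 → Fin 2 → LpOn p Ω)

/-- The function together with its weak derivatives up to the second order, an embedding of
`X_p(Ω)` into a Banach space which induces a norm equivalent to that of `W^{2,p}(Ω)`. -/
noncomputable def sobolevJet (p : ℝ≥0∞) [Fact (1 ≤ p)] (Ω : TopologicalSpace.Opens Plane) :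
    sobolevX p Ω →ₗ[ℝ] JetSpace p Ω where
  toFun u := (u, fun i => (u.2.1.weakPartial i).memLp.toLp _,
    fun i j => ((u.2.1.weakPartial i).weakPartial j).memLp.toLp _)
  map_add' u v := by
    have e : ((u + v : sobolevX p Ω) : LpOn p Ω) =ᵐ[vol Ω] (u : LpOn p Ω) + (v : LpOn p Ω) :=
      Lp.coeFn_add (u : LpOn p Ω) v
    have e1 : ∀ i, weakPartial Ω i ((u + v : sobolevX p Ω) : LpOn p Ω) =ᵐ[vol Ω]
        weakPartial Ω i (u : LpOn p Ω) + weakPartial Ω i (v : LpOn p Ω) := fun i =>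
      (((u.2.1.hasWeakPartial i).add (v.2.1.hasWeakPartial i)).congr e.symm
        (EventuallyEq.refl _ _)).ae_eq
    refine Prod.ext rfl (Prod.ext (funext fun i => ?_) (funext fun i => funext fun j => ?_))
    · change ((u + v).2.1.weakPartial i).memLp.toLp _ = (u.2.1.weakPartial i).memLp.toLp _
        + (v.2.1.weakPartial i).memLp.toLp _
      rw [← MemLp.toLp_add, MemLp.toLp_eq_toLp_iff]
      exact e1 i
    · change ((u + v).2.1.weakPartial i |>.weakPartial j).memLp.toLp _
        = ((u.2.1.weakPartial i).weakPartial j).memLp.toLp _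
          + ((v.2.1.weakPartial i).weakPartial j).memLp.toLp _
      rw [← MemLp.toLp_add, MemLp.toLp_eq_toLp_iff]
      exact ((((u.2.1.weakPartial i).hasWeakPartial j).add
        ((v.2.1.weakPartial i).hasWeakPartial j)).congr (e1 i).symm (EventuallyEq.refl _ _)).ae_eq
  map_smul' c u := by
    have e : ((c • u : sobolevX p Ω) : LpOn p Ω) =ᵐ[vol Ω] c • ((u : LpOn p Ω) : Plane → ℝ) :=
      Lp.coeFn_smul c (u : LpOn p Ω)
    have e1 : ∀ i, weakPartial Ω i ((c • u : sobolevX p Ω) : LpOn p Ω) =ᵐ[vol Ω]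
        c • weakPartial Ω i (u : LpOn p Ω) := fun i =>
      (((u.2.1.hasWeakPartial i).const_smul c).congr e.symm (EventuallyEq.refl _ _)).ae_eq
    refine Prod.ext rfl (Prod.ext (funext fun i => ?_) (funext fun i => funext fun j => ?_))
    · change ((c • u).2.1.weakPartial i).memLp.toLp _ = c • (u.2.1.weakPartial i).memLp.toLp _
      rw [← MemLp.toLp_const_smul, MemLp.toLp_eq_toLp_iff]
      exact e1 i
    · change ((c • u).2.1.weakPartial i |>.weakPartial j).memLp.toLp _
        = c • ((u.2.1.weakPartial i).weakPartial j).memLp.toLp _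
      rw [← MemLp.toLp_const_smul, MemLp.toLp_eq_toLp_iff]
      exact ((((u.2.1.weakPartial i).hasWeakPartial j).const_smul c).congr (e1 i).symm
        (EventuallyEq.refl _ _)).ae_eq

/-- The solution of the Dirichlet problem together with its derivatives up to the second order. -/
noncomputable def inverseLaplacianJet (h : LaplacianInvertible p Ω) :
    LpOn p Ω →ₗ[ℝ] JetSpace p Ω :=
  sobolevJet p Ω ∘ₗ (LinearEquiv.ofBijective (dirichletLaplacian p Ω) h).symm.toLinearMap

theorem inverseLaplacianJet_fst (h : LaplacianInvertible p Ω) (f : LpOn p Ω) :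
    (inverseLaplacianJet h f).1 = inverseLaplacian h f := rfl

theorem coeFn_inverseLaplacianJet_first (h : LaplacianInvertible p Ω) (f : LpOn p Ω) (i : Fin 2) :
    (inverseLaplacianJet h f).2.1 i =ᵐ[vol Ω] weakPartial Ω i (inverseLaplacian h f) :=
  ((memSobolev_inverseLaplacian h f).weakPartial i).memLp.coeFn_toLp

theorem coeFn_inverseLaplacianJet_second (h : LaplacianInvertible p Ω) (f : LpOn p Ω)
    (i j : Fin 2) : (inverseLaplacianJet h f).2.2 i j =ᵐ[vol Ω]
      weakPartial Ω j (weakPartial Ω i (inverseLaplacian h f)) :=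
  (((memSobolev_inverseLaplacian h f).weakPartial i).weakPartial j).memLp.coeFn_toLp

/-- The closed graph theorem applies: along a convergent sequence of jets, weak derivatives and
membership in `W_0^{1,p}(Ω)` pass to the limit, so that the limit jet is that of a solution. -/
theorem continuous_inverseLaplacianJet (h : LaplacianInvertible p Ω) :
    Continuous (inverseLaplacianJet h) := by
  refine LinearMap.continuous_of_seq_closed_graph _ fun f g v hf hv => ?_
  obtain ⟨u, u₁, u₂⟩ := v
  have hu : Tendsto (fun n => inverseLaplacian h (f n)) atTop (𝓝 u) :=
    (continuous_fst.tendsto _).comp hv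
  have hu₁ : ∀ i, Tendsto (fun n => (inverseLaplacianJet h (f n)).2.1 i) atTop (𝓝 (u₁ i)) :=
    fun i => ((continuous_apply i).tendsto _).comp
      ((continuous_fst.tendsto _).comp ((continuous_snd.tendsto _).comp hv))
  have hu₂ : ∀ i j, Tendsto (fun n => (inverseLaplacianJet h (f n)).2.2 i j) atTop
      (𝓝 (u₂ i j)) := fun i j => ((continuous_apply j).tendsto _).comp
      (((continuous_apply i).tendsto _).comp
        ((continuous_snd.tendsto _).comp ((continuous_snd.tendsto _).comp hv)))
  have hm := fun n => memSobolev_inverseLaplacian h (f n)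
  have hw : ∀ n i, HasWeakPartial Ω i (inverseLaplacian h (f n))
      ((inverseLaplacianJet h (f n)).2.1 i) := fun n i =>
    ((hm n).hasWeakPartial i).congr (EventuallyEq.refl _ _)
      (coeFn_inverseLaplacianJet_first h (f n) i).symm
  have hw₁ : ∀ i, HasWeakPartial Ω i u (u₁ i) := fun i =>
    hasWeakPartial_of_tendsto (fun n => hw n i) hu (hu₁ i)
  have hw₂ : ∀ i j, HasWeakPartial Ω j (u₁ i) (u₂ i j) := fun i j =>
    hasWeakPartial_of_tendsto (fun n => (((hm n).weakPartial i).hasWeakPartial j).congr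
      (coeFn_inverseLaplacianJet_first h (f n) i).symm
      (coeFn_inverseLaplacianJet_second h (f n) i j).symm) (hu₁ i) (hu₂ i j)
  have hm1 : MemSobolev 1 p Ω u := ⟨Lp.memLp u, fun i => ⟨_, hw₁ i, Lp.memLp (u₁ i)⟩⟩
  have hm2 : MemSobolev 2 p Ω u := ⟨Lp.memLp u, fun i => ⟨_, hw₁ i, Lp.memLp (u₁ i),
    fun j => ⟨_, hw₂ i j, Lp.memLp (u₂ i j)⟩⟩⟩
  have hz : MemSobolevZero p Ω u := by
    refine memSobolevZero_of_forall_approx Fact.out hm1 fun ε hε => ?_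
    have e : ∀ n, sobolevNorm 1 p Ω (u - inverseLaplacian h (f n))
        = edist u (inverseLaplacian h (f n))
          + ∑ i, edist (u₁ i) ((inverseLaplacianJet h (f n)).2.1 i) := fun n => by
      rw [sobolevNorm_one_eq fun i => (hw₁ i).sub (hw n i), Lp.edist_def]
      simp only [Lp.edist_def]
    have t : Tendsto (fun n => sobolevNorm 1 p Ω (u - inverseLaplacian h (f n))) atTop (𝓝 0) := by
      simp only [e]
      have h1 := (tendsto_const_nhds (x := u)).edist hu
      have h2 := fun i => (tendsto_const_nhds (x := u₁ i)).edist (hu₁ i)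
      have := h1.add (tendsto_finsetSum Finset.univ fun i _ => h2 i)
      simpa using this
    obtain ⟨n, hn⟩ := ((tendsto_order.1 t).2 ε hε).exists
    exact ⟨_, (inverseLaplacian_mem h (f n)).2, hn⟩
  have hΔ : ∀ n, f n = ∑ i, (inverseLaplacianJet h (f n)).2.2 i i := fun n => by
    refine Lp.ext ?_
    have e0 := weakLaplacian_inverseLaplacian h (f n)
    filter_upwards [e0, coeFn_inverseLaplacianJet_second h (f n) 0 0,
      coeFn_inverseLaplacianJet_second h (f n) 1 1,
      Lp.coeFn_add ((inverseLaplacianJet h (f n)).2.2 0 0) ((inverseLaplacianJet h (f n)).2.2 1 1)]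
      with x h1 h2 h3 h4
    rw [Fin.sum_univ_two, h4, Pi.add_apply, h2, h3, ← h1, weakLaplacian, Fin.sum_univ_two]
  have hg : g = ∑ i, u₂ i i := by
    refine tendsto_nhds_unique hf ?_
    have t := tendsto_finsetSum Finset.univ fun i _ => hu₂ i i
    exact t.congr fun n => (hΔ n).symm
  have hE : ∀ i j, weakPartial Ω j (weakPartial Ω i u) =ᵐ[vol Ω] u₂ i j := fun i j =>
    ((hw₂ i j).congr (hw₁ i).ae_eq.symm (EventuallyEq.refl _ _)).ae_eq
  have hLap : weakLaplacian Ω u =ᵐ[vol Ω] g := by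
    rw [hg, Fin.sum_univ_two]
    filter_upwards [hE 0 0, hE 1 1, Lp.coeFn_add (u₂ 0 0) (u₂ 1 1)] with x h1 h2 h3
    rw [h3, Pi.add_apply, weakLaplacian, Fin.sum_univ_two, h1, h2]
  have hu' : u = inverseLaplacian h g := eq_inverseLaplacian h ⟨hm2, hz⟩ hLap
  have hu1' : ∀ i, weakPartial Ω i (inverseLaplacian h g) =ᵐ[vol Ω] u₁ i := fun i =>
    hu' ▸ (hw₁ i).ae_eq
  refine Prod.ext hu' (Prod.ext (funext fun i => Lp.ext ?_)
    (funext fun i => funext fun j => Lp.ext ?_))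
  · exact (hu1' i).symm.trans (coeFn_inverseLaplacianJet_first h g i).symm
  · refine EventuallyEq.trans ?_ (coeFn_inverseLaplacianJet_second h g i j).symm
    rw [← hu']
    exact (hE i j).symm

/-- The inverse Laplacian as a bounded operator. -/
theorem exists_inverseLaplacian_clm (h : LaplacianInvertible p Ω) :
    ∃ T : LpOn p Ω →L[ℝ] LpOn p Ω, ∀ u, T u = inverseLaplacian h u :=
  ⟨⟨inverseLaplacian h, continuous_fst.comp (continuous_inverseLaplacianJet h)⟩, fun _ => rfl⟩

theorem sobolevNorm_zero_inverseLaplacian (h : LaplacianInvertible p Ω) (f : LpOn p Ω) :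
    sobolevNorm 0 p Ω (inverseLaplacian h f) = ‖(inverseLaplacianJet h f).1‖ₑ := by
  rw [inverseLaplacianJet_fst, Lp.enorm_def]
  rfl

theorem sobolevNorm_two_inverseLaplacian (h : LaplacianInvertible p Ω) (f : LpOn p Ω) :
    sobolevNorm 2 p Ω (inverseLaplacian h f) = ‖(inverseLaplacianJet h f).1‖ₑ
      + ∑ i, (‖(inverseLaplacianJet h f).2.1 i‖ₑ + ∑ j, ‖(inverseLaplacianJet h f).2.2 i j‖ₑ) := by
  simp only [sobolevNorm, Lp.enorm_def, inverseLaplacianJet_fst,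
    eLpNorm_congr_ae (coeFn_inverseLaplacianJet_first h f _),
    eLpNorm_congr_ae (coeFn_inverseLaplacianJet_second h f _ _)]

theorem exists_enorm_inverseLaplacianJet_le (h : LaplacianInvertible p Ω) : ∃ D : ℝ≥0∞, D ≠ ∞ ∧
    ∀ f : LpOn p Ω, ‖f‖ ≤ 1 → ‖inverseLaplacianJet h f‖ₑ ≤ D := by
  set S : LpOn p Ω →L[ℝ] JetSpace p Ω :=
    ⟨inverseLaplacianJet h, continuous_inverseLaplacianJet h⟩ with hS
  refine ⟨ENNReal.ofReal ‖S‖, ENNReal.ofReal_ne_top, fun f hf => ?_⟩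
  rw [← ofReal_norm]
  refine ENNReal.ofReal_le_ofReal ((S.le_opNorm f).trans ?_)
  exact mul_le_of_le_one_right (norm_nonneg _) hf

theorem inverseLaplacianNorm_zero_ne_top (h : LaplacianInvertible p Ω) :
    inverseLaplacianNorm h 0 ≠ ∞ := by
  obtain ⟨D, hD, hle⟩ := exists_enorm_inverseLaplacianJet_le h
  refine ne_top_of_le_ne_top hD (iSup₂_le fun f hf => ?_)
  rw [sobolevNorm_zero_inverseLaplacian]
  exact (enorm_le_iff_norm_le.2 (norm_fst_le _)).trans (hle f hf)

theorem inverseLaplacianNorm_two_ne_top (h : LaplacianInvertible p Ω) :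
    inverseLaplacianNorm h 2 ≠ ∞ := by
  obtain ⟨D, hD, hle⟩ := exists_enorm_inverseLaplacianJet_le h
  refine ne_top_of_le_ne_top (b := D + ∑ _i : Fin 2, (D + ∑ _j : Fin 2, D))
    (by simp [hD, ENNReal.mul_eq_top])
    (iSup₂_le fun f hf => ?_)
  rw [sobolevNorm_two_inverseLaplacian]
  have h0 := hle f hf
  have h2 : ‖(inverseLaplacianJet h f).2‖ₑ ≤ D :=
    (enorm_le_iff_norm_le.2 (norm_snd_le _)).trans h0
  gcongr with i _ j
  · exact (enorm_le_iff_norm_le.2 (norm_fst_le _)).trans h0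
  · exact (enorm_le_iff_norm_le.2 ((norm_le_pi_norm _ i).trans (norm_fst_le _))).trans h2
  · exact (enorm_le_iff_norm_le.2 (((norm_le_pi_norm _ j).trans (norm_le_pi_norm _ i)).trans
      (norm_snd_le _))).trans h2

theorem sobolevNorm_inverseLaplacian_le (h : LaplacianInvertible p Ω) {k : ℕ} (hk : k ≤ 2)
    (f : LpOn p Ω) :
    sobolevNorm k p Ω (inverseLaplacian h f) ≤ inverseLaplacianNorm h k * ‖f‖ₑ := by
  have hm : ∀ g : LpOn p Ω, MemSobolev k p Ω (inverseLaplacian h g) := fun g => by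
    have h2 := memSobolev_inverseLaplacian h g
    interval_cases k
    · exact h2.memLp
    · exact ⟨h2.memLp, fun i => ⟨_, h2.hasWeakPartial i, (h2.weakPartial i).memLp⟩⟩
    · exact h2
  -- the norm is a supremum over the unit ball; `g = 0` when `f = 0`
  set g : LpOn p Ω := ‖f‖⁻¹ • f with hg
  have hg1 : ‖g‖ ≤ 1 := by
    rw [hg, norm_smul, norm_inv, norm_norm]
    exact inv_mul_le_one
  have hfg : f = ‖f‖ • g := by
    by_cases h0 : f = 0
    · simp [h0]
    · rw [hg, smul_inv_smul₀ (norm_ne_zero_iff.2 h0)]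
  have e : (‖f‖ • (inverseLaplacian h g : Plane → ℝ)) =ᵐ[vol Ω] inverseLaplacian h f := by
    have h1 : inverseLaplacian h f = ‖f‖ • inverseLaplacian h g := by
      rw [← map_smul, ← hfg]
    rw [h1]
    exact (Lp.coeFn_smul _ _).symm
  rw [← sobolevNorm_congr ((hm g).const_smul _) e, sobolevNorm_const_smul (hm g), mul_comm,
    enorm_norm]
  gcongr
  exact le_iSup₂ (f := fun (f : LpOn p Ω) (_ : ‖f‖ ≤ 1) => sobolevNorm k p Ω
    (inverseLaplacian h f)) g hg1

end InverseLaplacian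

/-! ### Composition operators -/

section CompositionOperator

variable {Ω Ω' : TopologicalSpace.Opens Plane} {p : ℝ≥0∞}

theorem coeFn_compLp {φ : Plane → Plane} (h : CompWellDefined p Ω Ω' φ) (v : LpOn p Ω') :
    compLp (Ω := Ω) φ v =ᵐ[vol Ω] v ∘ φ := by
  rw [compLp, dif_pos (h.1 v (Lp.memLp v))]
  exact MemLp.coeFn_toLp _

theorem exists_compLp_clm [Fact (1 ≤ p)] {φ : Plane → Plane} (h : CompWellDefined p Ω Ω' φ)
    {D : ℝ≥0∞} (hD : D ≠ ∞)
    (hle : ∀ v : Plane → ℝ, eLpNorm (v ∘ φ) p (vol Ω) ≤ D * eLpNorm v p (vol Ω')) :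
    ∃ L : LpOn p Ω' →L[ℝ] LpOn p Ω, ∀ v, L v = compLp φ v := by
  let L : LpOn p Ω' →ₗ[ℝ] LpOn p Ω :=
    { toFun := fun v => compLp φ v
      map_add' := fun v w => Lp.ext <| by
        have h1 := h.2 _ _ (Lp.coeFn_add v w)
        filter_upwards [coeFn_compLp h (v + w), coeFn_compLp h v, coeFn_compLp h w, h1,
          Lp.coeFn_add (compLp (Ω := Ω) φ v) (compLp (Ω := Ω) φ w)] with x e1 e2 e3 e4 e5
        rw [e1, e4, e5, Pi.add_apply, e2, e3]
        rfl
      map_smul' := fun c v => Lp.ext <| by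
        have h1 := h.2 _ _ (Lp.coeFn_smul c v)
        filter_upwards [coeFn_compLp h (c • v), coeFn_compLp h v, h1,
          Lp.coeFn_smul c (compLp (Ω := Ω) φ v)] with x e1 e2 e3 e4
        rw [e1, e3, RingHom.id_apply, e4, Pi.smul_apply, e2]
        rfl }
  refine ⟨L.mkContinuous D.toReal fun v => ?_, fun v => rfl⟩
  change ‖compLp (Ω := Ω) φ v‖ ≤ _
  rw [Lp.norm_def, Lp.norm_def, ← ENNReal.toReal_mul, eLpNorm_congr_ae (coeFn_compLp h v)]
  exact ENNReal.toReal_mono (ENNReal.mul_ne_top hD (Lp.memLp v).2.ne) (hle v)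

end CompositionOperator

/-! ### The defect matrix -/

section Defect

variable {Ω Ω' : TopologicalSpace.Opens Plane} {φ : OpenPartialHomeomorph Plane Plane} {c C : ℝ}
  {p : ℝ≥0∞}

theorem defectMatrix_ae_eq (hJ : jacobian Ω φ =ᵐ[vol Ω] classicalJacobian φ) (i j : Fin 2) :
    (fun x => defectMatrix Ω φ x i j) =ᵐ[vol Ω]
      fun x => matrixDefect (classicalJacobian φ x) i j := by
  filter_upwards [hJ] with x hx
  rw [defectMatrix, hx, matrixDefect]

namespace IsBoundedDiffeo

theorem matrixDefect_lipschitz (h : IsBoundedDiffeo Ω Ω' φ c C) (i j : Fin 2) :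
    LocallyLipschitzOn (Ω : Set Plane) fun x => matrixDefect (classicalJacobian φ x) i j :=
  h.locallyLipschitzOn_comp (contDiffOn_matrixDefect i j)

theorem memSobolev_defectMatrix (h : IsBoundedDiffeo Ω Ω' φ c C)
    (hJ : jacobian Ω φ =ᵐ[vol Ω] classicalJacobian φ) (i j : Fin 2) :
    MemSobolev 1 ∞ Ω fun x => defectMatrix Ω φ x i j :=
  (h.memSobolev_comp (contDiffOn_matrixDefect i j)).congr (defectMatrix_ae_eq hJ i j).symm

theorem weakPartial_defectMatrix (h : IsBoundedDiffeo Ω Ω' φ c C)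
    (hJ : jacobian Ω φ =ᵐ[vol Ω] classicalJacobian φ) (i j k : Fin 2) :
    weakPartial Ω k (fun x => defectMatrix Ω φ x i j) =ᵐ[vol Ω]
      classicalPartial k fun x => matrixDefect (classicalJacobian φ x) i j :=
  ((hasWeakPartial_of_locallyLipschitzOn (h.matrixDefect_lipschitz i j) k).congr
    (defectMatrix_ae_eq hJ i j).symm (EventuallyEq.refl _ _)).ae_eq

theorem constK_eq (h : IsBoundedDiffeo Ω Ω' φ c C)
    (hJ : jacobian Ω φ =ᵐ[vol Ω] classicalJacobian φ) : constK Ω φ =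
      (∑ i, ∑ j, eLpNorm (fun x => matrixDefect (classicalJacobian φ x) i j) ∞ (vol Ω)) +
      ∑ i, eLpNorm (fun x => ∑ j, classicalPartial j
        (fun y => matrixDefect (classicalJacobian φ y) i j) x) ∞ (vol Ω) := by
  rw [constK]
  congr 1
  · exact Finset.sum_congr rfl fun i _ => Finset.sum_congr rfl fun j _ =>
      eLpNorm_congr_ae (defectMatrix_ae_eq hJ i j)
  · refine Finset.sum_congr rfl fun i _ => eLpNorm_congr_ae ?_
    filter_upwards [ae_all_iff.2 fun j => h.weakPartial_defectMatrix hJ i j j] with x hx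
    exact Finset.sum_congr rfl fun j _ => hx j

theorem constK_ne_top (h : IsBoundedDiffeo Ω Ω' φ c C)
    (hJ : jacobian Ω φ =ᵐ[vol Ω] classicalJacobian φ) : constK Ω φ ≠ ∞ := by
  have h1 : ∀ i j, eLpNorm (fun x => defectMatrix Ω φ x i j) ∞ (vol Ω) ≠ ∞ := fun i j =>
    (h.memSobolev_defectMatrix hJ i j).memLp.2.ne
  have h2 : ∀ i, eLpNorm (fun x => ∑ j, weakPartial Ω j (fun y => defectMatrix Ω φ y i j) x) ∞
      (vol Ω) ≠ ∞ := fun i =>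
    (memLp_finsetSum Finset.univ fun j _ =>
      ((h.memSobolev_defectMatrix hJ i j).weakPartial j).memLp).2.ne
  rw [constK]
  refine ENNReal.add_ne_top.2 ⟨?_, ?_⟩
  · exact ENNReal.sum_ne_top.2 fun i _ => ENNReal.sum_ne_top.2 fun j _ => h1 i j
  · exact ENNReal.sum_ne_top.2 fun i _ => h2 i

end IsBoundedDiffeo

theorem matrixDefect_one (i j : Fin 2) : matrixDefect 1 i j = 0 := by
  simp [matrixDefect]

/-- The defect vanishes at the identity matrix and its derivative is bounded near it, uniformly
with respect to the domain. -/
theorem exists_matrixDefect_bound {ε : ℝ} (hε : 0 < ε) : ∃ (r M : ℝ), 0 < r ∧ 0 < M ∧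
    ∀ A : Fin 2 → Fin 2 → ℝ, (∀ i j, |A i j - (1 : Matrix (Fin 2) (Fin 2) ℝ) i j| ≤ r) →
      ∀ i j, |matrixDefect (Matrix.of A) i j| ≤ ε ∧
        ‖fderiv ℝ (fun A : Fin 2 → Fin 2 → ℝ => matrixDefect (Matrix.of A) i j) A‖ ≤ M := by
  set I : Fin 2 → Fin 2 → ℝ := fun i j => (1 : Matrix (Fin 2) (Fin 2) ℝ) i j with hI
  have hIU : I ∈ invertibleMatrices := by
    change (1 : Matrix (Fin 2) (Fin 2) ℝ).det ≠ 0
    simp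
  have hnhds := isOpen_invertibleMatrices.mem_nhds hIU
  have h1 : ∀ i j, ∀ᶠ A in 𝓝 I, |matrixDefect (Matrix.of A) i j| < ε := fun i j => by
    have hc := ((contDiffOn_matrixDefect i j).continuousOn.continuousAt hnhds).abs.tendsto
    have h0 : |matrixDefect (Matrix.of I) i j| = 0 := by
      rw [abs_eq_zero]
      exact matrixDefect_one i j
    rw [h0] at hc
    exact (tendsto_order.1 hc).2 ε hε
  have h2 : ∀ i j, ∃ M : ℝ, ∀ᶠ A in 𝓝 I,
      ‖fderiv ℝ (fun A : Fin 2 → Fin 2 → ℝ => matrixDefect (Matrix.of A) i j) A‖ < M := by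
    intro i j
    have hc := (((contDiffOn_matrixDefect i j).continuousOn_fderiv_of_isOpen
      isOpen_invertibleMatrices le_rfl).continuousAt hnhds).norm.tendsto
    exact ⟨_, (tendsto_order.1 hc).2 _ (lt_add_one _)⟩
  choose M hM using h2
  obtain ⟨r, hr, hball⟩ := Metric.nhds_basis_closedBall.mem_iff.1
    ((eventually_all.2 fun i => eventually_all.2 fun j => h1 i j).and
      (eventually_all.2 fun i => eventually_all.2 fun j => hM i j))
  refine ⟨r, 1 + ∑ i, ∑ j, |M i j|, hr, by positivity, fun A hA i j => ?_⟩
  have hAb : A ∈ Metric.closedBall I r := by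
    rw [Metric.mem_closedBall, dist_pi_le_iff hr.le]
    intro i
    rw [dist_pi_le_iff hr.le]
    intro j
    rw [Real.dist_eq]
    exact hA i j
  obtain ⟨k1, k2⟩ := hball hAb
  refine ⟨(k1 i j).le, (k2 i j).le.trans ?_⟩
  have e1 : |M i j| ≤ ∑ j, |M i j| := Finset.single_le_sum (f := fun j => |M i j|)
    (fun _ _ => abs_nonneg _) (Finset.mem_univ j)
  have e2 : ∑ j, |M i j| ≤ ∑ i, ∑ j, |M i j| := Finset.single_le_sum
    (f := fun i => ∑ j, |M i j|) (fun _ _ => by positivity) (Finset.mem_univ i)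
  linarith [le_abs_self (M i j)]

theorem ae_abs_le_of_eLpNorm_top_le {g : Plane → ℝ} {μ : Measure Plane} {δ : ℝ} (hδ : 0 ≤ δ)
    (h : eLpNorm g ∞ μ ≤ ENNReal.ofReal δ) : ∀ᵐ x ∂μ, |g x| ≤ δ := by
  rw [eLpNorm_exponent_top] at h
  filter_upwards [ae_le_eLpNormEssSup (f := g) (μ := μ)] with x hx
  have h1 := hx.trans h
  rw [← ofReal_norm] at h1
  exact (ENNReal.ofReal_le_ofReal_iff hδ).1 h1

/-- The distance of `φ` to the identity in `W^{2,∞}` controls the Jacobian matrix and its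
derivatives. -/
theorem IsBoundedDiffeo.ae_bound_of_distToId (h : IsBoundedDiffeo Ω Ω' φ c C) {δ : ℝ} (hδ : 0 ≤ δ)
    (hd : distToId Ω φ ≤ ENNReal.ofReal δ) : ∀ᵐ x ∂(vol Ω), ∀ i j,
      |classicalJacobian φ x i j - (1 : Matrix (Fin 2) (Fin 2) ℝ) i j| ≤ δ ∧
      ∀ k, |classicalPartial k (fun y => classicalJacobian φ y i j) x| ≤ δ := by
  have hw : ∀ i j, HasWeakPartial Ω j (fun x => x i - φ x i)
      (fun x => (1 : Matrix (Fin 2) (Fin 2) ℝ) i j - classicalJacobian φ x i j) := by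
    intro i j
    have h1 := hasWeakPartial_clm (Ω := Ω) (EuclideanSpace.proj i : Plane →L[ℝ] ℝ) j
    have h2 := h1.sub (h.hasWeakPartial i j)
    refine h2.congr (EventuallyEq.refl _ _) (Eventually.of_forall fun x => ?_)
    simp [Matrix.one_apply]
  have hw2 : ∀ i j k, HasWeakPartial Ω k
      (fun x => (1 : Matrix (Fin 2) (Fin 2) ℝ) i j - classicalJacobian φ x i j)
      (fun x => -classicalPartial k (fun y => classicalJacobian φ y i j) x) := by
    intro i j k
    have h1 := hasWeakPartial_of_locallyLipschitzOn (Ω := Ω)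
      (f := fun _ => (1 : Matrix (Fin 2) (Fin 2) ℝ) i j)
      (locallyLipschitzOn_of_contDiffAt fun x _ => contDiffAt_const) k
    have h2 := h1.sub (hasWeakPartial_of_locallyLipschitzOn (h.lipschitz i j) k)
    refine h2.congr (EventuallyEq.refl _ _) (Eventually.of_forall fun x => ?_)
    simp [classicalPartial]
  have hle : ∀ i, sobolevNorm 2 ∞ Ω (fun x => x i - φ x i) ≤ ENNReal.ofReal δ := fun i =>
    (Finset.single_le_sum (f := fun i => sobolevNorm 2 ∞ Ω fun x => x i - φ x i)
      (fun _ _ => zero_le) (Finset.mem_univ i)).trans hd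
  have hle1 : ∀ i j, sobolevNorm 1 ∞ Ω (weakPartial Ω j fun x => x i - φ x i)
      ≤ ENNReal.ofReal δ := fun i j =>
    ((Finset.single_le_sum (f := fun j => sobolevNorm 1 ∞ Ω (weakPartial Ω j fun x => x i - φ x i))
      (fun _ _ => zero_le) (Finset.mem_univ j)).trans le_add_self).trans (hle i)
  have hb1 : ∀ i j, ∀ᵐ x ∂(vol Ω),
      |classicalJacobian φ x i j - (1 : Matrix (Fin 2) (Fin 2) ℝ) i j| ≤ δ := fun i j => by
    have h1 : eLpNorm (weakPartial Ω j fun x => x i - φ x i) ∞ (vol Ω) ≤ ENNReal.ofReal δ :=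
      le_self_add.trans (hle1 i j)
    rw [eLpNorm_congr_ae (hw i j).ae_eq] at h1
    filter_upwards [ae_abs_le_of_eLpNorm_top_le hδ h1] with x hx
    rwa [abs_sub_comm]
  have hb2 : ∀ i j k, ∀ᵐ x ∂(vol Ω),
      |classicalPartial k (fun y => classicalJacobian φ y i j) x| ≤ δ := fun i j k => by
    have h1 : eLpNorm (weakPartial Ω k (weakPartial Ω j fun x => x i - φ x i)) ∞ (vol Ω)
        ≤ ENNReal.ofReal δ :=
      ((Finset.single_le_sum (f := fun k => sobolevNorm 0 ∞ Ω
        (weakPartial Ω k (weakPartial Ω j fun x => x i - φ x i)))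
        (fun _ _ => zero_le) (Finset.mem_univ k)).trans le_add_self).trans (hle1 i j)
    rw [eLpNorm_congr_ae ((hw2 i j k).congr (hw i j).ae_eq.symm (EventuallyEq.refl _ _)).ae_eq]
      at h1
    filter_upwards [ae_abs_le_of_eLpNorm_top_le hδ h1] with x hx
    rwa [abs_neg] at hx
  filter_upwards [ae_all_iff.2 fun i => ae_all_iff.2 (hb1 i),
    ae_all_iff.2 fun i => ae_all_iff.2 fun j => ae_all_iff.2 (hb2 i j)] with x h1 h2 i j
  exact ⟨h1 i j, h2 i j⟩

/-- `K_φ → 0` as `φ → id` in `W^{2,∞}`. -/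
theorem exists_constK_lt {ε : ℝ} (hε : 0 < ε) : ∃ δ : ℝ, 0 < δ ∧
    ∀ (Ω Ω' : TopologicalSpace.Opens Plane) (φ : OpenPartialHomeomorph Plane Plane) (c C : ℝ),
      IsBoundedDiffeo Ω Ω' φ c C → jacobian Ω φ =ᵐ[vol Ω] classicalJacobian φ →
      distToId Ω φ < ENNReal.ofReal δ → constK Ω φ < ENNReal.ofReal ε := by
  -- four entries bounded by `ε / 16` and two divergences bounded by `ε / 8` add up to `ε / 2`
  obtain ⟨r, M, hr, hM, hbd⟩ := exists_matrixDefect_bound (ε := ε / 16) (by positivity)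
  refine ⟨min r (ε / (16 * M)), by positivity, fun Ω Ω' φ c C h hJ hd => ?_⟩
  set δ := min r (ε / (16 * M)) with hδ
  have hδ0 : 0 ≤ δ := by positivity
  have hae := h.ae_bound_of_distToId hδ0 hd.le
  have hMδ : M * δ ≤ ε / 16 := by
    calc M * δ ≤ M * (ε / (16 * M)) := mul_le_mul_of_nonneg_left (min_le_right _ _) hM.le
      _ = ε / 16 := by field_simp
  have hb : ∀ᵐ x ∂(vol Ω), ∀ i j, |matrixDefect (classicalJacobian φ x) i j| ≤ ε / 16 ∧
      ∀ k, |classicalPartial k (fun y => matrixDefect (classicalJacobian φ y) i j) x|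
        ≤ ε / 16 := by
    have hcomp := fun i j => ae_classicalPartial_comp isOpen_invertibleMatrices
      (contDiffOn_matrixDefect i j) h.lipschitz h.mapsTo_invertibleMatrices
    filter_upwards [hae, ae_all_iff.2 fun i => ae_all_iff.2 (hcomp i)] with x hx hc i j
    have hk := hbd (fun i j => classicalJacobian φ x i j)
      (fun i j => (hx i j).1.trans (min_le_left _ _)) i j
    refine ⟨hk.1, fun k => ?_⟩
    have e := hc i j k
    have e2 := (abs_clm_apply_le hk.2 hδ0 fun i j => (hx i j).2 k).trans hMδ
    rw [← e] at e2
    exact e2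
  have t1 : ∀ i j, eLpNorm (fun x => matrixDefect (classicalJacobian φ x) i j) ∞ (vol Ω)
      ≤ ENNReal.ofReal (ε / 16) := fun i j => by
    rw [eLpNorm_exponent_top]
    refine eLpNormEssSup_le_of_ae_bound ?_
    filter_upwards [hb] with x hx using (hx i j).1
  have t2 : ∀ i, eLpNorm (fun x => ∑ j, classicalPartial j
      (fun y => matrixDefect (classicalJacobian φ y) i j) x) ∞ (vol Ω)
      ≤ ENNReal.ofReal (ε / 8) := fun i => by
    rw [eLpNorm_exponent_top]
    refine eLpNormEssSup_le_of_ae_bound ?_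
    filter_upwards [hb] with x hx
    rw [Fin.sum_univ_two]
    refine (norm_add_le _ _).trans ?_
    have := (hx i 0).2 0
    have := (hx i 1).2 1
    simp only [Real.norm_eq_abs]
    linarith
  rw [h.constK_eq hJ]
  calc _ ≤ (∑ _i : Fin 2, ∑ _j : Fin 2, ENNReal.ofReal (ε / 16))
        + ∑ _i : Fin 2, ENNReal.ofReal (ε / 8) :=
        add_le_add (Finset.sum_le_sum fun i _ => Finset.sum_le_sum fun j _ => t1 i j)
          (Finset.sum_le_sum fun i _ => t2 i)
    _ = ENNReal.ofReal (ε / 2) := by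
        simp only [Fin.sum_univ_two]
        rw [← ENNReal.ofReal_add (by positivity) (by positivity),
          ← ENNReal.ofReal_add (by positivity) (by positivity),
          ← ENNReal.ofReal_add (by positivity) (by positivity),
          ← ENNReal.ofReal_add (by positivity) (by positivity)]
        congr 1
        ring
    _ < ENNReal.ofReal ε := (ENNReal.ofReal_lt_ofReal_iff hε).2 (by linarith)

end Defect

/-! ### Comparison of the two inverse Laplacians -/

section Comparison

variable {Ω Ω' : TopologicalSpace.Opens Plane} {φ : OpenPartialHomeomorph Plane Plane} {c C : ℝ}
  {p : ℝ≥0∞} [Fact (1 ≤ p)]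

namespace IsBoundedDiffeo

/-- The `L^p` norm of `(1 - |det Dφ|) f + div (M_φ ∇u)`, which is the right-hand side of the
Dirichlet problem comparing the two solutions. The divergence is expanded by the product rule, so
that only the entries of `M_φ` and the divergences of its rows occur, as in `K_φ`. -/
theorem eLpNorm_defect_le (h : IsBoundedDiffeo Ω Ω' φ c C)
    (hJ : jacobian Ω φ =ᵐ[vol Ω] classicalJacobian φ) {u : Plane → ℝ} (hu : MemSobolev 2 p Ω u)
    {f : Plane → ℝ} (hf : AEStronglyMeasurable f (vol Ω)) :
    eLpNorm (fun x => (1 - |(classicalJacobian φ x).det|) * f x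
      + ∑ k, ∑ l, matrixDefect (classicalJacobian φ x) k l
          * weakPartial Ω l (weakPartial Ω k u) x
      + ∑ k, (∑ l, classicalPartial l (fun y => matrixDefect (classicalJacobian φ y) k l) x)
          * weakPartial Ω k u x) p (vol Ω)
      ≤ eLpNorm (fun x => 1 - |(jacobian Ω φ x).det|) ∞ (vol Ω) * eLpNorm f p (vol Ω)
        + constK Ω φ * sobolevNorm 2 p Ω u := by
  have hp1 : 1 ≤ p := Fact.out
  have hmul : ∀ a b : Plane → ℝ, AEStronglyMeasurable b (vol Ω) →
      eLpNorm (fun x => a x * b x) p (vol Ω) ≤ eLpNorm a ∞ (vol Ω) * eLpNorm b p (vol Ω) :=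
    fun a b hb => eLpNorm_smul_le_eLpNorm_top_mul_eLpNorm p hb a
  have hJm : AEStronglyMeasurable (fun x => 1 - |(classicalJacobian φ x).det|) (vol Ω) :=
    (continuousOn_const.sub (continuousOn_det fun i j => (h.lipschitz i j).continuousOn).abs
      ).aestronglyMeasurable Ω.isOpen.measurableSet
  have hMm : ∀ k l, AEStronglyMeasurable (fun x => matrixDefect (classicalJacobian φ x) k l)
      (vol Ω) := fun k l =>
    (h.matrixDefect_lipschitz k l).continuousOn.aestronglyMeasurable Ω.isOpen.measurableSet
  have hDm : ∀ k, AEStronglyMeasurable (fun x => ∑ l, classicalPartial l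
      (fun y => matrixDefect (classicalJacobian φ y) k l) x) (vol Ω) := fun k =>
    (Finset.measurable_sum _ fun l _ => measurable_classicalPartial l _).aestronglyMeasurable
  have hum : ∀ k, AEStronglyMeasurable (weakPartial Ω k u) (vol Ω) := fun k =>
    (hu.weakPartial k).memLp.1
  have humm : ∀ k l, AEStronglyMeasurable (weakPartial Ω l (weakPartial Ω k u)) (vol Ω) :=
    fun k l => ((hu.weakPartial k).weakPartial l).memLp.1
  set a := fun k l => eLpNorm (fun x => matrixDefect (classicalJacobian φ x) k l) ∞ (vol Ω) with ha
  set b := fun k => eLpNorm (fun x => ∑ l, classicalPartial l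
    (fun y => matrixDefect (classicalJacobian φ y) k l) x) ∞ (vol Ω) with hb
  set v := fun k => eLpNorm (weakPartial Ω k u) p (vol Ω) with hv
  set w := fun k l => eLpNorm (weakPartial Ω l (weakPartial Ω k u)) p (vol Ω) with hw
  have s1 : eLpNorm (fun x => ∑ k, ∑ l, matrixDefect (classicalJacobian φ x) k l
      * weakPartial Ω l (weakPartial Ω k u) x) p (vol Ω) ≤ ∑ k, ∑ l, a k l * w k l := by
    have e : (fun x => ∑ k, ∑ l, matrixDefect (classicalJacobian φ x) k l
        * weakPartial Ω l (weakPartial Ω k u) x) = ∑ k, ∑ l, fun x =>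
        matrixDefect (classicalJacobian φ x) k l * weakPartial Ω l (weakPartial Ω k u) x := by
      funext x
      simp
    rw [e]
    refine (eLpNorm_sum_le (fun k _ => Finset.aestronglyMeasurable_sum _ fun l _ =>
      (hMm k l).mul (humm k l)) hp1).trans (Finset.sum_le_sum fun k _ => ?_)
    exact (eLpNorm_sum_le (fun l _ => (hMm k l).mul (humm k l)) hp1).trans
      (Finset.sum_le_sum fun l _ => hmul _ _ (humm k l))
  have s2 : eLpNorm (fun x => ∑ k, (∑ l, classicalPartial l
      (fun y => matrixDefect (classicalJacobian φ y) k l) x) * weakPartial Ω k u x) p (vol Ω)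
      ≤ ∑ k, b k * v k := by
    have e : (fun x => ∑ k, (∑ l, classicalPartial l
        (fun y => matrixDefect (classicalJacobian φ y) k l) x) * weakPartial Ω k u x)
        = ∑ k, fun x => (∑ l, classicalPartial l
          (fun y => matrixDefect (classicalJacobian φ y) k l) x) * weakPartial Ω k u x := by
      funext x
      simp
    rw [e]
    exact (eLpNorm_sum_le (fun k _ => (hDm k).mul (hum k)) hp1).trans
      (Finset.sum_le_sum fun k _ => hmul _ _ (hum k))
  have s0 : eLpNorm (fun x => (1 - |(classicalJacobian φ x).det|) * f x) p (vol Ω)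
      ≤ eLpNorm (fun x => 1 - |(jacobian Ω φ x).det|) ∞ (vol Ω) * eLpNorm f p (vol Ω) := by
    refine (hmul _ _ hf).trans_eq ?_
    congr 1
    refine eLpNorm_congr_ae ?_
    filter_upwards [hJ] with x hx
    rw [hx]
  have m1 : AEStronglyMeasurable (fun x => ∑ k, ∑ l, matrixDefect (classicalJacobian φ x) k l
      * weakPartial Ω l (weakPartial Ω k u) x) (vol Ω) :=
    Finset.aestronglyMeasurable_fun_sum _ fun k _ => Finset.aestronglyMeasurable_fun_sum _
      fun l _ => (hMm k l).mul (humm k l)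
  have m2 : AEStronglyMeasurable (fun x => ∑ k, (∑ l, classicalPartial l
      (fun y => matrixDefect (classicalJacobian φ y) k l) x) * weakPartial Ω k u x) (vol Ω) :=
    Finset.aestronglyMeasurable_fun_sum _ fun k _ => (hDm k).mul (hum k)
  refine (eLpNorm_add_le ((hJm.mul hf).add m1) m2 hp1).trans ?_
  refine (add_le_add_left (eLpNorm_add_le (hJm.mul hf) m1 hp1) _).trans ?_
  rw [add_assoc]
  refine add_le_add s0 ((add_le_add s1 s2).trans ?_)
  rw [h.constK_eq hJ]
  have hv' : ∀ k, v k ≤ sobolevNorm 2 p Ω u := fun k => by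
    have h1 : v k ≤ sobolevNorm 1 p Ω (weakPartial Ω k u) := le_self_add
    exact (h1.trans (Finset.single_le_sum (f := fun k => sobolevNorm 1 p Ω (weakPartial Ω k u))
      (fun _ _ => zero_le) (Finset.mem_univ k))).trans le_add_self
  have hw' : ∀ k l, w k l ≤ sobolevNorm 2 p Ω u := fun k l => by
    have h1 : w k l ≤ sobolevNorm 1 p Ω (weakPartial Ω k u) :=
      (Finset.single_le_sum (f := fun l => w k l) (fun _ _ => zero_le)
        (Finset.mem_univ l)).trans le_add_self
    exact (h1.trans (Finset.single_le_sum (f := fun k => sobolevNorm 1 p Ω (weakPartial Ω k u))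
      (fun _ _ => zero_le) (Finset.mem_univ k))).trans le_add_self
  rw [add_mul, Finset.sum_mul, Finset.sum_mul]
  refine add_le_add (Finset.sum_le_sum fun k _ => ?_) (Finset.sum_le_sum fun k _ =>
    mul_le_mul_right (hv' k) _)
  rw [Finset.sum_mul]
  exact Finset.sum_le_sum fun l _ => mul_le_mul_right (hw' k l) _

/-- The difference of `u = Δ_Ω⁻¹ f` and of the solution pulled back from `Ω'`: both are pulled back
from `Ω'`, where their difference solves a Dirichlet problem whose right-hand side is small. -/
theorem eLpNorm_sub_pulledInverse_le (h : IsBoundedDiffeo Ω Ω' φ c C) (hp : p ≠ ∞)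
    (hJ : jacobian Ω φ =ᵐ[vol Ω] classicalJacobian φ) (hΩ : LaplacianInvertible p Ω)
    (hΩ' : LaplacianInvertible p Ω') (f : LpOn p Ω) :
    ENNReal.ofReal c *
        eLpNorm (inverseLaplacian hΩ f - pulledInverse hΩ' φ f : LpOn p Ω) p (vol Ω)
      ≤ inverseLaplacianNorm hΩ' 0 *
        (eLpNorm (fun x => 1 - |(jacobian Ω φ x).det|) ∞ (vol Ω) * eLpNorm f p (vol Ω)
          + constK Ω φ * sobolevNorm 2 p Ω (inverseLaplacian hΩ f)) := by
  have hp1 : 1 ≤ p := Fact.out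
  have hp0 : p ≠ 0 := (zero_lt_one.trans_le hp1).ne'
  have hcomp := h.compWellDefined hp0 hp
  have hcomp' := h.compWellDefined_symm hp0 hp
  set u := inverseLaplacian hΩ f with hu
  have hum : MemSobolev 2 p Ω u := memSobolev_inverseLaplacian hΩ f
  have hΔu : weakLaplacian Ω u =ᵐ[vol Ω] f := weakLaplacian_inverseLaplacian hΩ f
  set f' : LpOn p Ω' := compLp φ.symm f with hf'
  set v := inverseLaplacian hΩ' f' with hv
  set W : LpOn p Ω' := (hcomp'.1 u (Lp.memLp u)).toLp _ with hW
  have hWe : W =ᵐ[vol Ω'] u ∘ φ.symm := MemLp.coeFn_toLp _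
  have hWm2 := h.memSobolev_two_comp_symm hp1 hp hum
  have hWX : W ∈ sobolevX p Ω' := ⟨hWm2.congr hWe.symm,
    (h.memSobolevZero_comp_symm hp1 hp (inverseLaplacian_mem hΩ f).2).congr hWe.symm⟩
  -- `W = u ∘ φ⁻¹` and `v = Δ_Ω'⁻¹ f'` both lie in `X_p(Ω')`, and `Δ(W - v) = (q / |det Dφ|) ∘ φ⁻¹`
  set q : Plane → ℝ := fun x => (1 - |(classicalJacobian φ x).det|) * f x
      + ∑ k, ∑ l, matrixDefect (classicalJacobian φ x) k l
          * weakPartial Ω l (weakPartial Ω k u) x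
      + ∑ k, (∑ l, classicalPartial l (fun y => matrixDefect (classicalJacobian φ y) k l) x)
          * weakPartial Ω k u x with hq
  set R : Plane → ℝ := (fun x => q x / |(classicalJacobian φ x).det|) ∘ φ.symm with hR
  have hΔW : weakLaplacian Ω' W - (f' : Plane → ℝ) =ᵐ[vol Ω'] R := by
    have e1 := weakLaplacian_congr hWm2 hWe.symm
    have e2 := h.weakLaplacian_comp_symm hp1 hp hum
    have e3 := coeFn_compLp hcomp' f
    have e4 := h.comp_symm_ae_eq hΔu
    filter_upwards [e1, e2, e3, e4, ae_restrict_mem Ω'.isOpen.measurableSet] with y h1 h2 h3 h4 hy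
    have hdet : |(classicalJacobian φ (φ.symm y)).det| ≠ 0 :=
      abs_ne_zero.2 (h.det_ne_zero (h.mapsTo_symm hy))
    simp only [Function.comp_apply] at h2 h3 h4
    rw [Pi.sub_apply, h1, h2, hf', h3, h4, hR, Function.comp_apply, hq]
    simp only
    rw [div_sub' hdet]
    congr 1
    ring
  have hRm : MemLp R p (vol Ω') :=
    (memLp_congr_ae hΔW).1 ((memLp_weakLaplacian hWX.1).sub (Lp.memLp f'))
  have hWv : W - v = inverseLaplacian hΩ' (hRm.toLp R) := by
    have e1 : W = inverseLaplacian hΩ' ((memLp_weakLaplacian hWX.1).toLp _) :=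
      eq_inverseLaplacian hΩ' hWX (MemLp.coeFn_toLp _).symm
    rw [hv]
    nth_rewrite 1 [e1]
    rw [← map_sub]
    congr 1
    refine Lp.ext ((Lp.coeFn_sub _ _).trans (EventuallyEq.trans ?_ (MemLp.coeFn_toLp _).symm))
    filter_upwards [MemLp.coeFn_toLp (memLp_weakLaplacian hWX.1), hΔW] with y h1 h2
    rw [Pi.sub_apply, h1]
    exact h2
  have hpull : (inverseLaplacian hΩ f - pulledInverse hΩ' φ f : LpOn p Ω)
      =ᵐ[vol Ω] (W - v : LpOn p Ω') ∘ φ := by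
    have e1 := h.comp_ae_eq (Lp.coeFn_sub W v)
    have e2 := h.comp_ae_eq hWe
    have e3 : pulledInverse hΩ' φ f =ᵐ[vol Ω] v ∘ φ := coeFn_compLp hcomp v
    filter_upwards [Lp.coeFn_sub (inverseLaplacian hΩ f) (pulledInverse hΩ' φ f), e1, e2, e3,
      ae_restrict_mem Ω.isOpen.measurableSet] with x h1 h2 h3 h4 hx
    simp only [Function.comp_apply, Pi.sub_apply, h.left_inv hx] at h1 h2 h3 h4 ⊢
    rw [h1, h2, h3, h4]
  set N := inverseLaplacianNorm hΩ' 0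
  set cp := ENNReal.ofReal c ^ (1 / p.toReal) with hcp
  set X := eLpNorm (inverseLaplacian hΩ f - pulledInverse hΩ' φ f : LpOn p Ω) p (vol Ω) with hX
  have b1 : cp * X ≤ eLpNorm (W - v : LpOn p Ω') p (vol Ω') := by
    rw [hX, eLpNorm_congr_ae hpull]
    exact h.eLpNorm_comp_le hp0 hp _
  have b2 : eLpNorm (W - v : LpOn p Ω') p (vol Ω') ≤ N * eLpNorm R p (vol Ω') := by
    have := sobolevNorm_inverseLaplacian_le hΩ' (Nat.zero_le 2) (hRm.toLp R)
    rw [← hWv, Lp.enorm_def, eLpNorm_congr_ae hRm.coeFn_toLp] at this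
    exact this
  have b3 : ENNReal.ofReal c * eLpNorm R p (vol Ω') ≤ cp * eLpNorm q p (vol Ω) :=
    h.eLpNorm_div_comp_symm_le hp1 hp q
  have b4 := h.eLpNorm_defect_le hJ hum (Lp.memLp f).1
  have hc0 : ENNReal.ofReal c ≠ 0 := by simpa using h.pos
  have hcp0 : cp ≠ 0 := by simp [hcp, ENNReal.rpow_eq_zero_iff, h.pos]
  have hcpt : cp ≠ ∞ := ENNReal.rpow_ne_top_of_nonneg (by positivity) ENNReal.ofReal_ne_top
  refine le_trans ?_ (mul_le_mul_right b4 N)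
  -- the two changes of variables contribute `c ^ (-1 / p)` and `c ^ (1 / p - 1)`
  refine (ENNReal.mul_le_mul_iff_right hcp0 hcpt).1 ?_
  calc cp * (ENNReal.ofReal c * X) = ENNReal.ofReal c * (cp * X) := by ring
    _ ≤ ENNReal.ofReal c * (N * eLpNorm R p (vol Ω')) :=
        mul_le_mul_right (b1.trans b2) _
    _ = N * (ENNReal.ofReal c * eLpNorm R p (vol Ω')) := by ring
    _ ≤ N * (cp * eLpNorm q p (vol Ω)) := mul_le_mul_right b3 _
    _ = cp * (N * eLpNorm q p (vol Ω)) := by ring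

theorem exists_pulledInverse_clm (h : IsBoundedDiffeo Ω Ω' φ c C) (hp : p ≠ ∞)
    (hΩ' : LaplacianInvertible p Ω') :
    ∃ Tφ : LpOn p Ω →L[ℝ] LpOn p Ω, ∀ u, Tφ u = pulledInverse hΩ' φ u := by
  have hp0 : p ≠ 0 := (zero_lt_one.trans_le (Fact.out : 1 ≤ p)).ne'
  have hc0 : ENNReal.ofReal c ^ (1 / p.toReal) ≠ 0 := by
    simp [ENNReal.rpow_eq_zero_iff, h.pos]
  have hct : ENNReal.ofReal c ^ (1 / p.toReal) ≠ ∞ :=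
    ENNReal.rpow_ne_top_of_nonneg (by positivity) ENNReal.ofReal_ne_top
  obtain ⟨L₁, hL₁⟩ := exists_compLp_clm (h.compWellDefined hp0 hp)
    (ENNReal.inv_ne_top.2 hc0) fun v => by
      rw [← ENNReal.div_eq_inv_mul, ENNReal.le_div_iff_mul_le (Or.inl hc0) (Or.inl hct), mul_comm]
      exact h.eLpNorm_comp_le hp0 hp v
  obtain ⟨L₂, hL₂⟩ := exists_compLp_clm (h.compWellDefined_symm hp0 hp)
    (ENNReal.rpow_ne_top_of_nonneg (by positivity) ENNReal.ofReal_ne_top)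
    (h.eLpNorm_comp_symm_le hp0 hp)
  obtain ⟨T, hT⟩ := exists_inverseLaplacian_clm hΩ'
  refine ⟨L₁ ∘L T ∘L L₂, fun u => ?_⟩
  rw [ContinuousLinearMap.comp_apply, ContinuousLinearMap.comp_apply, hL₂, hT, hL₁, pulledInverse]

end IsBoundedDiffeo

theorem enorm_le_of_forall_enorm_le {E F : Type*} [NormedAddCommGroup E] [NormedSpace ℝ E]
    [NormedAddCommGroup F] [NormedSpace ℝ F] (L : E →L[ℝ] F) {D : ℝ≥0∞}
    (h : ∀ x, ‖L x‖ₑ ≤ D * ‖x‖ₑ) : ‖L‖ₑ ≤ D := by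
  rcases eq_or_ne D ∞ with rfl | hD
  · exact le_top
  rw [← ofReal_norm, ENNReal.ofReal_le_iff_le_toReal hD]
  refine L.opNorm_le_bound ENNReal.toReal_nonneg fun x => ?_
  have h1 := ENNReal.toReal_mono (ENNReal.mul_ne_top hD (by simp)) (h x)
  rwa [ENNReal.toReal_mul, toReal_enorm, toReal_enorm] at h1

end Comparison

end DirichletPerturbation

open DirichletPerturbation in
theorem mainTheorem2 (p : ℝ≥0∞) [Fact (1 ≤ p)] (hp : 1 < p) (hp' : p ≠ ∞) :
    (∃ C : ℝ, 0 < C ∧ ∀ (Ω Ω' : TopologicalSpace.Opens Plane)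
      (φ : OpenPartialHomeomorph Plane Plane) (h : Admissible p Ω Ω' φ),
      CompWellDefined p Ω Ω' φ ∧ CompWellDefined p Ω' Ω φ.symm ∧
      (∀ i j, MemSobolev 1 ∞ Ω (fun x => defectMatrix Ω φ x i j)) ∧
      constK Ω φ ≠ ∞ ∧
      inverseLaplacianNorm h.invertible_source 2 ≠ ∞ ∧
      inverseLaplacianNorm h.invertible_target 0 ≠ ∞ ∧
      ∃ T Tφ : LpOn p Ω →L[ℝ] LpOn p Ω,
        (∀ u, T u = inverseLaplacian h.invertible_source u) ∧
        (∀ u, Tφ u = pulledInverse h.invertible_target φ u) ∧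
        ‖T - Tφ‖ₑ ≤
          ENNReal.ofReal C *
            (inverseLaplacianNorm h.invertible_target 0 *
              (1 + inverseLaplacianNorm h.invertible_source 2)) *
          (ENNReal.ofReal (1 / jacobianInf Ω φ) *
            (eLpNorm (fun x => 1 - |(jacobian Ω φ x).det|) ∞ (vol Ω) + constK Ω φ))) ∧
    (∀ ε : ℝ, 0 < ε → ∃ δ : ℝ, 0 < δ ∧ ∀ (Ω Ω' : TopologicalSpace.Opens Plane)
      (φ : OpenPartialHomeomorph Plane Plane), Admissible p Ω Ω' φ →
      distToId Ω φ < ENNReal.ofReal δ → constK Ω φ < ENNReal.ofReal ε) := by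
  have hp0 : p ≠ 0 := (zero_lt_one.trans hp).ne'
  -- the constant `C_p` may be taken to be `1` for every `p`
  refine ⟨⟨1, one_pos, fun Ω Ω' φ h => ?_⟩, fun ε hε => ?_⟩
  · obtain ⟨C, hd⟩ := h.isBoundedDiffeo
    have hJ := h.jacobian_ae_eq
    obtain ⟨T, hT⟩ := exists_inverseLaplacian_clm h.invertible_source
    obtain ⟨Tφ, hTφ⟩ := hd.exists_pulledInverse_clm hp' h.invertible_target
    refine ⟨hd.compWellDefined hp0 hp', hd.compWellDefined_symm hp0 hp',
      hd.memSobolev_defectMatrix hJ, hd.constK_ne_top hJ, inverseLaplacianNorm_two_ne_top _,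
      inverseLaplacianNorm_zero_ne_top _, T, Tφ, hT, hTφ, enorm_le_of_forall_enorm_le _ fun f => ?_⟩
    rw [sub_apply, hT, hTφ, Lp.enorm_def, Lp.enorm_def]
    have key := hd.eLpNorm_sub_pulledInverse_le hp' hJ h.invertible_source h.invertible_target f
    have h2 := sobolevNorm_inverseLaplacian_le h.invertible_source le_rfl f
    rw [Lp.enorm_def] at h2
    set X := eLpNorm (inverseLaplacian h.invertible_source f
      - pulledInverse h.invertible_target φ f : LpOn p Ω) p (vol Ω)
    set N := inverseLaplacianNorm h.invertible_target 0
    set N₂ := inverseLaplacianNorm h.invertible_source 2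
    set J := eLpNorm (fun x => 1 - |(jacobian Ω φ x).det|) ∞ (vol Ω)
    set K := constK Ω φ
    set F := eLpNorm f p (vol Ω)
    have hc := h.inf_pos
    have hinv : ENNReal.ofReal (1 / jacobianInf Ω φ) * ENNReal.ofReal (jacobianInf Ω φ) = 1 := by
      rw [← ENNReal.ofReal_mul (by positivity), one_div_mul_cancel hc.ne', ENNReal.ofReal_one]
    calc X = ENNReal.ofReal (1 / jacobianInf Ω φ) * (ENNReal.ofReal (jacobianInf Ω φ) * X) := by
          rw [← mul_assoc, hinv, one_mul]
      _ ≤ ENNReal.ofReal (1 / jacobianInf Ω φ) * (N * (J * F + K * (N₂ * F))) := by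
          exact mul_le_mul_right
            (key.trans (mul_le_mul_right (add_le_add le_rfl (mul_le_mul_right h2 _)) _)) _
      -- the added terms complete the sum to the product `(1 + N₂) * (J + K) * F`
      _ ≤ ENNReal.ofReal (1 / jacobianInf Ω φ)
            * (N * ((J * F + K * (N₂ * F)) + (K * F + J * (N₂ * F)))) := by
          exact mul_le_mul_right (mul_le_mul_right le_self_add _) _
      _ = _ := by
          rw [ENNReal.ofReal_one]
          ring
  · obtain ⟨δ, hδ, hK⟩ := exists_constK_lt hε
    refine ⟨δ, hδ, fun Ω Ω' φ h hd => ?_⟩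
    obtain ⟨C, hB⟩ := h.isBoundedDiffeo
    exact hK Ω Ω' φ _ C hB h.jacobian_ae_eq hd
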